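/- **Theorem (polynomial-time decidability of equality in $\Sigma\Pi[\emptyset]$).** Types are generated from $0$ and $1$ by binary $+$ and $\times$, and the size of a type is given by $|0|=|1|=1$ and $|X+Y|=|X\times Y|=1+|X|+|Y|$. Let $\Sigma\Pi[\emptyset]$ be the initial category with (chosen) finite sums and products: its objects are the types, and its arrows are the formal expressions built from identities, composition, injections, projections, (co)tuples and the unique arrows out of $0$ and into $1$, modulo the equations valid in all categories with chosen finite sums and products. A (cut-free) term $t:X\to A$ is one built by the rules $\{\,\}:0\to A$; $\ \langle\,\rangle:X\to 1$; $\ \sigma_i(t):X\to A_0+A_1$ for $t:X\to A_i$; $\ \pi_i(t):X_0\times X_1\to A$ for $t:X_i\to A$; $\ \{t_0,t_1\}:X_0+X_1\to A$ for $t_i:X_i\to A$; $\ \langle t_0,t_1\rangle:X\to A_0\times A_1$ for $t_i:X\to A_i$. It denotes the evident arrow $X\to A$ of $\Sigma\Pi[\emptyset]$. There are a deterministic multi-stack Turing machine $M$ with finite alphabets and a polynomial $p$ with natural number coefficients such that, for all types $X,A$ and all terms $f,g:X\to A$, the machine $M$, started on the word that consists of $X,A,f,g$ in prefix notation, halts after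 at most $p(|X|\cdot|A|)$ steps with the correct answer to the question whether $f$ and $g$ denote the same arrow of $\Sigma\Pi[\emptyset]$. -/

import Mathlib

namespace SumProd

/-- The objects of `ΣΠ[∅]` (no atoms): generated from the initial object `zero` and the final
object `one` by binary sums `add` and binary products `mul`. -/
inductive Ty : Type
  | zero : Ty
  | one : Ty
  | add : Ty → Ty → Ty
  | mul : Ty → Ty → Ty

/-- The size of a type: the number of nodes of its syntax tree. -/
def Ty.size : Ty → ℕ
  | .zero => 1
  | .one => 1
  | .add X Y => 1 + X.size + Y.size
  | .mul X Y => 1 + X.size + Y.size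

/-- Formal arrows generated by the operations of a category with chosen finite sums and products
(composition is written in diagrammatic order). -/
inductive Arr : Ty → Ty → Type
  | id (X : Ty) : Arr X X
  | comp {X Y Z : Ty} : Arr X Y → Arr Y Z → Arr X Z
  | fromZero (A : Ty) : Arr .zero A
  | toOne (X : Ty) : Arr X .one
  | inl (A B : Ty) : Arr A (.add A B)
  | inr (A B : Ty) : Arr B (.add A B)
  | cotuple {X Y A : Ty} : Arr X A → Arr Y A → Arr (.add X Y) A
  | fst (X Y : Ty) : Arr (.mul X Y) X
  | snd (X Y : Ty) : Arr (.mul X Y) Y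
  | tuple {X A B : Ty} : Arr X A → Arr X B → Arr X (.mul A B)

/-- The least congruence on formal arrows containing the equations of categories with finite sums
and products: the category laws and the universal properties of `zero`, `one`, `add`, `mul`. -/
inductive Arr.Eqv : {X A : Ty} → Arr X A → Arr X A → Prop
  | refl {X A : Ty} (f : Arr X A) : Eqv f f
  | symm {X A : Ty} {f g : Arr X A} : Eqv f g → Eqv g f
  | trans {X A : Ty} {f g h : Arr X A} : Eqv f g → Eqv g h → Eqv f h
  | comp_congr {X Y Z : Ty} {f f' : Arr X Y} {g g' : Arr Y Z} :
      Eqv f f' → Eqv g g' → Eqv (.comp f g) (.comp f' g')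
  | cotuple_congr {X Y A : Ty} {f f' : Arr X A} {g g' : Arr Y A} :
      Eqv f f' → Eqv g g' → Eqv (.cotuple f g) (.cotuple f' g')
  | tuple_congr {X A B : Ty} {f f' : Arr X A} {g g' : Arr X B} :
      Eqv f f' → Eqv g g' → Eqv (.tuple f g) (.tuple f' g')
  | id_comp {X A : Ty} (f : Arr X A) : Eqv (.comp (.id X) f) f
  | comp_id {X A : Ty} (f : Arr X A) : Eqv (.comp f (.id A)) f
  | assoc {X Y Z W : Ty} (f : Arr X Y) (g : Arr Y Z) (h : Arr Z W) :
      Eqv (.comp (.comp f g) h) (.comp f (.comp g h))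
  | zero_uniq {A : Ty} (f : Arr .zero A) : Eqv f (.fromZero A)
  | one_uniq {X : Ty} (f : Arr X .one) : Eqv f (.toOne X)
  | inl_cotuple {X Y A : Ty} (f : Arr X A) (g : Arr Y A) :
      Eqv (.comp (.inl X Y) (.cotuple f g)) f
  | inr_cotuple {X Y A : Ty} (f : Arr X A) (g : Arr Y A) :
      Eqv (.comp (.inr X Y) (.cotuple f g)) g
  | cotuple_uniq {X Y A : Ty} (h : Arr (.add X Y) A) :
      Eqv (.cotuple (.comp (.inl X Y) h) (.comp (.inr X Y) h)) h
  | tuple_fst {X A B : Ty} (f : Arr X A) (g : Arr X B) :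
      Eqv (.comp (.tuple f g) (.fst A B)) f
  | tuple_snd {X A B : Ty} (f : Arr X A) (g : Arr X B) :
      Eqv (.comp (.tuple f g) (.snd A B)) g
  | tuple_uniq {X A B : Ty} (h : Arr X (.mul A B)) :
      Eqv (.tuple (.comp h (.fst A B)) (.comp h (.snd A B))) h

/-- Provable equality of formal arrows, as a setoid. -/
instance Arr.setoid (X A : Ty) : Setoid (Arr X A) where
  r := Arr.Eqv
  iseqv := ⟨Arr.Eqv.refl, Arr.Eqv.symm, Arr.Eqv.trans⟩

/-- `ΣΠ[∅]`, the initial category with (chosen) finite sums and products: its arrows are the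
formal arrows modulo the equations that hold in all such categories. -/
instance Ty.category : CategoryTheory.Category Ty where
  Hom X A := Quotient (Arr.setoid X A)
  id X := Quotient.mk _ (Arr.id X)
  comp f g := Quotient.map₂ Arr.comp (fun _ _ h _ _ k => Arr.Eqv.comp_congr h k) f g
  id_comp f := Quotient.inductionOn f fun f => Quotient.sound (Arr.Eqv.id_comp f)
  comp_id f := Quotient.inductionOn f fun f => Quotient.sound (Arr.Eqv.comp_id f)
  assoc f g h := Quotient.inductionOn₃ f g h fun f g h => Quotient.sound (Arr.Eqv.assoc f g h)

/-- The arrow of `ΣΠ[∅]` named by a formal arrow. -/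
def Arr.toHom {X A : Ty} (f : Arr X A) : X ⟶ A := Quotient.mk (Arr.setoid X A) f

/-- The terms of the cut-free calculus without atoms: the derivations of `X ⊢ A`, i.e.
`{}`, `⟨⟩`, `σ₀(t)`, `σ₁(t)`, `π₀(t)`, `π₁(t)`, `{t₀, t₁}` and `⟨t₀, t₁⟩`. -/
inductive Term : Ty → Ty → Type
  | cotuple₀ {A : Ty} : Term .zero A
  | tuple₀ {X : Ty} : Term X .one
  | inj₀ {X A B : Ty} : Term X A → Term X (.add A B)
  | inj₁ {X A B : Ty} : Term X B → Term X (.add A B)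
  | proj₀ {X Y A : Ty} : Term X A → Term (.mul X Y) A
  | proj₁ {X Y A : Ty} : Term Y A → Term (.mul X Y) A
  | cotuple {X Y A : Ty} : Term X A → Term Y A → Term (.add X Y) A
  | tuple {X A B : Ty} : Term X A → Term X B → Term X (.mul A B)

/-- The formal arrow that a cut-free term stands for. -/
def Term.toArr : {X A : Ty} → Term X A → Arr X A
  | _, _, .cotuple₀ => .fromZero _
  | _, _, .tuple₀ => .toOne _
  | _, _, .inj₀ t => .comp t.toArr (.inl _ _)
  | _, _, .inj₁ t => .comp t.toArr (.inr _ _)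
  | _, _, .proj₀ t => .comp (.fst _ _) t.toArr
  | _, _, .proj₁ t => .comp (.snd _ _) t.toArr
  | _, _, .cotuple s t => .cotuple s.toArr t.toArr
  | _, _, .tuple s t => .tuple s.toArr t.toArr

/-- The arrow of `ΣΠ[∅]` that a cut-free term denotes. -/
def Term.denote {X A : Ty} (t : Term X A) : X ⟶ A := t.toArr.toHom

/-- The input alphabet: one letter for each type former and each term former. -/
inductive Letter : Type
  | zero | one | add | mul
  | cotuple₀ | tuple₀ | inj₀ | inj₁ | proj₀ | proj₁ | cotuple | tuple

/-- A type in prefix (Polish) notation. -/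
def Ty.encode : Ty → List Letter
  | .zero => [.zero]
  | .one => [.one]
  | .add X Y => .add :: (X.encode ++ Y.encode)
  | .mul X Y => .mul :: (X.encode ++ Y.encode)

/-- A cut-free term in prefix (Polish) notation. -/
def Term.encode : {X A : Ty} → Term X A → List Letter
  | _, _, .cotuple₀ => [.cotuple₀]
  | _, _, .tuple₀ => [.tuple₀]
  | _, _, .inj₀ t => .inj₀ :: t.encode
  | _, _, .inj₁ t => .inj₁ :: t.encode
  | _, _, .proj₀ t => .proj₀ :: t.encode
  | _, _, .proj₁ t => .proj₁ :: t.encode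
  | _, _, .cotuple s t => .cotuple :: (s.encode ++ t.encode)
  | _, _, .tuple s t => .tuple :: (s.encode ++ t.encode)

/-- An instance of the word problem: two parallel cut-free terms. -/
structure WordProblem : Type where
  /-- the common domain -/
  dom : Ty
  /-- the common codomain -/
  cod : Ty
  /-- the first term -/
  left : Term dom cod
  /-- the second term -/
  right : Term dom cod

/-- The input word: domain, codomain and the two terms, one after the other. -/
def WordProblem.encode (w : WordProblem) : List Letter :=
  w.dom.encode ++ w.cod.encode ++ w.left.encode ++ w.right.encode

/-- The predicate `P` can be decided in time polynomial in `size`: some multi-stack Turing machine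
with finite alphabets, started on `enc a`, halts with the one-letter output telling whether `P a`
holds, within `p (size a)` steps, for one polynomial `p`. -/
def DecidableInPolyTime {α Γ : Type} (enc : α → List Γ) (size : α → ℕ) (P : α → Prop) : Prop :=
  ∃ (M : Turing.TM2ComputableAux Γ Bool) (p : Polynomial ℕ),
    (∀ k, Finite (M.tm.Γ k)) ∧
    ∀ a : α, ∃ b : Bool, (b = true ↔ P a) ∧
      Nonempty (Turing.TM2OutputsInTime M.tm ((enc a).map M.inputAlphabet.symm)
        (some ([b].map M.outputAlphabet.symm)) (p.eval (size a)))

end SumProd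

/-! A formal arrow acts on cut-free terms by composition, and the universal properties hold for this
action up to the permuting conversions `Conv`. Evaluating at the identity term recovers a term from
its action, so two terms denote the same arrow exactly when they are related by `Conv`
(`Term.denote_eq_iff`).

To decide `Conv` efficiently an invariant is used. A token is a pair (x, a) of nodes of the domain
and the codomain; a term places one token at each of its units, with x a leaf 0 for { } and a a leaf
1 for ⟨ ⟩. Units can be moved: out of 0, { } into a sum equals either injection of { }, and { } into
a product equals the pair of two { }; dually for ⟨ ⟩. The sets of tokens that respect these moves
are the `Closed` ones, and `Term.closure` is the least closed set that contains the tokens of a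
term. Conversions preserve it (`Conv.sat_iff`).

The heart is the converse, `Conv.of_closure_iff`, by induction on |X| + |A|. Tupling and cotupling
are invertible, and closures of the components can be read off. What remains is X₀ × X₁ → A₀ + A₁,
where a term starts with an injection or a projection. The closure of an injected term can be larger
than that of the term, because a token can leave the summand, travel through the other one, spread
over the domain and come back. Exactly then the term has a special form: it factors through 0
(`Conv.of_sat_elimZero`), through 1, through a projection (`Conv.exists_proj`) or through a given
injection (`Conv.exists_inj`). Without atoms every type has either a point or an arrow to 0, never
both (`Ty.pointed_dual`), and this controls which tokens can return.

For the complexity, nodes and subterms are represented by positions of the input word. Parsing,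
closing up the tokens and comparing the terms become finitely many Horn clauses over ternary
relations on positions; `SumProd.rules` derives `equal` exactly when the terms denote the same
arrow. The intended interpretation is a model (soundness), and in every model the tokens form a
closed set (completeness). The least model is reached after polynomially many passes. These are
carried out by a structured program on stacks, which is compiled to a multi-stack Turing machine
(`Datalog.exists_machine`). The word has length at most 4·|X|·|A|, which turns the bound in the
length into one in |X|·|A|. -/

namespace SumProd

/-! ### Cut elimination: equality of arrows is the congruence of permuting conversions. -/

/-- The congruence on cut-free terms generated by the permuting conversions. -/
inductive Conv : {X A : Ty} → Term X A → Term X A → Prop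
  | refl {X A : Ty} (f : Term X A) : Conv f f
  | symm {X A : Ty} {f g : Term X A} : Conv f g → Conv g f
  | trans {X A : Ty} {f g h : Term X A} : Conv f g → Conv g h → Conv f h
  | inj₀ {X A : Ty} (B : Ty) {f g : Term X A} :
      Conv f g → Conv (.inj₀ (B := B) f) (.inj₀ g)
  | inj₁ {X B : Ty} (A : Ty) {f g : Term X B} :
      Conv f g → Conv (.inj₁ (A := A) f) (.inj₁ g)
  | proj₀ {X A : Ty} (Y : Ty) {f g : Term X A} :
      Conv f g → Conv (.proj₀ (Y := Y) f) (.proj₀ g)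
  | proj₁ {Y A : Ty} (X : Ty) {f g : Term Y A} :
      Conv f g → Conv (.proj₁ (X := X) f) (.proj₁ g)
  | cotuple {X Y A : Ty} {f f' : Term X A} {g g' : Term Y A} :
      Conv f f' → Conv g g' → Conv (.cotuple f g) (.cotuple f' g')
  | tuple {X A B : Ty} {f f' : Term X A} {g g' : Term X B} :
      Conv f f' → Conv g g' → Conv (.tuple f g) (.tuple f' g')
  | zero {A : Ty} (f : Term .zero A) : Conv f .cotuple₀
  | one {X : Ty} (f : Term X .one) : Conv f .tuple₀
  | inj₀_cotuple {X Y A : Ty} (B : Ty) (f : Term X A) (g : Term Y A) :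
      Conv (.inj₀ (B := B) (.cotuple f g)) (.cotuple (.inj₀ f) (.inj₀ g))
  | inj₁_cotuple {X Y B : Ty} (A : Ty) (f : Term X B) (g : Term Y B) :
      Conv (.inj₁ (A := A) (.cotuple f g)) (.cotuple (.inj₁ f) (.inj₁ g))
  | proj₀_tuple {X A B : Ty} (Y : Ty) (f : Term X A) (g : Term X B) :
      Conv (.proj₀ (Y := Y) (.tuple f g)) (.tuple (.proj₀ f) (.proj₀ g))
  | proj₁_tuple {Y A B : Ty} (X : Ty) (f : Term Y A) (g : Term Y B) :
      Conv (.proj₁ (X := X) (.tuple f g)) (.tuple (.proj₁ f) (.proj₁ g))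
  | cotuple_tuple {X Y A B : Ty} (a : Term X A) (b : Term X B) (c : Term Y A) (d : Term Y B) :
      Conv (.cotuple (.tuple a b) (.tuple c d)) (.tuple (.cotuple a c) (.cotuple b d))
  | proj₀_inj₀ {X A : Ty} (Y B : Ty) (f : Term X A) :
      Conv (.proj₀ (Y := Y) (.inj₀ (B := B) f)) (.inj₀ (.proj₀ f))
  | proj₀_inj₁ {X B : Ty} (Y A : Ty) (f : Term X B) :
      Conv (.proj₀ (Y := Y) (.inj₁ (A := A) f)) (.inj₁ (.proj₀ f))
  | proj₁_inj₀ {Y A : Ty} (X B : Ty) (f : Term Y A) :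
      Conv (.proj₁ (X := X) (.inj₀ (B := B) f)) (.inj₀ (.proj₁ f))
  | proj₁_inj₁ {Y B : Ty} (X A : Ty) (f : Term Y B) :
      Conv (.proj₁ (X := X) (.inj₁ (A := A) f)) (.inj₁ (.proj₁ f))

namespace Arr.Eqv

theorem comp_left {X Y Z : Ty} {f f' : Arr X Y} (h : Eqv f f') (g : Arr Y Z) :
    Eqv (.comp f g) (.comp f' g) := comp_congr h (refl g)

theorem comp_right {X Y Z : Ty} (f : Arr X Y) {g g' : Arr Y Z} (h : Eqv g g') :
    Eqv (.comp f g) (.comp f g') := comp_congr (refl f) h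

theorem cotuple_ext {X Y A : Ty} {f g : Arr (.add X Y) A}
    (hl : Eqv (.comp (.inl X Y) f) (.comp (.inl X Y) g))
    (hr : Eqv (.comp (.inr X Y) f) (.comp (.inr X Y) g)) : Eqv f g :=
  (cotuple_uniq f).symm.trans ((cotuple_congr hl hr).trans (cotuple_uniq g))

theorem tuple_ext {X A B : Ty} {f g : Arr X (.mul A B)}
    (hl : Eqv (.comp f (.fst A B)) (.comp g (.fst A B)))
    (hr : Eqv (.comp f (.snd A B)) (.comp g (.snd A B))) : Eqv f g :=
  (tuple_uniq f).symm.trans ((tuple_congr hl hr).trans (tuple_uniq g))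

theorem cotuple_comp {X Y A B : Ty} (f : Arr X A) (g : Arr Y A) (h : Arr A B) :
    Eqv (.comp (.cotuple f g) h) (.cotuple (.comp f h) (.comp g h)) :=
  cotuple_ext
    ((assoc _ _ _).symm.trans ((comp_left (inl_cotuple f g) h).trans (inl_cotuple _ _).symm))
    ((assoc _ _ _).symm.trans ((comp_left (inr_cotuple f g) h).trans (inr_cotuple _ _).symm))

theorem comp_tuple {X Y A B : Ty} (h : Arr X Y) (f : Arr Y A) (g : Arr Y B) :
    Eqv (.comp h (.tuple f g)) (.tuple (.comp h f) (.comp h g)) :=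
  tuple_ext
    ((assoc _ _ _).trans ((comp_right h (tuple_fst f g)).trans (tuple_fst _ _).symm))
    ((assoc _ _ _).trans ((comp_right h (tuple_snd f g)).trans (tuple_snd _ _).symm))

theorem cotuple_tuple {X Y A B : Ty} (a : Arr X A) (b : Arr X B) (c : Arr Y A) (d : Arr Y B) :
    Eqv (.cotuple (.tuple a b) (.tuple c d)) (.tuple (.cotuple a c) (.cotuple b d)) :=
  tuple_ext
    ((cotuple_comp _ _ _).trans
      ((cotuple_congr (tuple_fst a b) (tuple_fst c d)).trans (tuple_fst _ _).symm))
    ((cotuple_comp _ _ _).trans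
      ((cotuple_congr (tuple_snd a b) (tuple_snd c d)).trans (tuple_snd _ _).symm))

end Arr.Eqv

theorem Conv.eqv {X A : Ty} {f g : Term X A} (h : Conv f g) : Arr.Eqv f.toArr g.toArr := by
  induction h with
  | refl f => exact .refl _
  | symm _ ih => exact ih.symm
  | trans _ _ ih ih' => exact ih.trans ih'
  | inj₀ _ _ ih => exact ih.comp_left _
  | inj₁ _ _ ih => exact ih.comp_left _
  | proj₀ _ _ ih => exact ih.comp_right _
  | proj₁ _ _ ih => exact ih.comp_right _
  | cotuple _ _ ih ih' => exact .cotuple_congr ih ih'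
  | tuple _ _ ih ih' => exact .tuple_congr ih ih'
  | zero f => exact .zero_uniq _
  | one f => exact .one_uniq _
  | inj₀_cotuple => exact .cotuple_comp _ _ _
  | inj₁_cotuple => exact .cotuple_comp _ _ _
  | proj₀_tuple => exact .comp_tuple _ _ _
  | proj₁_tuple => exact .comp_tuple _ _ _
  | cotuple_tuple => exact .cotuple_tuple _ _ _ _
  | proj₀_inj₀ => exact (Arr.Eqv.assoc _ _ _).symm
  | proj₀_inj₁ => exact (Arr.Eqv.assoc _ _ _).symm
  | proj₁_inj₀ => exact (Arr.Eqv.assoc _ _ _).symm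
  | proj₁_inj₁ => exact (Arr.Eqv.assoc _ _ _).symm

namespace Term

/-- Composition with the unique arrow out of the initial object. -/
def elimZero {A : Ty} : {Z C : Ty} → Term Z C → C = .zero → Term Z A
  | _, _, .cotuple₀, _ => .cotuple₀
  | _, _, .proj₀ t, h => .proj₀ (t.elimZero h)
  | _, _, .proj₁ t, h => .proj₁ (t.elimZero h)
  | _, _, .cotuple s t, h => .cotuple (s.elimZero h) (t.elimZero h)

/-- Composition with the cotuple of two arrows, given by their actions on terms. -/
def elimAdd {X Y A : Ty} (F : ∀ Z, Term Z X → Term Z A) (G : ∀ Z, Term Z Y → Term Z A) :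
    {Z C : Ty} → Term Z C → C = .add X Y → Term Z A
  | _, _, .cotuple₀, _ => .cotuple₀
  | _, _, .inj₀ t, h => F _ ((Ty.add.inj h).1 ▸ t)
  | _, _, .inj₁ t, h => G _ ((Ty.add.inj h).2 ▸ t)
  | _, _, .proj₀ t, h => .proj₀ (t.elimAdd F G h)
  | _, _, .proj₁ t, h => .proj₁ (t.elimAdd F G h)
  | _, _, .cotuple s t, h => .cotuple (s.elimAdd F G h) (t.elimAdd F G h)

/-- Composition with the first projection. -/
def fst {A B : Ty} : {Z C : Ty} → Term Z C → C = .mul A B → Term Z A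
  | _, _, .cotuple₀, _ => .cotuple₀
  | _, _, .proj₀ t, h => .proj₀ (t.fst h)
  | _, _, .proj₁ t, h => .proj₁ (t.fst h)
  | _, _, .cotuple s t, h => .cotuple (s.fst h) (t.fst h)
  | _, _, .tuple s _, h => (Ty.mul.inj h).1 ▸ s

/-- Composition with the second projection. -/
def snd {A B : Ty} : {Z C : Ty} → Term Z C → C = .mul A B → Term Z B
  | _, _, .cotuple₀, _ => .cotuple₀
  | _, _, .proj₀ t, h => .proj₀ (t.snd h)
  | _, _, .proj₁ t, h => .proj₁ (t.snd h)
  | _, _, .cotuple s t, h => .cotuple (s.snd h) (t.snd h)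
  | _, _, .tuple _ t, h => (Ty.mul.inj h).2 ▸ t

/-- The identity term. -/
def id : (X : Ty) → Term X X
  | .zero => .cotuple₀
  | .one => .tuple₀
  | .add X Y => .cotuple (.inj₀ (id X)) (.inj₁ (id Y))
  | .mul X Y => .tuple (.proj₀ (id X)) (.proj₁ (id Y))

end Term

/-- The action of a formal arrow on terms by composition (cut elimination). -/
def Arr.eval : {X A : Ty} → Arr X A → (Z : Ty) → Term Z X → Term Z A
  | _, _, .id _, _, t => t
  | _, _, .comp f g, Z, t => g.eval Z (f.eval Z t)
  | _, _, .fromZero _, _, t => t.elimZero rfl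
  | _, _, .toOne _, _, _ => .tuple₀
  | _, _, .inl _ _, _, t => .inj₀ t
  | _, _, .inr _ _, _, t => .inj₁ t
  | _, _, .cotuple f g, _, t => t.elimAdd f.eval g.eval rfl
  | _, _, .fst _ _, _, t => t.fst rfl
  | _, _, .snd _ _, _, t => t.snd rfl
  | _, _, .tuple f g, Z, t => .tuple (f.eval Z t) (g.eval Z t)

/-- Cut against a projection is well defined on conversion classes. The codomain is a variable with
an equation, since induction on `Conv` needs variable indices; the equation discards the rules for
other codomains. -/
theorem Conv.fst {Z C A B : Ty} {f g : Term Z C} (h : Conv f g) (hC : C = .mul A B) :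
    Conv (f.fst hC) (g.fst hC) := by
  induction h with
  | refl f => exact .refl _
  | symm _ ih => exact (ih hC).symm
  | trans _ _ ih ih' => exact (ih hC).trans (ih' hC)
  | proj₀ _ _ ih => exact .proj₀ _ (ih hC)
  | proj₁ _ _ ih => exact .proj₁ _ (ih hC)
  | cotuple _ _ ih ih' => exact .cotuple (ih hC) (ih' hC)
  | tuple h _ _ _ => cases hC; exact h
  | zero f => exact .zero _
  | proj₀_tuple | proj₁_tuple | cotuple_tuple => cases hC; exact .refl _
  | _ => cases hC

theorem Conv.snd {Z C A B : Ty} {f g : Term Z C} (h : Conv f g) (hC : C = .mul A B) :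
    Conv (f.snd hC) (g.snd hC) := by
  induction h with
  | refl f => exact .refl _
  | symm _ ih => exact (ih hC).symm
  | trans _ _ ih ih' => exact (ih hC).trans (ih' hC)
  | proj₀ _ _ ih => exact .proj₀ _ (ih hC)
  | proj₁ _ _ ih => exact .proj₁ _ (ih hC)
  | cotuple _ _ ih ih' => exact .cotuple (ih hC) (ih' hC)
  | tuple _ h _ _ => cases hC; exact h
  | zero f => exact .zero _
  | proj₀_tuple | proj₁_tuple | cotuple_tuple => cases hC; exact .refl _
  | _ => cases hC

theorem Conv.elimZero {Z C A : Ty} {f g : Term Z C} (h : Conv f g) (hC : C = .zero) :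
    Conv (f.elimZero (A := A) hC) (g.elimZero hC) := by
  induction h with
  | refl f => exact .refl _
  | symm _ ih => exact (ih hC).symm
  | trans _ _ ih ih' => exact (ih hC).trans (ih' hC)
  | proj₀ _ _ ih => exact .proj₀ _ (ih hC)
  | proj₁ _ _ ih => exact .proj₁ _ (ih hC)
  | cotuple _ _ ih ih' => exact .cotuple (ih hC) (ih' hC)
  | zero f => exact .zero _
  | _ => cases hC

/-- A family of maps between terms that respects conversion and commutes with the left rules. -/
structure Natural {X A : Ty} (F : ∀ Z, Term Z X → Term Z A) : Prop where
  congr {Z : Ty} {f g : Term Z X} : Conv f g → Conv (F Z f) (F Z g)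
  proj₀ {Z : Ty} (Y : Ty) (f : Term Z X) :
    Conv (F _ (.proj₀ (Y := Y) f)) (.proj₀ (F _ f))
  proj₁ {Z : Ty} (Y : Ty) (f : Term Z X) :
    Conv (F _ (.proj₁ (X := Y) f)) (.proj₁ (F _ f))
  cotuple {Z W : Ty} (f : Term Z X) (g : Term W X) :
    Conv (F _ (.cotuple f g)) (.cotuple (F _ f) (F _ g))

/-- A conversion may move a left rule across an injection, and `elimAdd` replaces the injection by
`F` or `G`. Congruence of these maps is therefore not enough: they must commute with the left rules.
-/
theorem Conv.elimAdd {X Y A : Ty} {F : ∀ Z, Term Z X → Term Z A} {G : ∀ Z, Term Z Y → Term Z A}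
    (hF : Natural F) (hG : Natural G) {Z C : Ty} {f g : Term Z C} (h : Conv f g)
    (hC : C = .add X Y) : Conv (f.elimAdd F G hC) (g.elimAdd F G hC) := by
  induction h with
  | refl f => exact .refl _
  | symm _ ih => exact (ih hC).symm
  | trans _ _ ih ih' => exact (ih hC).trans (ih' hC)
  | inj₀ _ h _ => cases hC; exact hF.congr h
  | inj₁ _ h _ => cases hC; exact hG.congr h
  | proj₀ _ _ ih => exact .proj₀ _ (ih hC)
  | proj₁ _ _ ih => exact .proj₁ _ (ih hC)
  | cotuple _ _ ih ih' => exact .cotuple (ih hC) (ih' hC)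
  | zero f => exact .zero _
  | inj₀_cotuple => cases hC; exact hF.cotuple _ _
  | inj₁_cotuple => cases hC; exact hG.cotuple _ _
  | proj₀_inj₀ => cases hC; exact (hF.proj₀ _ _).symm
  | proj₀_inj₁ => cases hC; exact (hG.proj₀ _ _).symm
  | proj₁_inj₀ => cases hC; exact (hF.proj₁ _ _).symm
  | proj₁_inj₁ => cases hC; exact (hG.proj₁ _ _).symm
  | _ => cases hC

/-- Left rules act on the domain and composition with `f` acts on the codomain, so they commute: by
computation where `eval` recurses through left rules, and by a permuting conversion where it adds a
right rule. -/
theorem Arr.natural_eval {X A : Ty} (f : Arr X A) : Natural f.eval := by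
  induction f with
  | id X => exact ⟨fun h => h, fun _ _ => .refl _, fun _ _ => .refl _, fun _ _ => .refl _⟩
  | comp f g hf hg =>
    exact ⟨fun h => hg.congr (hf.congr h),
      fun _ _ => (hg.congr (hf.proj₀ _ _)).trans (hg.proj₀ _ _),
      fun _ _ => (hg.congr (hf.proj₁ _ _)).trans (hg.proj₁ _ _),
      fun _ _ => (hg.congr (hf.cotuple _ _)).trans (hg.cotuple _ _)⟩
  | fromZero A =>
    exact ⟨fun h => h.elimZero rfl, fun _ _ => .refl _, fun _ _ => .refl _, fun _ _ => .refl _⟩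
  | toOne X =>
    exact ⟨fun _ => .refl _, fun _ _ => (Conv.one _).symm, fun _ _ => (Conv.one _).symm,
      fun _ _ => (Conv.one _).symm⟩
  | inl A B =>
    exact ⟨fun h => .inj₀ _ h, fun _ _ => (Conv.proj₀_inj₀ _ _ _).symm,
      fun _ _ => (Conv.proj₁_inj₀ _ _ _).symm, fun _ _ => .inj₀_cotuple _ _ _⟩
  | inr A B =>
    exact ⟨fun h => .inj₁ _ h, fun _ _ => (Conv.proj₀_inj₁ _ _ _).symm,
      fun _ _ => (Conv.proj₁_inj₁ _ _ _).symm, fun _ _ => .inj₁_cotuple _ _ _⟩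
  | cotuple f g hf hg =>
    exact ⟨fun h => h.elimAdd hf hg rfl, fun _ _ => .refl _, fun _ _ => .refl _, fun _ _ => .refl _⟩
  | fst A B =>
    exact ⟨fun h => h.fst rfl, fun _ _ => .refl _, fun _ _ => .refl _, fun _ _ => .refl _⟩
  | snd A B =>
    exact ⟨fun h => h.snd rfl, fun _ _ => .refl _, fun _ _ => .refl _, fun _ _ => .refl _⟩
  | tuple f g hf hg =>
    exact ⟨fun h => .tuple (hf.congr h) (hg.congr h),
      fun _ _ => (Conv.tuple (hf.proj₀ _ _) (hg.proj₀ _ _)).trans (Conv.proj₀_tuple _ _ _).symm,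
      fun _ _ => (Conv.tuple (hf.proj₁ _ _) (hg.proj₁ _ _)).trans (Conv.proj₁_tuple _ _ _).symm,
      fun _ _ => (Conv.tuple (hf.cotuple _ _) (hg.cotuple _ _)).trans
        (Conv.cotuple_tuple _ _ _ _).symm⟩

/-- Left rules at the head of `t` are pushed inside the pair until a genuine `tuple` or a unit out
of 0 is met. This makes pairing an invertible rule. -/
theorem Conv.tuple_eta {Z C A B : Ty} (t : Term Z C) (hC : C = .mul A B) :
    Conv (.tuple (t.fst hC) (t.snd hC)) (hC ▸ t) := by
  induction t with
  | cotuple₀ => subst hC; exact (Conv.zero _)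
  | tuple₀ | inj₀ | inj₁ => cases hC
  | proj₀ t ih => subst hC; exact (Conv.proj₀_tuple _ _ _).symm.trans (.proj₀ _ (ih rfl))
  | proj₁ t ih => subst hC; exact (Conv.proj₁_tuple _ _ _).symm.trans (.proj₁ _ (ih rfl))
  | cotuple s t ih ih' =>
    subst hC; exact (Conv.cotuple_tuple _ _ _ _).symm.trans (.cotuple (ih rfl) (ih' rfl))
  | tuple s t => cases hC; exact .refl _

/-- A term into 0 is built from left rules and { } alone, so naturality determines the image under
`F`. This is the uniqueness of the arrow out of 0; `elimAdd_eq` does the same for cotuples. -/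
theorem Conv.elimZero_eq {A : Ty} {F : ∀ Z, Term Z .zero → Term Z A} (hF : Natural F) {Z C : Ty}
    (t : Term Z C) (hC : C = .zero) : Conv (F Z (hC ▸ t)) (t.elimZero hC) := by
  induction t with
  | cotuple₀ => exact .zero _
  | tuple₀ | inj₀ | inj₁ | tuple => cases hC
  | proj₀ t ih => subst hC; exact (hF.proj₀ _ _).trans (.proj₀ _ (ih rfl))
  | proj₁ t ih => subst hC; exact (hF.proj₁ _ _).trans (.proj₁ _ (ih rfl))
  | cotuple s t ih ih' =>
    subst hC; exact (hF.cotuple _ _).trans (.cotuple (ih rfl) (ih' rfl))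

theorem Conv.elimAdd_eq {X Y A : Ty} {H : ∀ Z, Term Z (.add X Y) → Term Z A} (hH : Natural H)
    {F : ∀ Z, Term Z X → Term Z A} {G : ∀ Z, Term Z Y → Term Z A}
    (hF : ∀ Z t, Conv (F Z t) (H Z (.inj₀ t))) (hG : ∀ Z t, Conv (G Z t) (H Z (.inj₁ t))) {Z C : Ty}
    (t : Term Z C) (hC : C = .add X Y) : Conv (t.elimAdd F G hC) (H Z (hC ▸ t)) := by
  induction t with
  | cotuple₀ => exact (Conv.zero _).symm
  | tuple₀ | tuple => cases hC
  | inj₀ t => cases hC; exact hF _ _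
  | inj₁ t => cases hC; exact hG _ _
  | proj₀ t ih => subst hC; exact (Conv.proj₀ _ (ih rfl)).trans (hH.proj₀ _ _).symm
  | proj₁ t ih => subst hC; exact (Conv.proj₁ _ (ih rfl)).trans (hH.proj₁ _ _).symm
  | cotuple s t ih ih' =>
    subst hC
    exact (Conv.cotuple (ih rfl) (ih' rfl)).trans (hH.cotuple _ _).symm

theorem Arr.Eqv.conv_eval {X A : Ty} {f g : Arr X A} (h : Arr.Eqv f g) :
    ∀ (Z : Ty) (t : Term Z X), Conv (f.eval Z t) (g.eval Z t) := by
  induction h with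
  | refl f => exact fun _ _ => .refl _
  | symm _ ih => exact fun Z t => (ih Z t).symm
  | trans _ _ ih ih' => exact fun Z t => (ih Z t).trans (ih' Z t)
  | @comp_congr _ _ _ f f' g g' _ _ ih ih' =>
    exact fun Z t => (g.natural_eval.congr (ih Z t)).trans (ih' Z _)
  | @cotuple_congr X Y A f f' g g' _ _ ih ih' =>
    exact fun Z t => Conv.elimAdd_eq (H := (Arr.cotuple f' g').eval)
      (Arr.natural_eval _) ih ih' t rfl
  | tuple_congr _ _ ih ih' => exact fun Z t => .tuple (ih Z t) (ih' Z t)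
  -- The category laws and the β-equations hold by computation of `eval`; only the uniqueness laws
  -- and the congruences need an argument.
  | id_comp | comp_id | assoc | inl_cotuple | inr_cotuple | tuple_fst | tuple_snd =>
    exact fun _ _ => .refl _
  | zero_uniq f => exact fun Z t => Conv.elimZero_eq f.natural_eval t rfl
  | one_uniq f => exact fun Z t => .one _
  | cotuple_uniq h =>
    exact fun Z t => Conv.elimAdd_eq h.natural_eval (fun _ _ => .refl _) (fun _ _ => .refl _) t rfl
  | tuple_uniq h => exact fun Z t => .tuple_eta _ rfl

/-- The Yoneda argument: evaluation at the identity gives the term back, so arrows with the same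
action come from convertible terms. -/
theorem Term.conv_eval_id {X A : Ty} (t : Term X A) : Conv (t.toArr.eval X (Term.id X)) t := by
  induction t with
  | cotuple₀ => exact .zero _
  | tuple₀ => exact .one _
  | inj₀ t ih => exact .inj₀ _ ih
  | inj₁ t ih => exact .inj₁ _ ih
  | proj₀ t ih => exact (t.toArr.natural_eval.proj₀ _ _).trans (.proj₀ _ ih)
  | proj₁ t ih => exact (t.toArr.natural_eval.proj₁ _ _).trans (.proj₁ _ ih)
  | cotuple s t ih ih' => exact .cotuple ih ih'
  | tuple s t ih ih' => exact .tuple ih ih'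

/-- Two terms denote the same arrow iff they are related by the permuting conversions. -/
theorem Term.denote_eq_iff {X A : Ty} {f g : Term X A} : f.denote = g.denote ↔ Conv f g := by
  refine ⟨fun h => ?_, fun h => Quotient.sound h.eqv⟩
  have h' : Arr.Eqv f.toArr g.toArr := Quotient.exact h
  exact f.conv_eval_id.symm.trans ((h'.conv_eval X _).trans g.conv_eval_id)

end SumProd

/-! ### Tokens, saturation, and invariance of the closure under conversions. -/

namespace SumProd

namespace Ty

/-- The dual type, exchanging sums and products. -/
def dual : Ty → Ty
  | .zero => .one
  | .one => .zero
  | .add X Y => .mul X.dual Y.dual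
  | .mul X Y => .add X.dual Y.dual

@[simp] theorem dual_dual (X : Ty) : X.dual.dual = X := by
  induction X <;> simp_all [dual]

@[simp] theorem size_dual (X : Ty) : X.dual.size = X.size := by
  induction X <;> simp_all [dual, size]

/-- The path leads to a node of the syntax tree. -/
def IsNode : Ty → List Bool → Prop
  | _, [] => True
  | .add X _, false :: p => X.IsNode p
  | .add _ Y, true :: p => Y.IsNode p
  | .mul X _, false :: p => X.IsNode p
  | .mul _ Y, true :: p => Y.IsNode p
  | .zero, _ :: _ => False
  | .one, _ :: _ => False

/-- The path leads to a leaf labelled `zero`. -/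
def IsZeroLeaf : Ty → List Bool → Prop
  | .zero, [] => True
  | .add X _, false :: p => X.IsZeroLeaf p
  | .add _ Y, true :: p => Y.IsZeroLeaf p
  | .mul X _, false :: p => X.IsZeroLeaf p
  | .mul _ Y, true :: p => Y.IsZeroLeaf p
  | _, _ => False

/-- The path leads to a leaf labelled `one`. -/
abbrev IsOneLeaf (A : Ty) (a : List Bool) : Prop := A.dual.IsZeroLeaf a

theorem IsZeroLeaf.isNode {X : Ty} {x : List Bool} (h : X.IsZeroLeaf x) : X.IsNode x := by
  induction X generalizing x with
  | zero | one => cases x <;> simp_all [IsNode, IsZeroLeaf]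
  | add X Y ihX ihY | mul X Y ihX ihY =>
    rcases x with _ | ⟨_ | _, x⟩
    · trivial
    · exact ihX h
    · exact ihY h

theorem IsOneLeaf.isNode {X : Ty} {x : List Bool} (h : X.IsOneLeaf x) : X.IsNode x := by
  induction X generalizing x with
  | zero | one => cases x <;> simp_all [IsNode, IsZeroLeaf, IsOneLeaf, dual]
  | add X Y ihX ihY | mul X Y ihX ihY =>
    rcases x with _ | ⟨_ | _, x⟩
    · trivial
    · exact ihX h
    · exact ihY h

/-- The condition on the set of nodes `a` of a codomain for which a token `(x, a)` with `x` a
leaf `zero` is present. -/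
def Stable : Ty → (List Bool → Prop) → Prop
  | .zero, _ => True
  | .one, _ => True
  | .add A B, P => ((P [] ↔ P [false]) ∧ (P [] ↔ P [true])) ∧
      A.Stable (fun a => P (false :: a)) ∧ B.Stable (fun a => P (true :: a))
  | .mul A B, P => (P [] ↔ P [false] ∧ P [true]) ∧
      A.Stable (fun a => P (false :: a)) ∧ B.Stable (fun a => P (true :: a))

/-- The leaves `one` in `C` suffice to build a point of `A`. -/
def Cov : Ty → (List Bool → Prop) → Prop
  | .zero, _ => False
  | .one, C => C []
  | .add A B, C => A.Cov (fun a => C (false :: a)) ∨ B.Cov (fun a => C (true :: a))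
  | .mul A B, C => A.Cov (fun a => C (false :: a)) ∧ B.Cov (fun a => C (true :: a))

/-- The type has a point. -/
abbrev Pointed (A : Ty) : Prop := A.Cov fun _ => True

/-- The nodes at or below a node covered by `C`. -/
def Under : Ty → (List Bool → Prop) → List Bool → Prop
  | A, C, [] => A.Cov C
  | .zero, C, _ :: _ => Ty.zero.Cov C
  | .one, C, _ :: _ => Ty.one.Cov C
  | .add A B, C, false :: a => (Ty.add A B).Cov C ∨ A.Under (fun a => C (false :: a)) a
  | .add A B, C, true :: a => (Ty.add A B).Cov C ∨ B.Under (fun a => C (true :: a)) a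
  | .mul A B, C, false :: a => (Ty.mul A B).Cov C ∨ A.Under (fun a => C (false :: a)) a
  | .mul A B, C, true :: a => (Ty.mul A B).Cov C ∨ B.Under (fun a => C (true :: a)) a

/-- Since 0 and 1 are the only leaves, having a point is the truth value of the type read as a
Boolean formula, and dualizing negates it. -/
theorem pointed_dual (A : Ty) : A.dual.Pointed ↔ ¬ A.Pointed := by
  induction A with
  | zero | one => simp [Pointed, Cov, dual]
  | add A B ihA ihB => simp only [Pointed, Cov, dual, not_or] at *; rw [ihA, ihB]
  | mul A B ihA ihB => simp only [Pointed, Cov, dual] at *; rw [ihA, ihB]; tauto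

/-- The conditions involve only equivalences and conjunctions, which pass to intersections. Hence a
least closed set containing given tokens exists. -/
theorem Stable.forall {ι : Sort*} {A : Ty} {P : ι → List Bool → Prop} (h : ∀ i, A.Stable (P i)) :
    A.Stable fun a => ∀ i, P i a := by
  induction A generalizing P with
  | zero | one => trivial
  | add A B ihA ihB =>
    exact ⟨⟨forall_congr' fun i => (h i).1.1, forall_congr' fun i => (h i).1.2⟩,
      ihA fun i => (h i).2.1, ihB fun i => (h i).2.2⟩
  | mul A B ihA ihB =>
    exact ⟨(forall_congr' fun i => (h i).1).trans forall_and,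
      ihA fun i => (h i).2.1, ihB fun i => (h i).2.2⟩

theorem stable_const (A : Ty) (p : Prop) : A.Stable fun _ => p := by
  induction A <;> simp_all [Stable]

theorem Stable.of_root {A : Ty} {P : List Bool → Prop} (h : A.Stable P) (h0 : P [])
    {a : List Bool} (ha : A.IsNode a) : P a := by
  induction A generalizing P a with
  | zero | one => cases a <;> simp_all [IsNode]
  | add A B ihA ihB =>
    rcases a with _ | ⟨_ | _, a⟩
    · exact h0
    · exact ihA h.2.1 (h.1.1.1 h0) ha
    · exact ihB h.2.2 (h.1.2.1 h0) ha
  | mul A B ihA ihB =>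
    rcases a with _ | ⟨_ | _, a⟩
    · exact h0
    · exact ihA h.2.1 (h.1.1 h0).1 ha
    · exact ihB h.2.2 (h.1.1 h0).2 ha

theorem Cov.root_of_stable {A : Ty} {C P : List Bool → Prop} (h : A.Cov C) (hP : A.Stable P)
    (hC : ∀ a, A.IsOneLeaf a → C a → P a) : P [] := by
  induction A generalizing C P with
  | zero => exact h.elim
  | one => exact hC [] trivial h
  | add A B ihA ihB =>
    rcases h with h | h
    · exact hP.1.1.2 (ihA h hP.2.1 fun a ha => hC (false :: a) ha)
    · exact hP.1.2.2 (ihB h hP.2.2 fun a ha => hC (true :: a) ha)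
  | mul A B ihA ihB =>
    exact hP.1.2 ⟨ihA h.1 hP.2.1 fun a ha => hC (false :: a) ha,
      ihB h.2 hP.2.2 fun a ha => hC (true :: a) ha⟩

theorem Cov.under {A : Ty} {C : List Bool → Prop} (h : A.Cov C) (a : List Bool) :
    A.Under C a := by
  rcases a with _ | ⟨b, a⟩
  · cases A <;> exact h
  · cases A with
    | zero | one => exact h
    | add | mul => cases b <;> exact Or.inl h

/-- Membership in a stable set climbs from covering leaves to the covered node and then descends to
all nodes below it. Together with `stable_under` and `under_of_isOneLeaf` this makes `Under` the
least stable set, on the nodes, that contains the leaves 1 in `C`. -/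
theorem Under.of_stable {A : Ty} {C P : List Bool → Prop} {a : List Bool} (h : A.Under C a)
    (hP : A.Stable P) (hC : ∀ a, A.IsOneLeaf a → C a → P a) (ha : A.IsNode a) : P a := by
  by_cases h' : A.Cov C
  · exact hP.of_root (h'.root_of_stable hP hC) ha
  induction A generalizing C P a with
  | zero | one => cases a <;> simp_all [Under]
  | add A B ihA ihB | mul A B ihA ihB =>
    rcases a with _ | ⟨_ | _, a⟩
    · exact (h' h).elim
    · have h := h.resolve_left h'
      have hC' := fun a (ha : A.IsOneLeaf a) => hC (false :: a) ha
      by_cases hA : A.Cov fun a => C (false :: a)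
      · exact hP.2.1.of_root (hA.root_of_stable hP.2.1 hC') ha
      · exact ihA (P := fun a => P (false :: a)) h hP.2.1 hC' ha hA
    · have h := h.resolve_left h'
      have hC' := fun a (ha : B.IsOneLeaf a) => hC (true :: a) ha
      by_cases hB : B.Cov fun a => C (true :: a)
      · exact hP.2.2.of_root (hB.root_of_stable hP.2.2 hC') ha
      · exact ihB (P := fun a => P (true :: a)) h hP.2.2 hC' ha hB

theorem Cov.mono {A : Ty} {C C' : List Bool → Prop} (h : A.Cov C)
    (hC : ∀ a, A.IsOneLeaf a → C a → C' a) : A.Cov C' := by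
  induction A generalizing C C' with
  | zero => exact h
  | one => exact hC [] trivial h
  | add A B ihA ihB =>
    exact h.imp (fun h => ihA h fun a => hC (false :: a)) (fun h => ihB h fun a => hC (true :: a))
  | mul A B ihA ihB =>
    exact h.imp (fun h => ihA h fun a => hC (false :: a)) (fun h => ihB h fun a => hC (true :: a))

theorem Under.mono {A : Ty} {C C' : List Bool → Prop} {a : List Bool} (h : A.Under C a)
    (hC : ∀ a, A.IsOneLeaf a → C a → C' a) : A.Under C' a := by
  induction A generalizing C C' a with
  | zero | one => cases a <;> exact Cov.mono h hC
  | add A B ihA ihB | mul A B ihA ihB =>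
    rcases a with _ | ⟨_ | _, a⟩
    · exact Cov.mono h hC
    · exact h.imp (fun h => h.mono hC) (fun h => ihA h fun a => hC (false :: a))
    · exact h.imp (fun h => h.mono hC) (fun h => ihB h fun a => hC (true :: a))

theorem stable_under (A : Ty) (C : List Bool → Prop) : A.Stable (A.Under C) := by
  -- If the root is covered the set is everything; otherwise the disjunct for the root disappears
  -- and the condition passes to the two children.
  by_cases h : A.Cov C
  · have : A.Under C = fun _ => True := by funext a; simp [h.under a]
    rw [this]; exact stable_const _ _
  induction A generalizing C with
  | zero | one => trivial
  | add A B ihA ihB =>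
    have hA : ¬ A.Cov fun a => C (false :: a) := fun h' => h (Or.inl h')
    have hB : ¬ B.Cov fun a => C (true :: a) := fun h' => h (Or.inr h')
    refine ⟨⟨?_, ?_⟩, ?_, ?_⟩
    · simp [Under, h, hA]
    · simp [Under, h, hB]
    · simpa [Under, h] using ihA _ hA
    · simpa [Under, h] using ihB _ hB
  | mul A B ihA ihB =>
    refine ⟨?_, ?_, ?_⟩
    · simp [Under, h]; exact fun h1 h2 => h ⟨h1, h2⟩
    · simp only [Under, h, false_or]
      by_cases hA : A.Cov fun a => C (false :: a)
      · have : A.Under (fun a => C (false :: a)) = fun _ => True := by funext a; simp [hA.under a]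
        rw [this]; exact stable_const _ _
      · exact ihA _ hA
    · simp only [Under, h, false_or]
      by_cases hB : B.Cov fun a => C (true :: a)
      · have : B.Under (fun a => C (true :: a)) = fun _ => True := by funext a; simp [hB.under a]
        rw [this]; exact stable_const _ _
      · exact ihB _ hB

theorem under_of_isOneLeaf {A : Ty} {C : List Bool → Prop} {a : List Bool} (ha : A.IsOneLeaf a)
    (h : C a) : A.Under C a := by
  induction A generalizing C a with
  | zero | one => cases a <;> simp_all [IsZeroLeaf, dual, Under, Cov, IsOneLeaf]
  | add A B ihA ihB | mul A B ihA ihB =>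
    rcases a with _ | ⟨_ | _, a⟩
    · simp [IsZeroLeaf, dual, IsOneLeaf] at ha
    · exact Or.inr (ihA ha h)
    · exact Or.inr (ihB ha h)

theorem not_cov_false (A : Ty) : ¬ A.Cov fun _ => False := by
  induction A with
  | zero | one => exact id
  | add A B ihA ihB => exact fun h => h.elim ihA ihB
  | mul A B ihA ihB => exact fun h => ihA h.1

theorem not_under_false (A : Ty) (a : List Bool) : ¬ A.Under (fun _ => False) a := by
  induction A generalizing a with
  | zero | one => cases a <;> exact id
  | add A B ihA ihB | mul A B ihA ihB =>
    rcases a with _ | ⟨_ | _, a⟩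
    · exact not_cov_false _
    · exact fun h => h.elim (not_cov_false _) (ihA a)
    · exact fun h => h.elim (not_cov_false _) (ihB a)

theorem Under.exists_leaf {A : Ty} {C : List Bool → Prop} {a : List Bool} (h : A.Under C a) :
    ∃ a, A.IsOneLeaf a ∧ C a := by
  by_contra! hC
  exact not_under_false A a (h.mono hC)

end Ty

/-- The saturation conditions on a set of tokens, i.e. of pairs of nodes of the domain and the
codomain. -/
def Closed (X A : Ty) (T : List Bool → List Bool → Prop) : Prop :=
  (∀ x, X.IsZeroLeaf x → A.Stable (T x)) ∧
    ∀ a, A.IsOneLeaf a → X.dual.Stable fun x => T x a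

theorem Closed.forall {ι : Sort*} {X A : Ty} {T : ι → List Bool → List Bool → Prop}
    (h : ∀ i, Closed X A (T i)) : Closed X A fun x a => ∀ i, T i x a :=
  ⟨fun x hx => .forall fun i => (h i).1 x hx, fun a ha => .forall fun i => (h i).2 a ha⟩

theorem Closed.flip {X A : Ty} {T : List Bool → List Bool → Prop} (h : Closed X A T) :
    Closed A.dual X.dual fun a x => T x a := by
  refine ⟨h.2, fun x hx => ?_⟩
  simp only [Ty.dual_dual, Ty.IsOneLeaf] at hx ⊢
  exact h.1 x hx

namespace Term

/-- All tokens of the units of the term belong to `T`. -/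
def Sat : {X A : Ty} → Term X A → (List Bool → List Bool → Prop) → Prop
  | _, _, .cotuple₀, T => T [] []
  | _, _, .tuple₀, T => T [] []
  | _, _, .inj₀ t, T => t.Sat fun x a => T x (false :: a)
  | _, _, .inj₁ t, T => t.Sat fun x a => T x (true :: a)
  | _, _, .proj₀ t, T => t.Sat fun x a => T (false :: x) a
  | _, _, .proj₁ t, T => t.Sat fun x a => T (true :: x) a
  | _, _, .cotuple s t, T =>
      (s.Sat fun x a => T (false :: x) a) ∧ t.Sat fun x a => T (true :: x) a
  | _, _, .tuple s t, T =>
      (s.Sat fun x a => T x (false :: a)) ∧ t.Sat fun x a => T x (true :: a)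

/-- The tokens derivable from those of the term. -/
def closure {X A : Ty} (f : Term X A) (x a : List Bool) : Prop :=
  ∀ T, Closed X A T → f.Sat T → T x a

theorem Sat.mono {X A : Ty} {f : Term X A} {T T' : List Bool → List Bool → Prop} (h : f.Sat T)
    (hT : ∀ x a, T x a → T' x a) : f.Sat T' := by
  induction f generalizing T T' with
  | cotuple₀ | tuple₀ => exact hT _ _ h
  | inj₀ t ih | inj₁ t ih | proj₀ t ih | proj₁ t ih => exact ih h fun _ _ => hT _ _
  | cotuple s t ih ih' | tuple s t ih ih' =>
    exact ⟨ih h.1 fun _ _ => hT _ _, ih' h.2 fun _ _ => hT _ _⟩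

theorem Sat.forall {ι : Sort*} {X A : Ty} {f : Term X A} {T : ι → List Bool → List Bool → Prop}
    (h : ∀ i, f.Sat (T i)) : f.Sat fun x a => ∀ i, T i x a := by
  induction f generalizing T with
  | cotuple₀ | tuple₀ => exact h
  | inj₀ t ih | inj₁ t ih | proj₀ t ih | proj₁ t ih => exact ih h
  | cotuple s t ih ih' | tuple s t ih ih' => exact ⟨ih fun i => (h i).1, ih' fun i => (h i).2⟩

/-- Without atoms every branch of a term ends in a unit. -/
theorem Sat.nonempty {X A : Ty} {f : Term X A} {T : List Bool → List Bool → Prop} (h : f.Sat T) :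
    ∃ x a, T x a := by
  induction f generalizing T with
  | cotuple₀ | tuple₀ => exact ⟨_, _, h⟩
  | inj₀ t ih | inj₁ t ih | proj₀ t ih | proj₁ t ih =>
    obtain ⟨_, _, h⟩ := ih h; exact ⟨_, _, h⟩
  | cotuple s t ih _ | tuple s t ih _ => obtain ⟨_, _, h⟩ := ih h.1; exact ⟨_, _, h⟩

theorem closed_closure {X A : Ty} (f : Term X A) : Closed X A f.closure :=
  .forall fun _ => .forall fun h => .forall fun _ => h

theorem sat_closure {X A : Ty} (f : Term X A) : f.Sat f.closure :=
  .forall fun _ => .forall fun _ => .forall fun h => h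

/-- The dual term. -/
def dual : {X A : Ty} → Term X A → Term A.dual X.dual
  | _, _, .cotuple₀ => .tuple₀
  | _, _, .tuple₀ => .cotuple₀
  | _, _, .inj₀ t => .proj₀ t.dual
  | _, _, .inj₁ t => .proj₁ t.dual
  | _, _, .proj₀ t => .inj₀ t.dual
  | _, _, .proj₁ t => .inj₁ t.dual
  | _, _, .cotuple s t => .tuple s.dual t.dual
  | _, _, .tuple s t => .cotuple s.dual t.dual

theorem sat_dual {X A : Ty} {f : Term X A} {T : List Bool → List Bool → Prop} :
    f.dual.Sat T ↔ f.Sat fun x a => T a x := by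
  induction f generalizing T with
  | cotuple₀ | tuple₀ => rfl
  | inj₀ t ih | inj₁ t ih | proj₀ t ih | proj₁ t ih => exact ih
  | cotuple s t ih ih' | tuple s t ih ih' => exact and_congr ih ih'

theorem closure_dual {X A : Ty} {f : Term X A} {x a : List Bool} :
    f.dual.closure a x ↔ f.closure x a := by
  refine ⟨fun h T hT hf => h _ hT.flip (sat_dual.2 hf), fun h T hT hf => ?_⟩
  have := hT.flip
  rw [Ty.dual_dual, Ty.dual_dual] at this
  exact h _ this (sat_dual.1 hf)

/-- The two types are only propositionally equal, whence `HEq`. In each compound case the double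
duals of the subterms are generalized first, so that the types can be rewritten without breaking
typing. -/
theorem dual_dual_heq {X A : Ty} (f : Term X A) : HEq f.dual.dual f := by
  induction f with
  | @cotuple₀ A => show HEq (cotuple₀ (A := A.dual.dual)) _; rw [Ty.dual_dual]
  | @tuple₀ A => show HEq (tuple₀ (X := A.dual.dual)) _; rw [Ty.dual_dual]
  | @inj₀ X A B t ih =>
    show HEq (inj₀ (B := B.dual.dual) t.dual.dual) _
    have h1 := X.dual_dual; have h2 := A.dual_dual; have h3 := B.dual_dual
    revert ih; generalize t.dual.dual = t'; revert t'; rw [h1, h2, h3]; rintro _ ⟨⟩; rfl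
  | @inj₁ X A B t ih =>
    show HEq (inj₁ (A := A.dual.dual) t.dual.dual) _
    have h1 := X.dual_dual; have h2 := A.dual_dual; have h3 := B.dual_dual
    revert ih; generalize t.dual.dual = t'; revert t'; rw [h1, h2, h3]; rintro _ ⟨⟩; rfl
  | @proj₀ X Y A t ih =>
    show HEq (proj₀ (Y := Y.dual.dual) t.dual.dual) _
    have h1 := X.dual_dual; have h2 := A.dual_dual; have h3 := Y.dual_dual
    revert ih; generalize t.dual.dual = t'; revert t'; rw [h1, h2, h3]; rintro _ ⟨⟩; rfl
  | @proj₁ X Y A t ih =>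
    show HEq (proj₁ (X := X.dual.dual) t.dual.dual) _
    have h1 := X.dual_dual; have h2 := A.dual_dual; have h3 := Y.dual_dual
    revert ih; generalize t.dual.dual = t'; revert t'; rw [h1, h2, h3]; rintro _ ⟨⟩; rfl
  | @cotuple X Y A s t ih ih' =>
    show HEq (cotuple s.dual.dual t.dual.dual) _
    have h1 := X.dual_dual; have h2 := A.dual_dual; have h3 := Y.dual_dual
    revert ih ih'; generalize t.dual.dual = t'; generalize s.dual.dual = s'; revert s' t'
    rw [h1, h2, h3]; rintro _ _ ⟨⟩ ⟨⟩; rfl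
  | @tuple X A B s t ih ih' =>
    show HEq (tuple s.dual.dual t.dual.dual) _
    have h1 := X.dual_dual; have h2 := A.dual_dual; have h3 := B.dual_dual
    revert ih ih'; generalize t.dual.dual = t'; generalize s.dual.dual = s'; revert s' t'
    rw [h1, h2, h3]; rintro _ _ ⟨⟩ ⟨⟩; rfl

end Term

theorem Conv.dual {X A : Ty} {f g : Term X A} (h : Conv f g) : Conv f.dual g.dual := by
  induction h with
  | refl => exact .refl _
  | symm _ ih => exact ih.symm
  | trans _ _ ih ih' => exact ih.trans ih'
  | inj₀ _ _ ih => exact .proj₀ _ ih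
  | inj₁ _ _ ih => exact .proj₁ _ ih
  | proj₀ _ _ ih => exact .inj₀ _ ih
  | proj₁ _ _ ih => exact .inj₁ _ ih
  | cotuple _ _ ih ih' => exact .tuple ih ih'
  | tuple _ _ ih ih' => exact .cotuple ih ih'
  | zero => exact .one _
  | one => exact .zero _
  | inj₀_cotuple => exact .proj₀_tuple _ _ _
  | inj₁_cotuple => exact .proj₁_tuple _ _ _
  | proj₀_tuple => exact .inj₀_cotuple _ _ _
  | proj₁_tuple => exact .inj₁_cotuple _ _ _
  | cotuple_tuple => exact (Conv.cotuple_tuple _ _ _ _).symm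
  | proj₀_inj₀ => exact (Conv.proj₀_inj₀ _ _ _).symm
  | proj₀_inj₁ => exact (Conv.proj₁_inj₀ _ _ _).symm
  | proj₁_inj₀ => exact (Conv.proj₀_inj₁ _ _ _).symm
  | proj₁_inj₁ => exact (Conv.proj₁_inj₁ _ _ _).symm

theorem Conv.of_heq {X A X' A' : Ty} (hX : X' = X) (hA : A' = A) {f g : Term X A}
    {f' g' : Term X' A'} (hf : HEq f' f) (hg : HEq g' g) (h : Conv f' g') : Conv f g := by
  subst hX hA; cases hf; cases hg; exact h

/-- Allows each later construction to be carried out on one side only, with 0, sums and injections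
exchanged for 1, products and projections. -/
theorem Conv.of_dual {X A : Ty} {f g : Term X A} (h : Conv f.dual g.dual) : Conv f g :=
  .of_heq X.dual_dual A.dual_dual f.dual_dual_heq g.dual_dual_heq h.dual

theorem Closed.domain_left {X Y A : Ty} {T : List Bool → List Bool → Prop} :
    Closed (.add X Y) A T ∨ Closed (.mul X Y) A T → Closed X A fun x a => T (false :: x) a := by
  rintro (h | h) <;> exact ⟨fun x hx => h.1 _ hx, fun a ha => (h.2 a ha).2.1⟩

theorem Closed.domain_right {X Y A : Ty} {T : List Bool → List Bool → Prop} :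
    Closed (.add X Y) A T ∨ Closed (.mul X Y) A T → Closed Y A fun x a => T (true :: x) a := by
  rintro (h | h) <;> exact ⟨fun x hx => h.1 _ hx, fun a ha => (h.2 a ha).2.2⟩

theorem Closed.codomain_left {X A B : Ty} {T : List Bool → List Bool → Prop} :
    Closed X (.add A B) T ∨ Closed X (.mul A B) T → Closed X A fun x a => T x (false :: a) := by
  rintro (h | h) <;> exact ⟨fun x hx => (h.1 x hx).2.1, fun a ha => h.2 _ ha⟩

theorem Closed.codomain_right {X A B : Ty} {T : List Bool → List Bool → Prop} :
    Closed X (.add A B) T ∨ Closed X (.mul A B) T → Closed X B fun x a => T x (true :: a) := by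
  rintro (h | h) <;> exact ⟨fun x hx => (h.1 x hx).2.2, fun a ha => h.2 _ ha⟩

/-- Over a leaf 0 the closure conditions are the moves of { } through sums and products of the
codomain, so all units of the term can be contracted to the single token at the two roots. -/
theorem Term.sat_zero {X A : Ty} (f : Term X A) (hX : X = .zero)
    {T : List Bool → List Bool → Prop} (hT : Closed X A T) : f.Sat T ↔ T [] [] := by
  induction f generalizing T with
  | cotuple₀ | tuple₀ => rfl
  | inj₀ t ih =>
    exact (ih hX (.codomain_left (.inl hT))).trans (hT.1 [] (by subst hX; trivial)).1.1.symm
  | inj₁ t ih =>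
    exact (ih hX (.codomain_right (.inl hT))).trans (hT.1 [] (by subst hX; trivial)).1.2.symm
  | proj₀ | proj₁ | cotuple => cases hX
  | tuple s t ih ih' =>
    exact (and_congr (ih hX (.codomain_left (.inr hT))) (ih' hX (.codomain_right (.inr hT)))).trans
      (hT.1 [] (by subst hX; trivial)).1.symm

/-- Only the two unit conversions use that `T` is closed. The other permutations do not change the
tokens at all, since prefixes of the domain path and of the codomain path are added independently.
-/
theorem Conv.sat_iff {X A : Ty} {f g : Term X A} (h : Conv f g)
    {T : List Bool → List Bool → Prop} (hT : Closed X A T) : f.Sat T ↔ g.Sat T := by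
  induction h generalizing T with
  | refl => rfl
  | symm _ ih => exact (ih hT).symm
  | trans _ _ ih ih' => exact (ih hT).trans (ih' hT)
  | inj₀ _ _ ih => exact ih (.codomain_left (.inl hT))
  | inj₁ _ _ ih => exact ih (.codomain_right (.inl hT))
  | proj₀ _ _ ih => exact ih (.domain_left (.inr hT))
  | proj₁ _ _ ih => exact ih (.domain_right (.inr hT))
  | cotuple _ _ ih ih' =>
    exact and_congr (ih (.domain_left (.inl hT))) (ih' (.domain_right (.inl hT)))
  | tuple _ _ ih ih' =>
    exact and_congr (ih (.codomain_left (.inr hT))) (ih' (.codomain_right (.inr hT)))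
  | zero f => exact f.sat_zero rfl hT
  | one f => exact Term.sat_dual.symm.trans (f.dual.sat_zero rfl hT.flip)
  | cotuple_tuple => exact and_and_and_comm
  | _ => rfl

theorem Conv.closure_iff {X A : Ty} {f g : Term X A} (h : Conv f g) {x a : List Bool} :
    f.closure x a ↔ g.closure x a :=
  forall_congr' fun _ => forall_congr' fun hT => imp_congr (h.sat_iff hT) Iff.rfl

end SumProd

/-! ### Completeness of the invariant: terms with equal closures are convertible. -/

namespace SumProd

namespace Ty

theorem isZeroLeaf_mul {X Y : Ty} (b : Bool) (x : List Bool) :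
    (Ty.mul X Y).IsZeroLeaf (b :: x) ↔ (cond b Y X).IsZeroLeaf x := by cases b <;> rfl

theorem isOneLeaf_add {X Y : Ty} (b : Bool) (x : List Bool) :
    (Ty.add X Y).IsOneLeaf (b :: x) ↔ (cond b Y X).IsOneLeaf x := by cases b <;> rfl

theorem stable_add {A B : Ty} {P : List Bool → Prop} :
    (Ty.add A B).Stable P ↔
      ∀ b, (P [] ↔ P [b]) ∧ (cond b B A).Stable fun a => P (b :: a) := by
  rw [Bool.forall_bool]; simp only [Stable, cond]; tauto

theorem under_mul_dual {X Y : Ty} {C : List Bool → Prop} {b : Bool} {x : List Bool} :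
    (Ty.mul X Y).dual.Under C (b :: x) ↔
      (Ty.mul X Y).dual.Cov C ∨ (cond b Y X).dual.Under (fun x => C (b :: x)) x := by
  cases b <;> rfl

@[simp] theorem isNode_dual {X : Ty} {x : List Bool} : X.dual.IsNode x ↔ X.IsNode x := by
  induction X generalizing x with
  | zero | one => cases x <;> simp [IsNode, dual]
  | add X Y ihX ihY | mul X Y ihX ihY =>
    rcases x with _ | ⟨_ | _, x⟩
    · simp [IsNode]
    · exact ihX
    · exact ihY

theorem stable_isNode (A : Ty) : A.Stable A.IsNode := by
  induction A with
  | zero | one => trivial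
  | add A B ihA ihB | mul A B ihA ihB =>
    have hA : A.IsNode [] := by cases A <;> trivial
    have hB : B.IsNode [] := by cases B <;> trivial
    simp [Stable, IsNode, ihA, ihB, hA, hB]

theorem isOneLeaf_dual {X : Ty} {x : List Bool} : X.dual.IsOneLeaf x ↔ X.IsZeroLeaf x := by
  simp [IsOneLeaf]

theorem size_cond_add (X Y : Ty) (b : Bool) : (cond b Y X).size < (Ty.add X Y).size := by
  cases b <;> simp only [cond, size] <;> omega

theorem size_cond_mul (X Y : Ty) (b : Bool) : (cond b Y X).size < (Ty.mul X Y).size := by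
  cases b <;> simp only [cond, size] <;> omega

end Ty

namespace Term

/-- The injection rules, indexed by a Boolean. -/
def inj {X A B : Ty} : (b : Bool) → Term X (cond b B A) → Term X (.add A B)
  | false, t => .inj₀ t
  | true, t => .inj₁ t

/-- The projection rules, indexed by a Boolean. -/
def proj {X Y A : Ty} : (b : Bool) → Term (cond b Y X) A → Term (.mul X Y) A
  | false, t => .proj₀ t
  | true, t => .proj₁ t

theorem eq_inj_or_eq_proj {X Y A B : Ty} (f : Term (.mul X Y) (.add A B)) :
    (∃ b t, f = inj b t) ∨ ∃ b t, f = proj b t := by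
  cases f with
  | inj₀ t => exact .inl ⟨false, t, rfl⟩
  | inj₁ t => exact .inl ⟨true, t, rfl⟩
  | proj₀ t => exact .inr ⟨false, t, rfl⟩
  | proj₁ t => exact .inr ⟨true, t, rfl⟩

theorem eq_inj {A B : Ty} (f : Term .one (.add A B)) : ∃ b t, f = inj b t := by
  cases f with
  | inj₀ t => exact ⟨false, t, rfl⟩
  | inj₁ t => exact ⟨true, t, rfl⟩

theorem eq_proj {X Y : Ty} (f : Term (.mul X Y) .zero) : ∃ b t, f = proj b t := by
  cases f with
  | proj₀ t => exact ⟨false, t, rfl⟩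
  | proj₁ t => exact ⟨true, t, rfl⟩

theorem sat_inj {X A B : Ty} {b : Bool} {f : Term X (cond b B A)}
    {T : List Bool → List Bool → Prop} :
    (inj (A := A) b f).Sat T ↔ f.Sat fun x a => T x (b :: a) := by cases b <;> rfl

theorem sat_proj {X Y A : Ty} {b : Bool} {f : Term (cond b Y X) A}
    {T : List Bool → List Bool → Prop} :
    (proj (X := X) b f).Sat T ↔ f.Sat fun x a => T (b :: x) a := by cases b <;> rfl

end Term

namespace Conv

theorem inj {X A B : Ty} (b : Bool) {f g : Term X (cond b B A)} (h : Conv f g) :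
    Conv (Term.inj (A := A) b f) (Term.inj b g) := by
  cases b
  · exact .inj₀ _ h
  · exact .inj₁ _ h

theorem proj {X Y A : Ty} (b : Bool) {f g : Term (cond b Y X) A} (h : Conv f g) :
    Conv (Term.proj (X := X) b f) (Term.proj b g) := by
  cases b
  · exact .proj₀ _ h
  · exact .proj₁ _ h

theorem proj_inj {X Y A B : Ty} (b c : Bool) (f : Term (cond b Y X) (cond c B A)) :
    Conv (Term.proj (X := X) b (Term.inj (A := A) c f)) (Term.inj c (Term.proj b f)) := by
  cases b <;> cases c
  · exact .proj₀_inj₀ _ _ _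
  · exact .proj₀_inj₁ _ _ _
  · exact .proj₁_inj₀ _ _ _
  · exact .proj₁_inj₁ _ _ _

theorem proj_tuple {X Y A B : Ty} (b : Bool) (f : Term (cond b Y X) A) (g : Term (cond b Y X) B) :
    Conv (Term.proj (X := X) b (.tuple f g)) (.tuple (.proj b f) (.proj b g)) := by
  cases b
  · exact .proj₀_tuple _ _ _
  · exact .proj₁_tuple _ _ _

/-- Invertibility of the cotuple rule: right rules above it are permuted inside. -/
theorem exists_cotuple {X Y Z A : Ty} (f : Term Z A) (h : Z = .add X Y) :
    ∃ s t, Conv (h ▸ f) (.cotuple s t) := by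
  induction f with
  | cotuple₀ | proj₀ | proj₁ => cases h
  | tuple₀ => subst h; exact ⟨.tuple₀, .tuple₀, (Conv.one _).symm⟩
  | inj₀ t ih =>
    subst h
    obtain ⟨s, t, h⟩ := ih rfl
    exact ⟨_, _, (Conv.inj₀ _ h).trans (.inj₀_cotuple _ _ _)⟩
  | inj₁ t ih =>
    subst h
    obtain ⟨s, t, h⟩ := ih rfl
    exact ⟨_, _, (Conv.inj₁ _ h).trans (.inj₁_cotuple _ _ _)⟩
  | cotuple s t => cases h; exact ⟨s, t, .refl _⟩
  | tuple s t ih ih' =>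
    subst h
    obtain ⟨s, t, h⟩ := ih rfl
    obtain ⟨s', t', h'⟩ := ih' rfl
    exact ⟨_, _, (Conv.tuple h h').trans (Conv.cotuple_tuple _ _ _ _).symm⟩

/-- The term `k.elimZero` is `k` followed by the arrow out of 0, and what follows the arrow out of 0
does not matter. Here and in `inj_elimZero` it absorbs right rules. -/
theorem elimZero_tuple {X C A B : Ty} (k : Term X C) (h : C = .zero) :
    Conv (k.elimZero (A := .mul A B) h) (.tuple (k.elimZero h) (k.elimZero h)) := by
  induction k with
  | tuple₀ | inj₀ | inj₁ | tuple => cases h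
  | cotuple₀ => exact (Conv.zero _).symm
  | proj₀ t ih => exact (Conv.proj₀ _ (ih h)).trans (.proj₀_tuple _ _ _)
  | proj₁ t ih => exact (Conv.proj₁ _ (ih h)).trans (.proj₁_tuple _ _ _)
  | cotuple s t ih ih' => exact (Conv.cotuple (ih h) (ih' h)).trans (.cotuple_tuple _ _ _ _)

theorem inj_elimZero {X C A B : Ty} (b : Bool) (k : Term X C) (h : C = .zero) :
    Conv (Term.inj (A := A) (B := B) b (k.elimZero h)) (k.elimZero h) := by
  induction k with
  | tuple₀ | inj₀ | inj₁ | tuple => cases h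
  | cotuple₀ => exact .zero _
  | proj₀ t ih => exact (Conv.proj_inj false b _).symm.trans (.proj₀ _ (ih h))
  | proj₁ t ih => exact (Conv.proj_inj true b _).symm.trans (.proj₁ _ (ih h))
  | cotuple s t ih ih' =>
    cases b
    · exact (Conv.inj₀_cotuple _ _ _).trans (.cotuple (ih h) (ih' h))
    · exact (Conv.inj₁_cotuple _ _ _).trans (.cotuple (ih h) (ih' h))

end Conv

namespace Term

/-- Precomposition with the unique arrow into the final object. -/
def const {X A : Ty} : {C : Ty} → Term C A → C = .one → Term X A
  | _, .tuple₀, _ => .tuple₀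
  | _, .inj₀ t, h => .inj₀ (t.const h)
  | _, .inj₁ t, h => .inj₁ (t.const h)
  | _, .tuple s t, h => .tuple (s.const h) (t.const h)

end Term

namespace Conv

theorem proj_const {X Y C A : Ty} (b : Bool) (c : Term C A) (h : C = .one) :
    Conv (Term.proj (X := X) (Y := Y) b (c.const h)) (c.const h) := by
  induction c with
  | cotuple₀ | proj₀ | proj₁ | cotuple => cases h
  | tuple₀ => exact .one _
  | inj₀ t ih => exact (proj_inj b false _).trans (.inj₀ _ (ih h))
  | inj₁ t ih => exact (proj_inj b true _).trans (.inj₁ _ (ih h))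
  | tuple s t ih ih' => exact (proj_tuple b _ _).trans (.tuple (ih h) (ih' h))

theorem cotuple_const {X Y C A : Ty} (c : Term C A) (h : C = .one) :
    Conv (.cotuple (c.const h : Term X A) (c.const h : Term Y A)) (c.const h) := by
  induction c with
  | cotuple₀ | proj₀ | proj₁ | cotuple => cases h
  | tuple₀ => exact .one _
  | inj₀ t ih => exact (Conv.inj₀_cotuple _ _ _).symm.trans (.inj₀ _ (ih h))
  | inj₁ t ih => exact (Conv.inj₁_cotuple _ _ _).symm.trans (.inj₁ _ (ih h))
  | tuple s t ih ih' => exact (Conv.cotuple_tuple _ _ _ _).trans (.tuple (ih h) (ih' h))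

/-- Both sides are the composite X → 0 → 1 → A, because X → 1 and 0 → A are unique. So if A has a
point and X has an arrow to 0, all arrows through 0 and all constants coincide, whatever `k` and `c`
are. -/
theorem elimZero_const {X A B C : Ty} (k : Term X B) (hk : B = .zero) (c : Term C A)
    (hc : C = .one) : Conv (k.elimZero hk) (c.const hc) := by
  induction k with
  | tuple₀ | inj₀ | inj₁ | tuple => cases hk
  | cotuple₀ => exact (Conv.zero _).symm
  | proj₀ t ih => exact (Conv.proj₀ _ (ih hk)).trans (proj_const false c hc)
  | proj₁ t ih => exact (Conv.proj₁ _ (ih hk)).trans (proj_const true c hc)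
  | cotuple s t ih ih' => exact (Conv.cotuple (ih hk) (ih' hk)).trans (cotuple_const c hc)

end Conv

namespace Term

theorem dual_const {X A C : Ty} (c : Term C A) (h : C = .one) :
    (c.const h : Term X A).dual = c.dual.elimZero (by rw [h]; rfl) := by
  induction c with
  | cotuple₀ | proj₀ | proj₁ | cotuple => cases h
  | tuple₀ => rfl
  | inj₀ t ih => exact congrArg Term.proj₀ (ih h)
  | inj₁ t ih => exact congrArg Term.proj₁ (ih h)
  | tuple s t ih ih' => exact congrArg₂ Term.cotuple (ih h) (ih' h)

/-- A covering of the dual domain by leaves 0 is a recipe for a term into 0: both components at a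
sum, one of them at a product. -/
theorem exists_sat_of_cov_dual {X : Ty} {K : List Bool → Prop} (h : X.dual.Cov K) :
    ∃ k : Term X .zero, k.Sat fun x _ => K x := by
  induction X generalizing K with
  | zero => exact ⟨.cotuple₀, h⟩
  | one => exact h.elim
  | add X Y ihX ihY =>
    obtain ⟨s, hs⟩ := ihX h.1
    obtain ⟨t, ht⟩ := ihY h.2
    exact ⟨.cotuple s t, hs, ht⟩
  | mul X Y ihX ihY =>
    rcases h with h | h
    · obtain ⟨s, hs⟩ := ihX h
      exact ⟨.proj₀ s, hs⟩
    · obtain ⟨s, hs⟩ := ihY h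
      exact ⟨.proj₁ s, hs⟩

theorem exists_sat_of_cov {A : Ty} {C : List Bool → Prop} (h : A.Cov C) :
    ∃ c : Term .one A, c.Sat fun _ a => C a := by
  induction A generalizing C with
  | one => exact ⟨.tuple₀, h⟩
  | zero => exact h.elim
  | mul X Y ihX ihY =>
    obtain ⟨s, hs⟩ := ihX h.1
    obtain ⟨t, ht⟩ := ihY h.2
    exact ⟨.tuple s t, hs, ht⟩
  | add X Y ihX ihY =>
    rcases h with h | h
    · obtain ⟨s, hs⟩ := ihX h
      exact ⟨.inj₀ s, hs⟩
    · obtain ⟨s, hs⟩ := ihY h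
      exact ⟨.inj₁ s, hs⟩

/-- A term visits both components at a sum of the domain and picks one at a product, as a covering
does. If its units all lie under covered nodes, then the root is covered too. -/
theorem Sat.cov_dual {X A : Ty} {f : Term X A} {K : List Bool → Prop}
    (h : f.Sat fun x _ => X.dual.Under K x) : X.dual.Cov K := by
  induction f generalizing K with
  | cotuple₀ => exact h
  | @tuple₀ X =>
    have h : X.dual.Under K [] := h
    cases X <;> exact h
  | inj₀ t ih | inj₁ t ih => exact ih h
  | proj₀ t ih =>
    by_contra hc
    exact hc (.inl (ih (Sat.mono h fun x _ hx => Or.resolve_left hx hc)))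
  | proj₁ t ih =>
    by_contra hc
    exact hc (.inr (ih (Sat.mono h fun x _ hx => Or.resolve_left hx hc)))
  | @cotuple X Y A s t ih ih' =>
    by_contra hc
    exact hc ⟨ih (h.1.mono fun x _ hx => Or.resolve_left hx hc),
      ih' (h.2.mono fun x _ hx => Or.resolve_left hx hc)⟩
  | tuple s t ih ih' => exact ih h.1

theorem sat_mono_of_isZeroLeaf {X A : Ty} {k : Term X A} (hA : A = .zero) {P Q : List Bool → Prop}
    (h : k.Sat fun x _ => P x) (hPQ : ∀ x, X.IsZeroLeaf x → P x → Q x) : k.Sat fun x _ => Q x := by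
  induction k generalizing P Q with
  | cotuple₀ => exact hPQ [] trivial h
  | tuple₀ | inj₀ | inj₁ | tuple => cases hA
  | proj₀ t ih => exact ih hA h fun x => hPQ (false :: x)
  | proj₁ t ih => exact ih hA h fun x => hPQ (true :: x)
  | cotuple s t ih ih' =>
    exact ⟨ih hA h.1 fun x => hPQ (false :: x), ih' hA h.2 fun x => hPQ (true :: x)⟩

theorem Sat.cov_dual_of_zero {X : Ty} {k : Term X .zero} {K : List Bool → Prop}
    (h : k.Sat fun x _ => K x) : X.dual.Cov K :=
  Sat.cov_dual (sat_mono_of_isZeroLeaf rfl h fun x hx hK =>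
    Ty.under_of_isOneLeaf (by simpa [Ty.IsOneLeaf] using hx) hK)

theorem pointed_codomain {X A : Ty} (f : Term X A) (h : X.Pointed) : A.Pointed := by
  induction f with
  | cotuple₀ => exact h.elim
  | tuple₀ => trivial
  | inj₀ t ih => exact .inl (ih h)
  | inj₁ t ih => exact .inr (ih h)
  | proj₀ t ih => exact ih h.1
  | proj₁ t ih => exact ih h.2
  | cotuple s t ih ih' => exact h.elim ih ih'
  | tuple s t ih ih' => exact ⟨ih h, ih' h⟩

theorem closure_mono_leaf {X A : Ty} {f : Term X A} {x a : List Bool} (hx : X.IsZeroLeaf x)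
    (h : f.closure x []) (ha : A.IsNode a) : f.closure x a :=
  (f.closed_closure.1 x hx).of_root h ha

theorem closure_of_under {X A : Ty} {f : Term X A} {x a : List Bool} (ha : A.IsOneLeaf a)
    (hx : X.IsNode x) (h : X.dual.Under (fun x => f.closure x []) x) : f.closure x a :=
  h.of_stable (f.closed_closure.2 a ha)
    (fun _ hx h => closure_mono_leaf (Ty.isOneLeaf_dual.1 hx) h ha.isNode) (Ty.isNode_dual.2 hx)

/-- A token at the root of the codomain descends to every leaf 1 there, spreads over the domain at
that leaf, and above a leaf 0 of the domain climbs back to the root, which is possible because the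
codomain is pointed. -/
theorem closure_root_of_under {X A : Ty} {f : Term X A} (hA : A.Pointed) {x : List Bool}
    (hx : X.IsZeroLeaf x) (h : X.dual.Under (fun x => f.closure x []) x) : f.closure x [] :=
  hA.root_of_stable (f.closed_closure.1 x hx) fun _ ha _ => closure_of_under ha hx.isNode h

/-- No token of one summand of the domain helps to derive a token in the other. -/
theorem closure_cotuple_left {X Y A : Ty} {s : Term X A} {t : Term Y A} {x a : List Bool} :
    (cotuple s t).closure (false :: x) a ↔ s.closure x a := by
  refine ⟨fun h T hT hs => ?_, fun h T hT hs => h _ (.domain_left (.inl hT)) hs.1⟩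
  -- A closed set for one component is extended by everything on the other side. The conjunction
  -- required at the root of the sum then reduces to the value at the root of the first summand.
  refine h (fun x a => match x with
    | [] => T [] a
    | false :: x => T x a
    | true :: _ => True) ⟨?_, fun a ha => ⟨?_, hT.2 a ha, Ty.stable_const _ _⟩⟩
    ⟨hs, Sat.mono t.sat_closure fun _ _ _ => trivial⟩
  · rintro (_ | ⟨_ | _, x⟩) hx
    · exact hx.elim
    · exact hT.1 x hx
    · exact Ty.stable_const _ _
  · simp

theorem closure_cotuple_right {X Y A : Ty} {s : Term X A} {t : Term Y A} {x a : List Bool} :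
    (cotuple s t).closure (true :: x) a ↔ t.closure x a := by
  refine ⟨fun h T hT hs => ?_, fun h T hT hs => h _ (.domain_right (.inl hT)) hs.2⟩
  refine h (fun x a => match x with
    | [] => T [] a
    | false :: _ => True
    | true :: x => T x a) ⟨?_, fun a ha => ⟨?_, Ty.stable_const _ _, hT.2 a ha⟩⟩
    ⟨Sat.mono s.sat_closure fun _ _ _ => trivial, hs⟩
  · rintro (_ | ⟨_ | _, x⟩) hx
    · exact hx.elim
    · exact Ty.stable_const _ _
    · exact hT.1 x hx
  · simp

theorem closure_tuple_left {X A B : Ty} {s : Term X A} {t : Term X B} {x a : List Bool} :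
    (tuple s t).closure x (false :: a) ↔ s.closure x a :=
  closure_dual.symm.trans (closure_cotuple_left.trans closure_dual)

theorem closure_tuple_right {X A B : Ty} {s : Term X A} {t : Term X B} {x a : List Bool} :
    (tuple s t).closure x (true :: a) ↔ t.closure x a :=
  closure_dual.symm.trans (closure_cotuple_right.trans closure_dual)

theorem closure_tuple_root {X A B : Ty} {s : Term X A} {t : Term X B} {x : List Bool}
    (hx : X.IsZeroLeaf x) : (tuple s t).closure x [] ↔ s.closure x [] ∧ t.closure x [] :=
  ((tuple s t).closed_closure.1 x hx).1.trans (and_congr closure_tuple_left closure_tuple_right)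

theorem closure_inj_of {X A B : Ty} {b : Bool} {f : Term X (cond b B A)} {x a : List Bool}
    (h : f.closure x a) : (inj (A := A) b f).closure x (b :: a) := by
  intro T hT hf
  cases b
  · exact h _ (.codomain_left (.inl hT)) hf
  · exact h _ (.codomain_right (.inl hT)) hf

theorem closure_inj_root {X A B : Ty} {b : Bool} (f : Term X (.add A B)) {x : List Bool}
    (hx : X.IsZeroLeaf x) : f.closure x [] ↔ f.closure x [b] :=
  (Ty.stable_add.1 (f.closed_closure.1 x hx) b).1

/-- A saturated set containing the tokens of `inj b f`. -/
def injBound {X A B : Ty} (b : Bool) (f : Term X (cond b B A)) (x : List Bool) :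
    List Bool → Prop
  | [] => X.dual.Under (fun x => f.closure x []) x
  | c :: a => if c = b then f.closure x a ∨
        (X.IsZeroLeaf x ∧ X.dual.Under (fun x => f.closure x []) x)
      else X.dual.Under (fun x => f.closure x []) x

/-- A new token can arise only from one at the root of the summand `b` and a leaf 0: it climbs to
the sum, descends into the other summand, spreads over the domain at leaves 1, and may return along
the leaves 0 it has reached. `injBound` allows for all of this, in the same summand only where it is
not already in the closure of `f`. -/
theorem closure_inj_aux {X A B : Ty} {b : Bool} {f : Term X (cond b B A)} {x a : List Bool}
    (h : (inj (A := A) b f).closure x a) : injBound b f x a := by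
  refine h (injBound b f) ⟨fun x hx => ?_, ?_⟩ ?_
  · rw [Ty.stable_add]
    intro c
    by_cases hu : X.dual.Under (fun x => f.closure x []) x
    · simp [injBound, hu, hx, Ty.stable_const]
    · have h0 : ¬ f.closure x [] :=
        fun h => hu (Ty.under_of_isOneLeaf (Ty.isOneLeaf_dual.2 hx) h)
      by_cases hc : c = b
      · subst hc
        simp [injBound, hu, h0, f.closed_closure.1 x hx]
      · simp [injBound, hu, hc, Ty.stable_const]
  · rintro (_ | ⟨c, a⟩) ha
    · exact ha.elim
    by_cases hc : c = b
    · subst hc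
      rw [Ty.isOneLeaf_add] at ha
      simp only [injBound, if_true]
      convert f.closed_closure.2 a ha using 2 with x
      exact ⟨fun h => h.elim _root_.id fun h => closure_of_under ha h.1.isNode h.2, Or.inl⟩
    · simp only [injBound, hc, if_false]
      exact Ty.stable_under _ _
  · rw [sat_inj]
    exact f.sat_closure.mono fun x a h => by simp [injBound, h]

theorem closure_inj_same {X A B : Ty} {b : Bool} {f : Term X (cond b B A)} {x a : List Bool}
    (h : (inj (A := A) b f).closure x (b :: a)) :
    f.closure x a ∨ (X.IsZeroLeaf x ∧ X.dual.Under (fun x => f.closure x []) x) := by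
  simpa [injBound] using closure_inj_aux h

theorem closure_inj_ne {X A B : Ty} {b c : Bool} (hc : c ≠ b) {f : Term X (cond b B A)}
    {x a : List Bool} (h : (inj (A := A) b f).closure x (c :: a)) :
    X.dual.Under (fun x => f.closure x []) x := by
  simpa [injBound, hc] using closure_inj_aux h

theorem closure_inj_nil {X A B : Ty} {b : Bool} {f : Term X (cond b B A)} {x : List Bool}
    (h : (inj (A := A) b f).closure x []) : X.dual.Under (fun x => f.closure x []) x :=
  closure_inj_aux h

/-- A token that enters the other summand at its leaves 1 cannot climb to the root of that summand,
so it never returns. -/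
theorem closure_inj_of_not_pointed {X A B : Ty} {b : Bool} {f : Term X (cond b B A)}
    (hB : ¬ (cond (!b) B A).Pointed) {x a : List Bool}
    (h : (inj (A := A) b f).closure x (b :: a)) : f.closure x a := by
  -- In the other summand all nodes under covered ones are admitted, with all leaves 1 counted as
  -- present. The root is not among them because this summand has no point.
  have := h (fun x a => match a with
    | [] => f.closure x []
    | c :: a => if c = b then f.closure x a else
        f.closure x [] ∨ (cond (!b) B A).Under (fun _ => True) a) ⟨fun x hx => ?_, ?_⟩ ?_
  · simpa using this
  · rw [Ty.stable_add]
    intro c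
    by_cases hc : c = b
    · subst hc
      simp [f.closed_closure.1 x hx]
    · obtain rfl : c = !b := by cases b <;> cases c <;> simp_all
      generalize cond (!b) B A = C at hB
      have hB' : ¬ C.Under (fun _ => True) [] := by cases C <;> exact hB
      by_cases h0 : f.closure x []
      · simp [h0, Ty.stable_const]
      · simp [h0, hB', Ty.stable_under]
  · rintro (_ | ⟨c, a⟩) ha
    · exact ha.elim
    rw [Ty.isOneLeaf_add] at ha
    by_cases hc : c = b
    · subst hc
      simpa using f.closed_closure.2 a ha
    · obtain rfl : c = !b := by cases b <;> cases c <;> simp_all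
      have := Ty.under_of_isOneLeaf (C := fun _ => True) ha trivial
      generalize cond (!b) B A = C at *
      simp [this, Ty.stable_const]
  · rw [sat_inj]
    exact f.sat_closure.mono fun x a h => by simp [h]

theorem closure_isNode {X A : Ty} {f : Term X A} {x a : List Bool} (h : f.closure x a) :
    A.IsNode a := by
  refine h (fun _ a => A.IsNode a) ⟨fun _ _ => A.stable_isNode, fun _ _ => Ty.stable_const _ _⟩ ?_
  clear h
  induction f with
  | @cotuple₀ A => cases A <;> trivial
  | tuple₀ => trivial
  | inj₀ t ih | inj₁ t ih | proj₀ t ih | proj₁ t ih => exact ih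
  | cotuple s t ih ih' | tuple s t ih ih' => exact ⟨ih, ih'⟩

/-- Three reasons why a detour through the other summand yields nothing new: the own summand is
pointed, and then `closure_root_of_under` gives the token inside `f`; the other summand has no
point, and then nothing returns; or no leaf 0 is linked to the root, and then nothing leaves. -/
theorem closure_inj_iff {X A B : Ty} {b : Bool} {f : Term X (cond b B A)}
    (h : (cond b B A).Pointed ∨ ¬ (cond (!b) B A).Pointed ∨
      ∀ x, X.IsZeroLeaf x → ¬ f.closure x []) {x a : List Bool} :
    (inj (A := A) b f).closure x (b :: a) ↔ f.closure x a := by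
  refine ⟨fun hf => ?_, closure_inj_of⟩
  rcases h with h | h | h
  · rcases closure_inj_same hf with hf | ⟨hx, hu⟩
    · exact hf
    · have h0 := closure_root_of_under h hx hu
      have ha := closure_isNode hf
      exact closure_mono_leaf hx h0 (by cases b <;> exact ha)
  · exact closure_inj_of_not_pointed h hf
  · rcases closure_inj_same hf with hf | ⟨_, hu⟩
    · exact hf
    · obtain ⟨x, hx, hK⟩ := hu.exists_leaf
      exact (h x (Ty.isOneLeaf_dual.1 hx) hK).elim

theorem closure_proj_of {X Y A : Ty} {b : Bool} {f : Term (cond b Y X) A} {x a : List Bool}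
    (h : f.closure x a) : (proj (X := X) b f).closure (b :: x) a := by
  cases b
  · exact closure_dual.1 (closure_inj_of (b := false) (closure_dual.2 h))
  · exact closure_dual.1 (closure_inj_of (b := true) (closure_dual.2 h))

theorem closure_proj_same {X Y A : Ty} {b : Bool} {f : Term (cond b Y X) A} {x a : List Bool}
    (h : (proj (X := X) b f).closure (b :: x) a) : f.closure x a ∨ A.IsOneLeaf a := by
  cases b
  · exact (closure_inj_same (b := false) (f := f.dual) (closure_dual.2 h)).imp closure_dual.1 And.left
  · exact (closure_inj_same (b := true) (f := f.dual) (closure_dual.2 h)).imp closure_dual.1 And.left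

theorem closure_proj_ne {X Y A : Ty} {b c : Bool} (hc : c ≠ b) {f : Term (cond b Y X) A}
    {x a : List Bool} (h : (proj (X := X) b f).closure (c :: x) a) :
    A.Under (fun a => f.closure [] a) a := by
  cases b
  · simpa [closure_dual] using closure_inj_ne (b := false) (f := f.dual) hc (closure_dual.2 h)
  · simpa [closure_dual] using closure_inj_ne (b := true) (f := f.dual) hc (closure_dual.2 h)

theorem closure_proj_iff {X Y A : Ty} {b : Bool} {f : Term (cond b Y X) A}
    (h : (cond b Y X).dual.Pointed) {x a : List Bool} :
    (proj (X := X) b f).closure (b :: x) a ↔ f.closure x a := by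
  refine ⟨fun hf => ?_, closure_proj_of⟩
  cases b
  · exact closure_dual.1 ((closure_inj_iff (b := false) (f := f.dual) (.inl h)).1
      (closure_dual.2 hf))
  · exact closure_dual.1 ((closure_inj_iff (b := true) (f := f.dual) (.inl h)).1
      (closure_dual.2 hf))

/-- The codomain 0 has no leaf 1 and no proper nodes, so there are no moves and the first rule can
be read off the tokens. -/
theorem closure_proj_zero {X Y : Ty} {b c : Bool} {f : Term (cond b Y X) .zero}
    {x a : List Bool} : (proj (X := X) b f).closure (c :: x) a ↔ c = b ∧ f.closure x a := by
  refine ⟨fun h => ?_, fun ⟨h, h'⟩ => h ▸ closure_proj_of h'⟩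
  obtain ⟨y, hy, h⟩ := h (fun x a => ∃ y, x = b :: y ∧ f.closure y a)
    ⟨fun _ _ => trivial, fun a ha => by cases a <;> exact ha.elim⟩
    (sat_proj.2 (f.sat_closure.mono fun x a h => ⟨x, rfl, h⟩))
  obtain ⟨rfl, rfl⟩ := List.cons.inj hy
  exact ⟨rfl, h⟩

theorem closure_inj_one {A B : Ty} {b c : Bool} {f : Term .one (cond b B A)}
    {x a : List Bool} : (inj (A := A) b f).closure x (c :: a) ↔ c = b ∧ f.closure x a := by
  refine ⟨fun h => ?_, fun ⟨h, h'⟩ => h ▸ closure_inj_of h'⟩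
  obtain ⟨y, hy, h⟩ := h (fun x a => ∃ y, a = b :: y ∧ f.closure x y)
    ⟨fun a ha => by cases a <;> exact ha.elim, fun _ _ => trivial⟩
    (sat_inj.2 (f.sat_closure.mono fun x a h => ⟨a, rfl, h⟩))
  obtain ⟨rfl, rfl⟩ := List.cons.inj hy
  exact ⟨rfl, h⟩

end Term

namespace Conv

open Term

theorem exists_tuple {X A B : Ty} (f : Term X (.mul A B)) : ∃ s t, Conv f (.tuple s t) :=
  ⟨_, _, (tuple_eta f rfl).symm⟩

/-- A term factors through the initial object by `k` if its closure contains the tokens of `k`. -/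
theorem of_sat_elimZero {X A : Ty} (f : Term X A) (k : Term X .zero)
    (hk : k.Sat fun x _ => f.closure x []) : Conv f (k.elimZero rfl) := by
  induction hn : X.size + A.size using Nat.strong_induction_on generalizing X A with
  | _ n ih =>
  subst hn
  -- The induction measure is symmetric in domain and codomain, so the induction hypothesis is also
  -- available for the dual statement.
  have ih_const : ∀ {X' A' : Ty} (f : Term X' A') (c : Term .one A'),
      X'.size + A'.size < X.size + A.size → (c.Sat fun _ a => f.closure [] a) →
      Conv f (c.const rfl) := by
    intro X' A' f c hlt hc
    refine .of_dual ?_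
    rw [dual_const]
    exact ih _ (by simpa [add_comm] using hlt) f.dual c.dual
      (sat_dual.2 (hc.mono fun _ _ h => closure_dual.2 h)) rfl
  match X, A, f, k with
  | .zero, _, f, k => exact (Conv.zero _).trans (Conv.zero _).symm
  | .one, _, _, k => nomatch k
  | .add X Y, A, f, .cotuple s t =>
    obtain ⟨f₀, f₁, hf⟩ := exists_cotuple f rfl
    refine Conv.trans hf (.cotuple (ih _ ?_ f₀ s ?_ rfl) (ih _ ?_ f₁ t ?_ rfl))
    · simp only [Ty.size]; omega
    · exact Sat.mono hk.1 fun x _ h => closure_cotuple_left.1 (hf.closure_iff.1 h)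
    · simp only [Ty.size]; omega
    · exact Sat.mono hk.2 fun x _ h => closure_cotuple_right.1 (hf.closure_iff.1 h)
  | .mul X Y, .one, f, k => exact (Conv.one _).trans (Conv.one _).symm
  | .mul X Y, .mul A B, f, k =>
    obtain ⟨f₀, f₁, hf⟩ := exists_tuple f
    have h := sat_mono_of_isZeroLeaf rfl hk fun x hx h =>
      (closure_tuple_root hx).1 (hf.closure_iff.1 h)
    refine hf.trans (.trans (.tuple (ih _ ?_ f₀ k ?_ rfl) (ih _ ?_ f₁ k ?_ rfl))
      (elimZero_tuple k rfl).symm)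
    · simp only [Ty.size]; omega
    · exact h.mono fun _ _ h => h.1
    · simp only [Ty.size]; omega
    · exact h.mono fun _ _ h => h.2
  | .mul X Y, .zero, f, k =>
    obtain ⟨b, f, rfl⟩ := eq_proj f
    obtain ⟨c, k, rfl⟩ := eq_proj k
    rw [sat_proj] at hk
    simp only [closure_proj_zero] at hk
    obtain ⟨_, _, rfl, _⟩ := hk.nonempty
    have h := ih _ (by have := Ty.size_cond_mul X Y c; omega) f k (hk.mono fun _ _ h => h.2) rfl
    cases c
    · exact .proj₀ _ h
    · exact .proj₁ _ h
  | .mul X Y, .add A B, f, k =>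
    rcases f.eq_inj_or_eq_proj with ⟨b, f, rfl⟩ | ⟨b, f, rfl⟩
    · have hlt : (Ty.mul X Y).size + (cond b B A).size < (Ty.mul X Y).size + (Ty.add A B).size := by
        have := Ty.size_cond_add A B b; omega
      -- If the other summand is pointed, tokens may have come back through it, so `k` need not be
      -- witnessed by `f`. But then the sum has a point and all arrows through 0 agree, hence
      -- another term `k'` into 0 serves as well.
      by_cases hB : (cond (!b) B A).Pointed
      · have hA : (Ty.add A B).Pointed := by
          cases b
          · exact .inr hB
          · exact .inl hB
        obtain ⟨c, -⟩ := exists_sat_of_cov hA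
        have hcov := Sat.cov_dual (sat_mono_of_isZeroLeaf rfl hk fun x hx h => closure_inj_nil h)
        obtain ⟨k', hk'⟩ := exists_sat_of_cov_dual hcov
        exact (Conv.inj b (ih _ hlt f k' hk' rfl)).trans ((inj_elimZero b k' rfl).trans
          ((elimZero_const k' rfl c rfl).trans (elimZero_const k rfl c rfl).symm))
      · refine (Conv.inj b (ih _ hlt f k ?_ rfl)).trans (inj_elimZero b k rfl)
        refine sat_mono_of_isZeroLeaf rfl hk fun x hx h => ?_
        exact closure_inj_of_not_pointed hB ((closure_inj_root _ hx).1 h)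
    · obtain ⟨c, k, rfl⟩ := eq_proj k
      have hlt : (cond b Y X).size + (Ty.add A B).size < (Ty.mul X Y).size + (Ty.add A B).size := by
        have := Ty.size_cond_mul X Y b; omega
      rw [sat_proj] at hk
      by_cases hc : c = b
      · subst hc
        have hX : (cond c Y X).dual.Pointed := hk.cov_dual_of_zero.mono fun _ _ _ => trivial
        simp only [closure_proj_iff hX] at hk
        have h := ih _ hlt f k hk rfl
        cases c
        · exact .proj₀ _ h
        · exact .proj₁ _ h
      -- `f` and `k` project to different factors. A token of `k` in the factor that `f` ignores can
      -- only come from a covering of the codomain at the root of the other factor, so `f` is a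
      -- constant, and constants agree with arrows through 0.
      · obtain ⟨x, _, hx⟩ := hk.nonempty
        obtain ⟨d, hd⟩ := exists_sat_of_cov (A := .add A B) (closure_proj_ne hc hx)
        exact (Conv.proj b (ih_const f d hlt hd)).trans ((proj_const b d rfl).trans
          (elimZero_const (Term.proj c k) rfl d rfl).symm)

theorem of_sat_const {X A : Ty} (f : Term X A) (c : Term .one A)
    (hc : c.Sat fun _ a => f.closure [] a) : Conv f (c.const rfl) := by
  refine .of_dual ?_
  rw [dual_const]
  exact of_sat_elimZero f.dual c.dual (sat_dual.2 (hc.mono fun _ _ h => closure_dual.2 h))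

/-- Induction on the codomain. When `f` begins with an injection, its token at the root either lies
in the injected term, or comes back through a pointed summand; then the domain maps to 0 and `f` is
a constant, or some other leaf of the same factor is linked to the root of the injected term, which
is why `x` varies in the induction. When `f` begins with the wrong projection, the token crosses the
factors and again makes it a constant. Constants factor through either projection. -/
theorem exists_proj {X Y A : Ty} {b : Bool} (f : Term (.mul X Y) A) {x : List Bool}
    (hx : (cond b Y X).IsZeroLeaf x) (hf : f.closure (b :: x) []) :
    ∃ f', Conv f (Term.proj b f') := by
  induction A generalizing x with
  | zero =>
    obtain ⟨c, f, rfl⟩ := eq_proj f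
    obtain ⟨rfl, -⟩ := closure_proj_zero.1 hf
    exact ⟨f, .refl _⟩
  | one => exact ⟨.tuple₀, (Conv.one _).trans (Conv.one _).symm⟩
  | mul A B ihA ihB =>
    obtain ⟨f₀, f₁, h⟩ := exists_tuple f
    have h' := (closure_tuple_root ((Ty.isZeroLeaf_mul b x).2 hx)).1 (h.closure_iff.1 hf)
    obtain ⟨g₀, h₀⟩ := ihA f₀ hx h'.1
    obtain ⟨g₁, h₁⟩ := ihB f₁ hx h'.2
    exact ⟨.tuple g₀ g₁, h.trans ((Conv.tuple h₀ h₁).trans (proj_tuple b _ _).symm)⟩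
  | add A B ihA ihB =>
    rcases f.eq_inj_or_eq_proj with ⟨c, f, rfl⟩ | ⟨c, f, rfl⟩
    · have ih : ∀ {x}, (cond b Y X).IsZeroLeaf x → f.closure (b :: x) [] →
          ∃ f', Conv f (Term.proj b f') := by
        cases c
        · exact ihA f
        · exact ihB f
      have lift : (∃ f', Conv f (Term.proj b f')) →
          ∃ f', Conv (Term.inj (A := A) (B := B) c f) (Term.proj b f') := fun ⟨f', h⟩ =>
        ⟨_, (Conv.inj c h).trans (proj_inj b c f').symm⟩
      by_cases hB : (cond (!c) B A).Pointed
      · rcases Ty.under_mul_dual.1 (closure_inj_nil hf) with hu | hu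
        · obtain ⟨k, hk⟩ := exists_sat_of_cov_dual hu
          have hA : (Ty.add A B).Pointed := by
            cases c
            · exact .inr hB
            · exact .inl hB
          obtain ⟨d, -⟩ := exists_sat_of_cov hA
          exact ⟨d.const rfl, (Conv.inj c (of_sat_elimZero f k hk)).trans
            ((inj_elimZero c k rfl).trans ((elimZero_const k rfl d rfl).trans
              (proj_const b d rfl).symm))⟩
        · obtain ⟨y, hy, h⟩ := hu.exists_leaf
          exact lift (ih (Ty.isOneLeaf_dual.1 hy) h)
      · refine lift (ih hx (closure_inj_of_not_pointed hB ((closure_inj_root _ ?_).1 hf)))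
        exact (Ty.isZeroLeaf_mul b x).2 hx
    · by_cases hc : b = c
      · subst hc; exact ⟨f, .refl _⟩
      · obtain ⟨d, hd⟩ := exists_sat_of_cov (A := .add A B) (closure_proj_ne hc hf)
        exact ⟨d.const rfl, (Conv.proj c (of_sat_const f d hd)).trans
          ((proj_const c d rfl).trans (proj_const b d rfl).symm)⟩

/-- A term factors through an injection if its tokens in the other summand all come from leaves
`zero` of the domain. -/
theorem exists_inj {X A B : Ty} {b : Bool} (f : Term X (.add A B))
    (hf : ∀ x a, f.closure x ((!b) :: a) → X.dual.Under (fun x => f.closure x []) x) :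
    ∃ f', Conv f (Term.inj b f') := by
  induction X with
  | zero => exact ⟨.cotuple₀, (Conv.zero _).trans (Conv.zero _).symm⟩
  | one =>
    obtain ⟨c, f, rfl⟩ := eq_inj f
    by_cases hc : b = c
    · subst hc; exact ⟨f, .refl _⟩
    · obtain rfl : c = !b := by cases b <;> cases c <;> simp_all
      obtain ⟨x, a, h⟩ := f.sat_closure.nonempty
      have := hf x a (closure_inj_of h)
      cases x <;> exact this.elim
  | add X Y ihX ihY =>
    obtain ⟨s, t, h⟩ := exists_cotuple f rfl
    have h := fun {x a} => Conv.closure_iff h (x := x) (a := a)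
    rename Conv _ _ => hst
    obtain ⟨s', hs⟩ := ihX s fun x a hs => by
      have := hf _ _ (h.2 (closure_cotuple_left.2 hs))
      simp only [h, Ty.dual, Ty.Under, Ty.Cov, closure_cotuple_left, closure_cotuple_right] at this
      exact this.elim (fun h => h.1.under x) _root_.id
    obtain ⟨t', ht⟩ := ihY t fun x a ht => by
      have := hf _ _ (h.2 (closure_cotuple_right.2 ht))
      simp only [h, Ty.dual, Ty.Under, Ty.Cov, closure_cotuple_left, closure_cotuple_right] at this
      exact this.elim (fun h => h.2.under x) _root_.id
    refine ⟨.cotuple s' t', Conv.trans hst ((Conv.cotuple hs ht).trans ?_)⟩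
    cases b
    · exact (Conv.inj₀_cotuple _ _ _).symm
    · exact (Conv.inj₁_cotuple _ _ _).symm
  | mul X Y ihX ihY =>
    -- An arrow through 0 factors through both injections. In the remaining cases the root of the
    -- domain is not covered, so `Under` passes to the factors.
    by_cases hcov : (Ty.mul X Y).dual.Cov fun x => f.closure x []
    · obtain ⟨k, hk⟩ := exists_sat_of_cov_dual hcov
      exact ⟨k.elimZero rfl, (of_sat_elimZero f k hk).trans (inj_elimZero b k rfl).symm⟩
    rcases f.eq_inj_or_eq_proj with ⟨c, f, rfl⟩ | ⟨c, f, rfl⟩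
    · by_cases hc : b = c
      · subst hc; exact ⟨f, .refl _⟩
      · obtain rfl : c = !b := by cases b <;> cases c <;> simp_all
        exact (hcov (Sat.cov_dual (f.sat_closure.mono fun x a h => hf x a (closure_inj_of h)))).elim
    -- The hypothesis passes to the factor because the root of a sum is not a leaf 1, which rules
    -- out the extra tokens created by the projection.
    · have ih : (∀ x a, f.closure x ((!b) :: a) →
          (cond c Y X).dual.Under (fun x => f.closure x []) x) → ∃ f', Conv f (Term.inj b f') := by
        cases c
        · exact ihX f
        · exact ihY f
      obtain ⟨f', h⟩ := ih fun x a h => by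
        have h := (Ty.under_mul_dual.1 (hf _ _ (closure_proj_of h))).resolve_left hcov
        refine h.mono fun x _ h => (closure_proj_same h).resolve_right fun h => h.elim
      exact ⟨_, (Conv.proj c h).trans (proj_inj c b f')⟩

/-- If the domain is covered, both terms are the same arrow through 0. Otherwise the injections
agree, and one strips either the injection or, when tokens may return from the other summand, a
projection common to both terms. The induction hypothesis is an argument because the lemma is also
applied to dual types. -/
theorem inj_inj {X Y A B : Ty}
    (ih : ∀ {X' A' : Ty} (f g : Term X' A'),
      X'.size + A'.size < (Ty.mul X Y).size + (Ty.add A B).size →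
      (∀ x a, f.closure x a ↔ g.closure x a) → Conv f g)
    {b c : Bool} (f : Term (.mul X Y) (cond b B A)) (g : Term (.mul X Y) (cond c B A))
    (h : ∀ x a, (Term.inj (A := A) b f).closure x a ↔ (Term.inj (A := A) c g).closure x a) :
    Conv (Term.inj (A := A) b f) (Term.inj c g) := by
  have of_cov : ((Ty.mul X Y).dual.Cov fun x => (Term.inj (A := A) b f).closure x []) →
      Conv (Term.inj (A := A) b f) (Term.inj c g) := fun hcov => by
    obtain ⟨k, hk⟩ := exists_sat_of_cov_dual hcov
    exact (of_sat_elimZero _ k hk).trans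
      (of_sat_elimZero _ k (hk.mono fun x _ hx => (h x []).1 hx)).symm
  by_cases hcov : (Ty.mul X Y).dual.Cov fun x => (Term.inj (A := A) b f).closure x []
  · exact of_cov hcov
  have hroot : ∀ (d : Bool) (f : Term (.mul X Y) (cond d B A)) x, (Ty.mul X Y).IsZeroLeaf x →
      f.closure x [] → (Term.inj (A := A) d f).closure x [] := fun d f x hx h =>
    (closure_inj_root _ hx).2 (closure_inj_of h)
  by_cases hcb : c = b
  · subst hcb
    have hlt : (Ty.mul X Y).size + (cond c B A).size < (Ty.mul X Y).size + (Ty.add A B).size := by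
      have := Ty.size_cond_add A B c; omega
    have same : (∀ x a, (Term.inj (A := A) c f).closure x (c :: a) ↔ f.closure x a) →
        (∀ x a, (Term.inj (A := A) c g).closure x (c :: a) ↔ g.closure x a) →
        Conv (Term.inj (A := A) c f) (Term.inj c g) := fun hf hg =>
      Conv.inj c (ih f g hlt fun x a => by rw [← hf, ← hg, h])
    -- In the bad case the own summand has no point while the other one has, and the injection may
    -- fail to reflect closures.
    by_cases hgood : (cond c B A).Pointed ∨ ¬ (cond (!c) B A).Pointed
    · exact same (fun _ _ => closure_inj_iff (hgood.imp_right .inl))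
        (fun _ _ => closure_inj_iff (hgood.imp_right .inl))
    by_cases hne : ∃ d x, (cond d Y X).IsZeroLeaf x ∧ (Term.inj (A := A) c f).closure (d :: x) []
    · obtain ⟨d, x, hx, hf⟩ := hne
      have factor : ∀ f : Term (.mul X Y) (cond c B A),
          (Term.inj (A := A) c f).closure (d :: x) [] →
          (¬ (Ty.mul X Y).dual.Cov fun x => (Term.inj (A := A) c f).closure x []) →
          ∃ f', Conv f (Term.proj d f') := fun f hf hcov => by
        rcases Ty.under_mul_dual.1 (closure_inj_nil hf) with hu | hu
        · exact (hcov (hu.mono fun x hx => hroot c f x (Ty.isOneLeaf_dual.1 hx))).elim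
        · obtain ⟨y, hy, h⟩ := hu.exists_leaf
          exact exists_proj f (Ty.isOneLeaf_dual.1 hy) h
      obtain ⟨f', hf'⟩ := factor f hf hcov
      obtain ⟨g', hg'⟩ := factor g ((h _ _).1 hf) (by simpa only [← h] using hcov)
      -- A point of this factor would give a point of the summand through `f'`. So the factor maps
      -- to 0, and the projection, unlike the injection, reflects closures.
      have hX : (cond d Y X).dual.Pointed := by
        rw [Ty.pointed_dual]
        exact fun hX => hgood (.inl (f'.pointed_codomain hX))
      have hf'' := (Conv.inj (A := A) c hf').trans (proj_inj d c f').symm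
      have hg'' := (Conv.inj (A := A) c hg').trans (proj_inj d c g').symm
      refine hf''.trans (.trans (Conv.proj d (ih _ _ ?_ fun x a => ?_)) hg''.symm)
      · have := Ty.size_cond_mul X Y d; omega
      · rw [← closure_proj_iff hX, ← closure_proj_iff hX, ← hf''.closure_iff, ← hg''.closure_iff, h]
    · have hne' : ∀ x, (Ty.mul X Y).IsZeroLeaf x → ¬ (Term.inj (A := A) c f).closure x [] := by
        rintro (_ | ⟨d, x⟩) hx hf
        · exact hx.elim
        · exact hne ⟨d, x, (Ty.isZeroLeaf_mul d x).1 hx, hf⟩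
      exact same
        (fun _ _ => closure_inj_iff (.inr (.inr fun x hx hf => hne' x hx (hroot c f x hx hf))))
        (fun _ _ => closure_inj_iff (.inr (.inr fun x hx hg =>
          hne' x hx ((h _ _).2 (hroot c g x hx hg)))))
  -- With different injections every token of `g` lies in the summand foreign to `f`, hence under
  -- the leaves 0 linked to the root, and so the domain is covered.
  · refine of_cov (Sat.cov_dual (f := g) (g.sat_closure.mono fun x a hg => ?_))
    have hf := (h x (c :: a)).2 (closure_inj_of hg)
    exact (closure_inj_ne hcb hf).mono fun x hx => hroot b f x (Ty.isOneLeaf_dual.1 hx)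

/-- By `exists_inj` the projection can be rewritten as an injection into the same summand, which
reduces the mixed case to `inj_inj`. -/
theorem inj_proj {X Y A B : Ty}
    (ih : ∀ {X' A' : Ty} (f g : Term X' A'),
      X'.size + A'.size < (Ty.mul X Y).size + (Ty.add A B).size →
      (∀ x a, f.closure x a ↔ g.closure x a) → Conv f g)
    {b c : Bool} (f : Term (.mul X Y) (cond b B A)) (g : Term (cond c Y X) (.add A B))
    (h : ∀ x a, (Term.inj (A := A) b f).closure x a ↔ (Term.proj (X := X) c g).closure x a) :
    Conv (Term.inj (A := A) b f) (Term.proj c g) := by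
  obtain ⟨g', hg⟩ := exists_inj (b := b) (Term.proj (X := X) c g) fun x a hg => by
    refine (closure_inj_ne (by simp) ((h _ _).2 hg)).mono fun x hx hf => ?_
    rw [← h]
    exact (closure_inj_root _ (Ty.isOneLeaf_dual.1 hx)).2 (closure_inj_of hf)
  exact (inj_inj ih f g' fun x a => (h x a).trans hg.closure_iff).trans hg.symm

/-- Terms with the same closure are related by the permuting conversions. -/
theorem of_closure_iff {X A : Ty} (f g : Term X A)
    (h : ∀ x a, f.closure x a ↔ g.closure x a) : Conv f g := by
  induction hn : X.size + A.size using Nat.strong_induction_on generalizing X A with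
  | _ n ih =>
  subst hn
  replace ih : ∀ {X' A' : Ty} (f g : Term X' A'), X'.size + A'.size < X.size + A.size →
      (∀ x a, f.closure x a ↔ g.closure x a) → Conv f g := fun f g hlt h => ih _ hlt f g h rfl
  have split_add : ∀ {Y Z : Ty} (u v : Term (.add Y Z) A), X = .add Y Z →
      (∀ x a, u.closure x a ↔ v.closure x a) → Conv u v := by
    rintro Y Z u v rfl huv
    obtain ⟨f₀, f₁, hf⟩ := exists_cotuple u rfl
    obtain ⟨g₀, g₁, hg⟩ := exists_cotuple v rfl
    refine Conv.trans hf (.trans (.cotuple (ih _ _ ?_ fun x a => ?_) (ih _ _ ?_ fun x a => ?_))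
      (Conv.symm hg))
    · simp only [Ty.size]; omega
    · rw [← closure_cotuple_left (s := f₀) (t := f₁), ← hf.closure_iff, huv,
        ← closure_cotuple_left (s := g₀) (t := g₁), ← hg.closure_iff]
    · simp only [Ty.size]; omega
    · rw [← closure_cotuple_right (s := f₀) (t := f₁), ← hf.closure_iff, huv,
        ← closure_cotuple_right (s := g₀) (t := g₁), ← hg.closure_iff]
  have split_mul : ∀ {B C : Ty} (u v : Term X (.mul B C)), A = .mul B C →
      (∀ x a, u.closure x a ↔ v.closure x a) → Conv u v := by
    rintro B C u v rfl huv
    obtain ⟨f₀, f₁, hf⟩ := exists_tuple u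
    obtain ⟨g₀, g₁, hg⟩ := exists_tuple v
    refine Conv.trans hf (.trans (.tuple (ih _ _ ?_ fun x a => ?_) (ih _ _ ?_ fun x a => ?_))
      (Conv.symm hg))
    · simp only [Ty.size]; omega
    · rw [← closure_tuple_left (s := f₀) (t := f₁), ← hf.closure_iff, huv,
        ← closure_tuple_left (s := g₀) (t := g₁), ← hg.closure_iff]
    · simp only [Ty.size]; omega
    · rw [← closure_tuple_right (s := f₀) (t := f₁), ← hf.closure_iff, huv,
        ← closure_tuple_right (s := g₀) (t := g₁), ← hg.closure_iff]
  match X, A, f, g with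
  | .zero, _, _, _ => exact (Conv.zero _).trans (Conv.zero _).symm
  | .one, .zero, f, _ => nomatch f
  | .one, .one, _, _ | .mul _ _, .one, _, _ => exact (Conv.one _).trans (Conv.one _).symm
  | .add Y Z, A, f, g => exact split_add f g rfl h
  | .one, .mul B C, f, g | .mul _ _, .mul B C, f, g => exact split_mul f g rfl h
  | .one, .add A B, f, g =>
    obtain ⟨b, f, rfl⟩ := eq_inj f
    obtain ⟨c, g, rfl⟩ := eq_inj g
    obtain ⟨x, a, hf⟩ := f.sat_closure.nonempty
    obtain ⟨rfl, -⟩ := closure_inj_one.1 ((h _ _).1 (closure_inj_of hf))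
    refine .inj b (ih f g ?_ fun x a => by simpa [closure_inj_one] using h x (b :: a))
    have := Ty.size_cond_add A B b; omega
  | .mul X Y, .zero, f, g =>
    obtain ⟨b, f, rfl⟩ := eq_proj f
    obtain ⟨c, g, rfl⟩ := eq_proj g
    obtain ⟨x, a, hf⟩ := f.sat_closure.nonempty
    obtain ⟨rfl, -⟩ := closure_proj_zero.1 ((h _ _).1 (closure_proj_of hf))
    refine .proj b (ih f g ?_ fun x a => by simpa [closure_proj_zero] using h (b :: x) a)
    have := Ty.size_cond_mul X Y b; omega
  | .mul X Y, .add A B, f, g =>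
    rcases f.eq_inj_or_eq_proj with ⟨b, f, rfl⟩ | ⟨b, f, rfl⟩ <;>
      rcases g.eq_inj_or_eq_proj with ⟨c, g, rfl⟩ | ⟨c, g, rfl⟩
    · exact inj_inj ih f g h
    · exact inj_proj ih f g h
    · exact (inj_proj ih g f fun x a => (h x a).symm).symm
    -- Two projections dualize to two injections between types of the same total size.
    · have ih' : ∀ {X' A' : Ty} (f g : Term X' A'),
          X'.size + A'.size < (Ty.mul A.dual B.dual).size + (Ty.add X.dual Y.dual).size →
          (∀ x a, f.closure x a ↔ g.closure x a) → Conv f g := fun f g hlt h =>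
        ih f g (by simp only [Ty.size, Ty.size_dual] at hlt ⊢; omega) h
      have h' := fun a x => (closure_dual (x := x) (a := a)).trans
        ((h x a).trans closure_dual.symm)
      refine Conv.of_dual ?_
      cases b <;> cases c
      · exact inj_inj ih' (b := false) (c := false) f.dual g.dual h'
      · exact inj_inj ih' (b := false) (c := true) f.dual g.dual h'
      · exact inj_inj ih' (b := true) (c := false) f.dual g.dual h'
      · exact inj_inj ih' (b := true) (c := true) f.dual g.dual h'

end Conv

/-- Two terms denote the same arrow iff the tokens of each are derivable from those of the other. -/
theorem Term.denote_eq_iff_sat {X A : Ty} {f g : Term X A} :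
    f.denote = g.denote ↔ f.Sat g.closure ∧ g.Sat f.closure := by
  rw [Term.denote_eq_iff]
  refine ⟨fun h => ⟨(h.sat_iff g.closed_closure).2 g.sat_closure,
    (h.sat_iff f.closed_closure).1 f.sat_closure⟩, fun h => .of_closure_iff f g fun x a =>
    ⟨fun hf => hf _ g.closed_closure h.1, fun hg => hg _ f.closed_closure h.2⟩⟩

end SumProd

/-! ### Structured stack programs and their compilation to Turing machines. -/

open Function StateTransition

/-- Structured programs on a family of stacks. -/
inductive StackProg {K : Type} (Γ : K → Type) : Type
  | skip : StackProg Γ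
  | push (k : K) (γ : Γ k) : StackProg Γ
  | pop (k : K) : StackProg Γ
  | seq (P Q : StackProg Γ) : StackProg Γ
  /-- branch on the top symbol of a stack -/
  | cases (k : K) (P : Option (Γ k) → StackProg Γ) : StackProg Γ
  /-- repeat as long as a stack is not empty -/
  | loop (k : K) (P : StackProg Γ) : StackProg Γ

namespace StackProg

variable {K : Type} [DecidableEq K] {Γ : K → Type}

/-- Execution of a program from one store to another in a given number of steps. -/
inductive Run : StackProg Γ → (∀ k, List (Γ k)) → (∀ k, List (Γ k)) → ℕ → Prop
  | skip (S) : Run .skip S S 1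
  | push (k γ S) : Run (.push k γ) S (update S k (γ :: S k)) 1
  | pop (k S) : Run (.pop k) S (update S k (S k).tail) 1
  | seq {P Q S S' S'' t t'} : Run P S S' t → Run Q S' S'' t' → Run (.seq P Q) S S'' (t + t')
  | cases {k P S S' t} : Run (P (S k).head?) S S' t → Run (.cases k P) S S' (1 + t)
  | loop_nil {k P S} : S k = [] → Run (.loop k P) S S 1
  | loop_cons {k P S S' S'' t t'} : S k ≠ [] → Run P S S' t → Run (.loop k P) S' S'' t' →
      Run (.loop k P) S S'' (1 + t + t')

/-- The program points of a program. -/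
def Lab : StackProg Γ → Type
  | .skip => Unit
  | .push _ _ => Unit
  | .pop _ => Unit
  | .seq P Q => P.Lab ⊕ Q.Lab
  | .cases _ P => Option (Σ o, (P o).Lab)
  | .loop _ P => Option P.Lab

omit [DecidableEq K] in
theorem finite_lab [∀ k, Finite (Γ k)] : ∀ P : StackProg Γ, Finite P.Lab
  | .skip => inferInstanceAs (Finite Unit)
  | .push _ _ => inferInstanceAs (Finite Unit)
  | .pop _ => inferInstanceAs (Finite Unit)
  | .seq P Q =>
    have := finite_lab P
    have := finite_lab Q
    inferInstanceAs (Finite (P.Lab ⊕ Q.Lab))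
  | .cases _ P =>
    have := fun o => finite_lab (P o)
    inferInstanceAs (Finite (Option (Σ o, (P o).Lab)))
  | .loop _ P =>
    have := finite_lab P
    inferInstanceAs (Finite (Option P.Lab))

/-- The first program point. -/
def entry : (P : StackProg Γ) → P.Lab
  | .skip => ()
  | .push _ _ => ()
  | .pop _ => ()
  | .seq P _ => .inl P.entry
  | .cases _ _ => none
  | .loop _ _ => none

/-- Recover the symbol that was read from stack `k`. -/
def readTop (k : K) : Option (Σ k, Γ k) → Option (Γ k)
  | none => none
  | some ⟨k', γ⟩ => if h : k' = k then some (h ▸ γ) else none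

theorem readTop_map (k : K) (o : Option (Γ k)) :
    readTop k (o.map fun γ => (⟨k, γ⟩ : Σ k, Γ k)) = o := by
  cases o <;> simp [readTop]

/-- Read the top of stack `k` and jump accordingly. -/
def jump {Λ : Type} (k : K) (f : Option (Γ k) → Λ) : Turing.TM2.Stmt Γ Λ (Option (Σ k, Γ k)) :=
  .peek k (fun _ o => o.map fun γ => ⟨k, γ⟩) (.goto fun s => f (readTop k s))

/-- The machine code of a program, placed at the labels `κ`, that jumps to `exit` at the end. -/
def code {Λ : Type} : (P : StackProg Γ) → (κ : P.Lab → Λ) → (exit : Λ) → P.Lab →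
    Turing.TM2.Stmt Γ Λ (Option (Σ k, Γ k))
  | .skip, _, exit, _ => .goto fun _ => exit
  | .push k γ, _, exit, _ => .push k (fun _ => γ) (.goto fun _ => exit)
  | .pop k, _, exit, _ => .pop k (fun s _ => s) (.goto fun _ => exit)
  | .seq P Q, κ, _, .inl l => P.code (fun l => κ (.inl l)) (κ (.inr Q.entry)) l
  | .seq _ Q, κ, exit, .inr l => Q.code (fun l => κ (.inr l)) exit l
  | .cases k P, κ, _, none => jump k fun o => κ (some ⟨o, (P o).entry⟩)
  | .cases _ P, κ, exit, some ⟨o, l⟩ => (P o).code (fun l => κ (some ⟨o, l⟩)) exit l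
  | .loop k P, κ, exit, none => jump k fun o => if o.isSome then κ (some P.entry) else exit
  | .loop _ P, κ, _, some l => P.code (fun l => κ (some l)) (κ none) l

/-- The configuration `c` leads to `c'` in `t` steps. -/
def Steps {Λ σ : Type} (M : Λ → Turing.TM2.Stmt Γ Λ σ) (t : ℕ)
    (c c' : Turing.TM2.Cfg Γ Λ σ) : Prop :=
  (flip bind (Turing.TM2.step M))^[t] (some c) = some c'

theorem Steps.trans {Λ σ : Type} {M : Λ → Turing.TM2.Stmt Γ Λ σ} {t t' : ℕ}
    {c c' c'' : Turing.TM2.Cfg Γ Λ σ} (h : Steps M t c c') (h' : Steps M t' c' c'') :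
    Steps M (t + t') c c'' := by
  unfold Steps at *
  rw [add_comm, iterate_add_apply, h, h']

/-- The internal state only carries a symbol from a peek to the jump in the same step. It may thus
be arbitrary before the program and unspecified after it. -/
theorem Run.steps {Λ : Type} {M : Λ → Turing.TM2.Stmt Γ Λ (Option (Σ k, Γ k))}
    {P : StackProg Γ} {S S' : ∀ k, List (Γ k)} {t : ℕ} (h : Run P S S' t) {κ : P.Lab → Λ}
    {exit : Λ} (hM : ∀ l, M (κ l) = P.code κ exit l) (v : Option (Σ k, Γ k)) :
    ∃ v', Steps M t ⟨some (κ P.entry), v, S⟩ ⟨some exit, v', S'⟩ := by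
  have jumps : ∀ {l : Λ} {k : K} {f : Option (Γ k) → Λ} (v S), M l = jump k f →
      Steps M 1 ⟨some l, v, S⟩
        ⟨some (f (S k).head?), (S k).head?.map fun γ => ⟨k, γ⟩, S⟩ := fun v S h => by
    simp [Steps, flip, h, jump, Turing.TM2.step, readTop_map]
  induction h generalizing exit v with
  | skip S => exact ⟨v, by simp [Steps, flip, Turing.TM2.step, hM, code]⟩
  | push k γ S => exact ⟨v, by simp [Steps, flip, Turing.TM2.step, hM, code]⟩
  | pop k S => exact ⟨v, by simp [Steps, flip, Turing.TM2.step, hM, code]⟩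
  | @seq P Q S S' S'' t t' _ _ ih ih' =>
    obtain ⟨v', h⟩ := ih (κ := fun l => κ (.inl l)) (exit := κ (.inr Q.entry))
      (fun l => hM (.inl l)) v
    obtain ⟨v'', h'⟩ := ih' (κ := fun l => κ (.inr l)) (fun l => hM (.inr l)) v'
    exact ⟨v'', h.trans h'⟩
  | @cases k P S S' t _ ih =>
    obtain ⟨v', h⟩ := ih (κ := fun l => κ (some ⟨_, l⟩)) (exit := exit)
      (fun l => hM (some ⟨_, l⟩)) _
    exact ⟨v', (jumps v S (hM none)).trans h⟩
  | @loop_nil k P S h =>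
    have := jumps v S (hM none)
    simp only [h, List.head?_nil] at this
    exact ⟨_, this⟩
  | @loop_cons k P S S' S'' t t' hS _ _ ih ih' =>
    have h0 := jumps v S (hM none)
    obtain ⟨γ, l, hl⟩ := List.exists_cons_of_ne_nil hS
    simp only [hl, List.head?_cons] at h0
    obtain ⟨v', h⟩ := ih (κ := fun l => κ (some l)) (exit := κ none) (fun l => hM (some l)) _
    obtain ⟨v'', h'⟩ := ih' hM v'
    exact ⟨v'', (h0.trans h).trans h'⟩

variable [Fintype K] [∀ k, Finite (Γ k)]

open Classical in
/-- The Turing machine that executes a program. -/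
noncomputable def machine (P : StackProg Γ) (k₀ k₁ : K) : Turing.FinTM2 :=
  have := P.finite_lab
  { K := K
    k₀ := k₀
    k₁ := k₁
    Γ := Γ
    Λ := Option P.Lab
    main := some P.entry
    ΛFin := Fintype.ofFinite _
    σ := Option (Σ k, Γ k)
    initialState := none
    σFin := Fintype.ofFinite _
    Γk₀Fin := Fintype.ofFinite _
    m := fun l => match l with
      | none => .load (fun _ => none) .halt
      | some l => P.code some none l }

/-- The store with the word `w` on stack `k` and all other stacks empty. -/
def single (k : K) (w : List (Γ k)) : ∀ k, List (Γ k) := update (fun _ => []) k w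

-- The instance is a variable so that the lemma matches whichever decision procedure occurs in the
-- initial and final configurations.
omit [Fintype K] [∀ k, Finite (Γ k)] in
theorem dite_eq_single {k₀ : K} (w : List (Γ k₀)) (k : K) (inst : Decidable (k = k₀)) :
    @dite (List (Γ k)) (k = k₀) inst (fun h => by rw [h]; exact w) (fun _ => []) =
      single k₀ w k := by
  by_cases hk : k = k₀
  · subst hk; simp [single]
  · simp [single, hk]

theorem initList_machine (P : StackProg Γ) (k₀ k₁ : K) (w : List (Γ k₀)) :
    Turing.initList (P.machine k₀ k₁) w = ⟨some (some P.entry), none, single k₀ w⟩ :=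
  congrArg (Turing.TM2.Cfg.mk _ _) (funext fun k => dite_eq_single w k _)

theorem haltList_machine (P : StackProg Γ) (k₀ k₁ : K) (w : List (Γ k₁)) :
    Turing.haltList (P.machine k₀ k₁) w = ⟨none, none, single k₁ w⟩ :=
  congrArg (Turing.TM2.Cfg.mk _ _) (funext fun k => dite_eq_single w k _)

theorem Run.outputs {P : StackProg Γ} {k₀ k₁ : K} {w : List (Γ k₀)} {w' : List (Γ k₁)} {t n : ℕ}
    (h : Run P (single k₀ w) (single k₁ w') t) (hn : t + 1 ≤ n) :
    Nonempty (Turing.TM2OutputsInTime (P.machine k₀ k₁) w (some w') n) := by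
  obtain ⟨v, hs⟩ := h.steps (M := (P.machine k₀ k₁).m) (κ := some) (exit := none)
    (fun _ => rfl) none
  -- The label `none` resets the internal state, as a halting configuration requires, and halts;
  -- this is the extra step in the bound.
  have hlast : Steps (P.machine k₀ k₁).m 1 ⟨some none, v, single k₁ w'⟩
      ⟨none, none, single k₁ w'⟩ := rfl
  refine ⟨⟨⟨t + 1, ?_⟩, hn⟩⟩
  show _ = some (Turing.haltList (P.machine k₀ k₁) w')
  rw [initList_machine, haltList_machine]
  exact hs.trans hlast

end StackProg

/-! ### The interpreter: states as stacks, bounded counters, loops and tapes. -/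

namespace Datalog
open Function StackProg

/-- Counters: the variables of the rules, and auxiliary counters. -/
abbrev Ctr := Fin 8 ⊕ Fin 10

/-- The stacks of the interpreter. Each counter `c` comes with a stack `co c` that holds the
complement of its value with respect to the common bound. -/
inductive Stk : Type
  | inp | inpA | out | mem | memA | tmp | tmp' | flag
  | ctr (c : Ctr)
  | co (c : Ctr)
  deriving DecidableEq, Fintype

/-- The alphabets of the stacks. A cell of the memory stores a set of relation symbols. -/
abbrev Alph (Γ₀ R : Type) : Stk → Type
  | .inp => Γ₀
  | .inpA => Γ₀
  | .out => Bool
  | .mem => R → Bool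
  | .memA => R → Bool
  | .tmp => Unit
  | .tmp' => Unit
  | .flag => Unit
  | .ctr _ => Unit
  | .co _ => Unit

instance finite_alph {Γ₀ R : Type} [Finite Γ₀] [Finite R] (k : Stk) : Finite (Alph Γ₀ R k) := by
  cases k <;> simp only [Alph] <;> infer_instance

variable {Γ₀ R : Type}

/-- A state of the interpreter, where each counter `c` is bounded by `N c`. -/
@[ext] structure St (Γ₀ R : Type) where
  N : Ctr → ℕ := 0
  inp : List Γ₀
  inpA : List Γ₀ := []
  mem : List (R → Bool) := []
  memA : List (R → Bool) := []
  ctr : Ctr → ℕ := 0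
  tmp : ℕ := 0
  tmp' : ℕ := 0
  flag : ℕ := 0

/-- The stacks that represent a state. -/
def St.store (s : St Γ₀ R) : ∀ k, List (Alph Γ₀ R k)
  | .inp => s.inp
  | .inpA => s.inpA
  | .out => []
  | .mem => s.mem
  | .memA => s.memA
  | .tmp => List.replicate s.tmp ()
  | .tmp' => List.replicate s.tmp' ()
  | .flag => List.replicate s.flag ()
  | .ctr c => List.replicate (s.ctr c) ()
  | .co c => List.replicate (s.N c - s.ctr c) ()

/-- The program leads from `s` to `s'` in at most `t` steps. -/
def Imp (P : StackProg (Alph Γ₀ R)) (s s' : St Γ₀ R) (t : ℕ) : Prop :=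
  ∃ t' ≤ t, Run P s.store s'.store t'

theorem Imp.mono {P : StackProg (Alph Γ₀ R)} {s s' : St Γ₀ R} {t t' : ℕ} (h : Imp P s s' t)
    (ht : t ≤ t') : Imp P s s' t' :=
  let ⟨u, hu, h⟩ := h
  ⟨u, hu.trans ht, h⟩

theorem Imp.skip (s : St Γ₀ R) : Imp .skip s s 1 := ⟨1, le_rfl, .skip _⟩

theorem Imp.seq {P Q : StackProg (Alph Γ₀ R)} {s s' s'' : St Γ₀ R} {t t' : ℕ}
    (h : Imp P s s' t) (h' : Imp Q s' s'' t') : Imp (.seq P Q) s s'' (t + t') :=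
  let ⟨u, hu, h⟩ := h
  let ⟨u', hu', h'⟩ := h'
  ⟨u + u', by omega, .seq h h'⟩

theorem Imp.cases {k : Stk} {P : Option (Alph Γ₀ R k) → StackProg (Alph Γ₀ R)} {s s' : St Γ₀ R}
    {t : ℕ} (h : Imp (P (s.store k).head?) s s' t) : Imp (.cases k P) s s' (1 + t) :=
  let ⟨u, hu, h⟩ := h
  ⟨1 + u, by omega, .cases h⟩

theorem Imp.loop {k : Stk} {P : StackProg (Alph Γ₀ R)} {t : ℕ} (n : ℕ) (s : ℕ → St Γ₀ R)
    (h : ∀ i < n, (s i).store k ≠ [] ∧ Imp P (s i) (s (i + 1)) t) (hn : (s n).store k = []) :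
    Imp (.loop k P) (s 0) (s n) (n * (1 + t) + 1) := by
  induction n generalizing s with
  | zero => exact ⟨1, by omega, .loop_nil hn⟩
  | succ n ih =>
    obtain ⟨u, hu, h1⟩ := ih (fun i => s (i + 1)) (fun i hi => h (i + 1) (by omega)) hn
    obtain ⟨h0, v, hv, h2⟩ := h 0 (by omega)
    refine ⟨1 + v + u, ?_, .loop_cons h0 h2 h1⟩
    have : (n + 1) * (1 + t) = n * (1 + t) + (1 + t) := by ring
    omega

theorem Imp.loop_nil {k : Stk} {P : StackProg (Alph Γ₀ R)} {s : St Γ₀ R} (h : s.store k = []) :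
    Imp (.loop k P) s s 1 := ⟨1, le_rfl, .loop_nil h⟩

theorem Imp.loop_cons {k : Stk} {P : StackProg (Alph Γ₀ R)} {s s' s'' : St Γ₀ R} {t t' : ℕ}
    (h : s.store k ≠ []) (h1 : Imp P s s' t) (h2 : Imp (.loop k P) s' s'' t') :
    Imp (.loop k P) s s'' (1 + t + t') :=
  let ⟨u, hu, h1⟩ := h1
  let ⟨u', hu', h2⟩ := h2
  ⟨1 + u + u', by omega, .loop_cons h h1 h2⟩

/-- Increment a counter. -/
def tick (c : Ctr) : StackProg (Alph Γ₀ R) := .seq (.pop (.co c)) (.push (.ctr c) ())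

/-- Decrement a counter. -/
def untick (c : Ctr) : StackProg (Alph Γ₀ R) := .seq (.pop (.ctr c)) (.push (.co c) ())

theorem imp_push {k : Stk} {γ : Alph Γ₀ R k} {s s' : St Γ₀ R}
    (h : s'.store = update s.store k (γ :: s.store k)) : Imp (.push k γ) s s' 1 :=
  ⟨1, le_rfl, h ▸ .push _ _ _⟩

theorem imp_pop {k : Stk} {s s' : St Γ₀ R}
    (h : s'.store = update s.store k (s.store k).tail) : Imp (.pop k) s s' 1 :=
  ⟨1, le_rfl, h ▸ .pop _ _⟩

theorem imp_tick {s : St Γ₀ R} {c : Ctr} (h : s.ctr c < s.N c) :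
    Imp (tick c) s { s with ctr := update s.ctr c (s.ctr c + 1) } 2 := by
  have e : St.store { s with ctr := update s.ctr c (s.ctr c + 1) } =
      update (update s.store (.co c) (s.store (.co c)).tail) (.ctr c)
        (() :: update s.store (.co c) (s.store (.co c)).tail (.ctr c)) := by
    funext k
    cases k with
    | ctr d =>
      by_cases hd : d = c
      · subst hd; simp [St.store, update, List.replicate_succ]
      · simp [St.store, update, hd]
    | co d =>
      by_cases hd : d = c
      · subst hd; simp [St.store, update, List.tail_replicate, Nat.sub_sub]
      · simp [St.store, update, hd]
    | _ => simp [St.store, update]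
  exact ⟨1 + 1, le_rfl, .seq (.pop _ _) (e ▸ .push _ _ _)⟩

theorem imp_untick {s : St Γ₀ R} {c : Ctr} (h : s.ctr c ≠ 0) (h' : s.ctr c ≤ s.N c) :
    Imp (untick c) s { s with ctr := update s.ctr c (s.ctr c - 1) } 2 := by
  have e : St.store { s with ctr := update s.ctr c (s.ctr c - 1) } =
      update (update s.store (.ctr c) (s.store (.ctr c)).tail) (.co c)
        (() :: update s.store (.ctr c) (s.store (.ctr c)).tail (.co c)) := by
    funext k
    cases k with
    | ctr d =>
      by_cases hd : d = c
      · subst hd; simp [St.store, update, List.tail_replicate]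
      · simp [St.store, update, hd]
    | co d =>
      by_cases hd : d = c
      · subst hd
        have : s.N d - (s.ctr d - 1) = (s.N d - s.ctr d) + 1 := by omega
        simp [St.store, update, this, List.replicate_succ]
      · simp [St.store, update, hd]
    | _ => simp [St.store, update]
  exact ⟨1 + 1, le_rfl, .seq (.pop _ _) (e ▸ .push _ _ _)⟩

theorem imp_pushTmp (s : St Γ₀ R) : Imp (.push .tmp ()) s { s with tmp := s.tmp + 1 } 1 :=
  imp_push (by funext k; cases k <;> simp [St.store, update, List.replicate_succ])

theorem imp_popTmp (s : St Γ₀ R) : Imp (.pop .tmp) s { s with tmp := s.tmp - 1 } 1 :=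
  imp_pop (by funext k; cases k <;> simp [St.store, update, List.tail_replicate])

theorem imp_pushTmp' (s : St Γ₀ R) : Imp (.push .tmp' ()) s { s with tmp' := s.tmp' + 1 } 1 :=
  imp_push (by funext k; cases k <;> simp [St.store, update, List.replicate_succ])

theorem imp_popTmp' (s : St Γ₀ R) : Imp (.pop .tmp') s { s with tmp' := s.tmp' - 1 } 1 :=
  imp_pop (by funext k; cases k <;> simp [St.store, update, List.tail_replicate])

theorem imp_pushFlag (s : St Γ₀ R) : Imp (.push .flag ()) s { s with flag := s.flag + 1 } 1 :=
  imp_push (by funext k; cases k <;> simp [St.store, update, List.replicate_succ])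

theorem imp_popFlag (s : St Γ₀ R) : Imp (.pop .flag) s { s with flag := s.flag - 1 } 1 :=
  imp_pop (by funext k; cases k <;> simp [St.store, update, List.tail_replicate])

theorem imp_pushMem (s : St Γ₀ R) (a : R → Bool) :
    Imp (.push .mem a) s { s with mem := a :: s.mem } 1 :=
  imp_push (by funext k; cases k <;> simp [St.store, update])

theorem imp_popMem (s : St Γ₀ R) : Imp (.pop .mem) s { s with mem := s.mem.tail } 1 :=
  imp_pop (by funext k; cases k <;> simp [St.store, update])

theorem imp_pushMemA (s : St Γ₀ R) (a : R → Bool) :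
    Imp (.push .memA a) s { s with memA := a :: s.memA } 1 :=
  imp_push (by funext k; cases k <;> simp [St.store, update])

theorem imp_popMemA (s : St Γ₀ R) : Imp (.pop .memA) s { s with memA := s.memA.tail } 1 :=
  imp_pop (by funext k; cases k <;> simp [St.store, update])

theorem imp_pushInp (s : St Γ₀ R) (a : Γ₀) :
    Imp (.push .inp a) s { s with inp := a :: s.inp } 1 :=
  imp_push (by funext k; cases k <;> simp [St.store, update])

theorem imp_popInp (s : St Γ₀ R) : Imp (.pop .inp) s { s with inp := s.inp.tail } 1 :=
  imp_pop (by funext k; cases k <;> simp [St.store, update])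

theorem imp_pushInpA (s : St Γ₀ R) (a : Γ₀) :
    Imp (.push .inpA a) s { s with inpA := a :: s.inpA } 1 :=
  imp_push (by funext k; cases k <;> simp [St.store, update])

theorem imp_popInpA (s : St Γ₀ R) : Imp (.pop .inpA) s { s with inpA := s.inpA.tail } 1 :=
  imp_pop (by funext k; cases k <;> simp [St.store, update])

theorem imp_bump (s : St Γ₀ R) {c : Ctr} (h : s.ctr c ≤ s.N c) :
    Imp (.push (.co c) ()) s { s with N := update s.N c (s.N c + 1) } 1 := by
  refine imp_push ?_
  funext k
  cases k with
  | co d =>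
    by_cases hd : d = c
    · subst hd
      have : s.N d + 1 - s.ctr d = (s.N d - s.ctr d) + 1 := by omega
      simp [St.store, update, this, List.replicate_succ]
    · simp [St.store, update, hd]
  | _ => simp [St.store, update]

/-! ### Loops over counters -/

/-- Run a program for all values of a counter. -/
def forCtr (c : Ctr) (P : StackProg (Alph Γ₀ R)) : StackProg (Alph Γ₀ R) :=
  .seq (.loop (.co c) (.seq P (tick c))) (.loop (.ctr c) (untick c))

/-- Set a counter. -/
def St.set (s : St Γ₀ R) (c : Ctr) (i : ℕ) : St Γ₀ R := { s with ctr := update s.ctr c i }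

/-- Set the temporary stack. -/
def St.setTmp (s : St Γ₀ R) (i : ℕ) : St Γ₀ R := { s with tmp := i }

/-- The loop ends when the complement of `c` is used up, that is at `c = n`; a second loop resets
`c`. The family `s` describes the state before each pass apart from the value of `c`. -/
theorem imp_forCtr {c : Ctr} {P : StackProg (Alph Γ₀ R)} {t n : ℕ} (s : ℕ → St Γ₀ R)
    (hN : ∀ i, (s i).N c = n) (h : ∀ i < n, Imp P ((s i).set c i) ((s (i + 1)).set c i) t) :
    Imp (forCtr c P) ((s 0).set c 0) ((s n).set c 0) (n * (t + 6) + 2) := by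
  have h1 : Imp (.loop (.co c) (.seq P (tick c))) ((s 0).set c 0) ((s n).set c n)
      (n * (1 + (t + 2)) + 1) := by
    refine Imp.loop n (fun i => (s i).set c i) (fun i hi => ⟨?_, (h i hi).seq ?_⟩) ?_
    · simp [St.store, St.set, hN]; omega
    · convert imp_tick ?_ using 1
      · simp [St.set]
      · simpa [St.set, hN] using hi
    · simp [St.store, St.set, hN]
  have h2 : Imp (.loop (.ctr c) (untick c)) ((s n).set c n) ((s n).set c 0)
      (n * (1 + 2) + 1) := by
    have := Imp.loop (k := .ctr c) (P := untick c) (t := 2) n (fun i => (s n).set c (n - i))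
      (fun i hi => ⟨?_, ?_⟩) ?_
    · simpa using this
    · simp [St.store, St.set]; omega
    · convert imp_untick (c := c) ?_ ?_ using 1
      · simp [St.set, Nat.sub_sub]
      · simp [St.set]; omega
      · simp [St.set, hN]
    · simp [St.store, St.set]
  refine (h1.seq h2).mono ?_
  ring_nf; omega

/-- Run a program as many times as the value of a counter. -/
def times (c : Ctr) (P : StackProg (Alph Γ₀ R)) : StackProg (Alph Γ₀ R) :=
  .seq (.loop (.ctr c) (.seq (untick c) (.seq (.push .tmp ()) P)))
    (.loop .tmp (.seq (.pop .tmp) (tick c)))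

/-- The units removed from `c` are collected on `tmp` and put back in the end. During the loop the
body sees other values of `c` and `tmp`, hence the hypothesis for all `j` and `k`. -/
theorem imp_times {c : Ctr} {P : StackProg (Alph Γ₀ R)} {t n : ℕ} (s : ℕ → St Γ₀ R) (m : ℕ)
    (hN : ∀ i, (s i).N c = n) (hm : m ≤ n) (hc : ∀ i, (s i).ctr c = m) (h0 : ∀ i, (s i).tmp = 0)
    (h : ∀ i j k, Imp P (((s i).set c j).setTmp k) (((s (i + 1)).set c j).setTmp k) t) :
    Imp (times c P) (s 0) (s m) (n * (t + 8) + 2) := by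
  have h1 := Imp.loop (k := .ctr c) (P := .seq (untick c) (.seq (.push .tmp ()) P))
    (t := 2 + (1 + t)) m (fun i => ((s i).set c (m - i)).setTmp i) (fun i hi => ⟨?_, ?_⟩) ?_
  rotate_left
  · simp [St.store, St.set, St.setTmp]; omega
  · refine Imp.seq (imp_untick (c := c) ?_ ?_) (.seq (imp_pushTmp _) ?_)
    · simp [St.set, St.setTmp]; omega
    · simp [St.set, St.setTmp, hN]; omega
    · convert h i (m - (i + 1)) (i + 1) using 1
      simp [St.set, St.setTmp, Nat.sub_sub]
  · simp [St.store, St.set, St.setTmp]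
  have h2 := Imp.loop (k := .tmp) (P := .seq (.pop .tmp) (tick c))
    (t := 1 + 2) m (fun i => ((s m).set c i).setTmp (m - i)) (fun i hi => ⟨?_, ?_⟩) ?_
  rotate_left
  · simp [St.store, St.setTmp]; omega
  · refine Imp.seq (imp_popTmp _) ?_
    convert imp_tick (c := c) ?_ using 1
    · simp [St.set, St.setTmp, Nat.sub_sub]
    · simp [St.set, St.setTmp, hN]; omega
  · simp [St.store, St.setTmp]
  have e0 : ((s 0).set c (m - 0)).setTmp 0 = s 0 := by
    rw [Nat.sub_zero]
    ext1 <;> simp [St.set, St.setTmp, ← hc 0, h0]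
  have e1 : ((s m).set c m).setTmp (m - m) = s m := by
    rw [Nat.sub_self]
    ext1 <;> simp only [St.set, St.setTmp, h0]
    rw [update_eq_iff]; exact ⟨(hc m).symm, fun _ _ => rfl⟩
  rw [e0, Nat.sub_self] at h1
  rw [e1] at h2
  refine (h1.seq h2).mono ?_
  have := Nat.mul_le_mul_right (t + 8) hm
  have e : m * (1 + (2 + (1 + t))) + 1 + (m * (1 + (1 + 2)) + 1) = m * (t + 8) + 2 := by ring
  omega

/-- A family of state changes, additive in the parameter, that neither read nor write the
counters. -/
structure IsAct (f : ℕ → St Γ₀ R → St Γ₀ R) : Prop where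
  zero (s) : f 0 s = s
  add (a b s) : f (a + b) s = f b (f a s)
  N (a s) : (f a s).N = s.N
  tmp (a s) : (f a s).tmp = s.tmp
  ctr (a s) : (f a s).ctr = s.ctr
  set (a s c i) : (f a s).set c i = f a (s.set c i)
  setTmp (a s i) : (f a s).setTmp i = f a (s.setTmp i)

/-- The program performs `f m` in `t` steps if the counters are bounded by `n` and those in `D` are
zero. -/
def Acts (f : ℕ → St Γ₀ R → St Γ₀ R) (n : ℕ) (D : Set Ctr) (P : StackProg (Alph Γ₀ R))
    (m t : ℕ) : Prop :=
  ∀ s : St Γ₀ R, (∀ c, s.N c = n) → (∀ d ∈ D, s.ctr d = 0) → Imp P s (f m s) t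

theorem St.set_self {s : St Γ₀ R} {c : Ctr} {i : ℕ} (h : s.ctr c = i) : s.set c i = s := by
  subst h; simp [St.set]

/-- A loop must find its own counter at zero, so `D` collects the counters of all nested loops, and
these must be distinct. -/
theorem Acts.forCtr {f : ℕ → St Γ₀ R → St Γ₀ R} (hf : IsAct f) {n : ℕ} {D : Set Ctr}
    {P : StackProg (Alph Γ₀ R)} {m t : ℕ} (h : Acts f n D P m t) {c : Ctr} (hc : c ∉ D) :
    Acts f n (insert c D) (Datalog.forCtr c P) (n * m) (n * (t + 6) + 2) := by
  intro s hN hs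
  have hs0 : s.set c 0 = s := St.set_self (hs c (by simp))
  have := imp_forCtr (c := c) (P := P) (t := t) (n := n) (fun i => f (i * m) s)
    (fun i => by rw [hf.N, hN]) fun i hi => by
      rw [add_mul, one_mul, hf.add, hf.set m]
      refine h _ (fun d => by rw [← hN d]; simp [St.set, hf.N]) fun d hd => ?_
      have : d ≠ c := fun h => hc (h ▸ hd)
      simp [St.set, hf.ctr, this, hs d (by simp [hd])]
  simpa only [hf.set, hs0, zero_mul, hf.zero] using this

theorem Acts.times {f : ℕ → St Γ₀ R → St Γ₀ R} (hf : IsAct f) {n : ℕ} {D : Set Ctr}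
    {P : StackProg (Alph Γ₀ R)} {m t : ℕ} (h : Acts f n D P m t) {c : Ctr} (hc : c ∉ D)
    {s : St Γ₀ R} (hN : ∀ c, s.N c = n) (hs : ∀ d ∈ D, s.ctr d = 0) (hcn : s.ctr c ≤ n)
    (h0 : s.tmp = 0) :
    Imp (Datalog.times c P) s (f (s.ctr c * m) s) (n * (t + 8) + 2) := by
  have := imp_times (c := c) (P := P) (t := t) (n := n) (fun i => f (i * m) s) (s.ctr c)
    (fun i => by rw [hf.N, hN]) hcn (fun i => by rw [hf.ctr]) (fun i => by rw [hf.tmp, h0])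
    fun i j k => by
      rw [add_mul, one_mul, hf.add, hf.set m, hf.setTmp m]
      refine h _ (fun d => by rw [← hN d]; simp [St.set, St.setTmp, hf.N]) fun d hd => ?_
      have : d ≠ c := fun h => hc (h ▸ hd)
      simp [St.set, St.setTmp, hf.ctr, this, hs d hd]
  simpa only [zero_mul, hf.zero] using this

/-! ### Moving along the memory and the input -/

/-- Move on by one memory cell. -/
def stepMem : StackProg (Alph Γ₀ R) :=
  .cases .mem fun
    | none => .skip
    | some a => .seq (.pop .mem) (.push .memA a)

/-- Move back to the first memory cell. -/
def rewindMem : StackProg (Alph Γ₀ R) :=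
  .loop .memA <| .cases .memA fun
    | none => .skip
    | some a => .seq (.pop .memA) (.push .mem a)

/-- Move on by some memory cells. -/
def St.advMem (k : ℕ) (s : St Γ₀ R) : St Γ₀ R :=
  { s with mem := s.mem.drop k, memA := (s.mem.take k).reverse ++ s.memA }

theorem isAct_advMem : IsAct (St.advMem : ℕ → St Γ₀ R → St Γ₀ R) where
  zero s := by simp [St.advMem]
  add a b s := by simp [St.advMem, List.take_add, List.drop_drop]
  N _ _ := rfl
  tmp _ _ := rfl
  ctr _ _ := rfl
  set _ _ _ _ := rfl
  setTmp _ _ _ := rfl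

theorem imp_stepMem (s : St Γ₀ R) : Imp stepMem s (s.advMem 1) 3 := by
  refine Imp.cases (t := 2) ?_
  rcases h : s.mem with _ | ⟨a, l⟩
  · have : s.advMem 1 = s := by ext1 <;> simp [St.advMem, h]
    rw [this]
    simpa [St.store, h] using (Imp.skip s).mono one_le_two
  · have : s.advMem 1 = { s with mem := s.mem.tail, memA := a :: s.memA } := by
      ext1 <;> simp [St.advMem, h]
    rw [this]
    simpa [St.store, h] using (imp_popMem s).seq (imp_pushMemA _ a)

theorem imp_rewindMem (s : St Γ₀ R) :
    Imp rewindMem s { s with mem := s.memA.reverse ++ s.mem, memA := [] }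
      (s.memA.length * 4 + 1) := by
  obtain ⟨l, hl⟩ : ∃ l, s.memA = l := ⟨_, rfl⟩
  induction l generalizing s with
  | nil =>
    have : { s with mem := s.memA.reverse ++ s.mem, memA := [] } = s := by ext1 <;> simp [hl]
    rw [this, hl]
    exact Imp.loop_nil hl
  | cons a l ih =>
    have h := ih { s with mem := a :: s.mem, memA := s.memA.tail } (by simp [hl])
    have e : { s with mem := s.memA.reverse ++ s.mem, memA := [] } =
        { s with mem := s.memA.tail.reverse ++ a :: s.mem, memA := [] } := by
      ext1 <;> simp [hl]
    rw [e]
    refine (Imp.loop_cons (t := 3) (by simp [St.store, hl]) (Imp.cases (t := 2) ?_) h).mono ?_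
    · simpa [St.store, hl] using (imp_popMemA s).seq (imp_pushMem _ a)
    · simp [hl]; omega

/-- Move on by one input letter. -/
def stepInp : StackProg (Alph Γ₀ R) :=
  .cases .inp fun
    | none => .skip
    | some a => .seq (.pop .inp) (.push .inpA a)

/-- Move back to the first input letter. -/
def rewindInp : StackProg (Alph Γ₀ R) :=
  .loop .inpA <| .cases .inpA fun
    | none => .skip
    | some a => .seq (.pop .inpA) (.push .inp a)

/-- Move on by some input letters. -/
def St.advInp (k : ℕ) (s : St Γ₀ R) : St Γ₀ R :=
  { s with inp := s.inp.drop k, inpA := (s.inp.take k).reverse ++ s.inpA }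

theorem isAct_advInp : IsAct (St.advInp : ℕ → St Γ₀ R → St Γ₀ R) where
  zero s := by simp [St.advInp]
  add a b s := by simp [St.advInp, List.take_add, List.drop_drop]
  N _ _ := rfl
  tmp _ _ := rfl
  ctr _ _ := rfl
  set _ _ _ _ := rfl
  setTmp _ _ _ := rfl

theorem imp_stepInp (s : St Γ₀ R) : Imp stepInp s (s.advInp 1) 3 := by
  refine Imp.cases (t := 2) ?_
  rcases h : s.inp with _ | ⟨a, l⟩
  · have : s.advInp 1 = s := by ext1 <;> simp [St.advInp, h]
    rw [this]
    simpa [St.store, h] using (Imp.skip s).mono one_le_two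
  · have : s.advInp 1 = { s with inp := s.inp.tail, inpA := a :: s.inpA } := by
      ext1 <;> simp [St.advInp, h]
    rw [this]
    simpa [St.store, h] using (imp_popInp s).seq (imp_pushInpA _ a)

theorem imp_rewindInp (s : St Γ₀ R) :
    Imp rewindInp s { s with inp := s.inpA.reverse ++ s.inp, inpA := [] }
      (s.inpA.length * 4 + 1) := by
  obtain ⟨l, hl⟩ : ∃ l, s.inpA = l := ⟨_, rfl⟩
  induction l generalizing s with
  | nil =>
    have : { s with inp := s.inpA.reverse ++ s.inp, inpA := [] } = s := by ext1 <;> simp [hl]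
    rw [this, hl]
    exact Imp.loop_nil hl
  | cons a l ih =>
    have h := ih { s with inp := a :: s.inp, inpA := s.inpA.tail } (by simp [hl])
    have e : { s with inp := s.inpA.reverse ++ s.inp, inpA := [] } =
        { s with inp := s.inpA.tail.reverse ++ a :: s.inp, inpA := [] } := by
      ext1 <;> simp [hl]
    rw [e]
    refine (Imp.loop_cons (t := 3) (by simp [St.store, hl]) (Imp.cases (t := 2) ?_) h).mono ?_
    · simpa [St.store, hl] using (imp_popInpA s).seq (imp_pushInp _ a)
    · simp [hl]; omega

end Datalog

/-! ### Horn clauses over a word, storage of facts, and tests of conditions. -/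

namespace Datalog
open Function StackProg

variable {Γ₀ R : Type}

/-- A condition in the body of a rule, about the values of variables in an input word. -/
inductive Cond (Γ₀ R : Type) : Type
  /-- the letter at a position satisfies `p` -/
  | letter (v : Fin 8) (p : Γ₀ → Bool)
  /-- a ternary relation -/
  | fact (r : R) (a b c : Fin 8)
  /-- the second value is the successor of the first one -/
  | succ (v v' : Fin 8)
  /-- the value is zero -/
  | zero (v : Fin 8)

/-- The meaning of a condition. -/
def Cond.Holds (w : List Γ₀) (I : R → ℕ → ℕ → ℕ → Prop) (e : Fin 8 → ℕ) : Cond Γ₀ R → Prop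
  | .letter v p => ∃ l, w[e v]? = some l ∧ p l = true
  | .fact r a b c => I r (e a) (e b) (e c)
  | .succ v v' => e v' = e v + 1
  | .zero v => e v = 0

theorem Cond.Holds.mono {w : List Γ₀} {I J : R → ℕ → ℕ → ℕ → Prop} {e : Fin 8 → ℕ}
    {c : Cond Γ₀ R} (h : ∀ r x y z, I r (e x) (e y) (e z) → J r (e x) (e y) (e z))
    (hc : c.Holds w I e) : c.Holds w J e := by
  cases c <;> first | exact h _ _ _ _ hc | exact hc

/-- A Horn clause. -/
structure Rule (Γ₀ R : Type) : Type where
  /-- the premises -/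
  body : List (Cond Γ₀ R)
  /-- the relation symbol of the conclusion -/
  rel : R
  /-- the first argument of the conclusion -/
  a : Fin 8
  /-- the second argument of the conclusion -/
  b : Fin 8
  /-- the third argument of the conclusion -/
  c : Fin 8

/-- An interpretation of the relation symbols satisfies the rules over a word. -/
def IsModel (rules : List (Rule Γ₀ R)) (w : List Γ₀) (I : R → ℕ → ℕ → ℕ → Prop) : Prop :=
  ∀ ρ ∈ rules, ∀ e : Fin 8 → ℕ, (∀ i, e i ≤ w.length) → (∀ c ∈ ρ.body, c.Holds w I e) →
    I ρ.rel (e ρ.a) (e ρ.b) (e ρ.c)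

/-- A fact follows from the rules. -/
def Derivable (rules : List (Rule Γ₀ R)) (w : List Γ₀) (r : R) (x y z : ℕ) : Prop :=
  ∀ I, IsModel rules w I → I r x y z

/-! ### Representation of finite relations in the memory -/

/-- The address of a triple. -/
def addr (n x y z : ℕ) : ℕ := (x * n + y) * n + z

theorem addr_lt {n x y z : ℕ} (hx : x < n) (hy : y < n) (hz : z < n) : addr n x y z < n ^ 3 := by
  have h1 : x * n + y + 1 ≤ n * n := by
    have := Nat.mul_le_mul_right n (Nat.succ_le_of_lt hx); rw [Nat.succ_mul] at this; omega
  have h2 := Nat.mul_le_mul_right n h1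
  rw [Nat.succ_mul] at h2
  have e : n ^ 3 = n * n * n := by ring
  rw [e, addr]; omega

/-- Addresses are three-digit numerals to the base n. -/
theorem addr_inj {n x y z x' y' z' : ℕ} (hy : y < n) (hz : z < n) (hy' : y' < n) (hz' : z' < n)
    (h : addr n x y z = addr n x' y' z') : x = x' ∧ y = y' ∧ z = z' := by
  have key : ∀ {a b a' b' : ℕ}, b < n → b' < n → a * n + b = a' * n + b' → a = a' ∧ b = b' := by
    intro a b a' b' hb hb' h
    have h1 := congrArg (· / n) h
    have h2 := congrArg (· % n) h
    have hn : 0 < n := by omega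
    simp only [Nat.mul_comm _ n, Nat.mul_add_div hn, Nat.div_eq_of_lt hb, Nat.div_eq_of_lt hb',
      Nat.mul_add_mod, Nat.mod_eq_of_lt hb, Nat.mod_eq_of_lt hb'] at h1 h2
    exact ⟨by simpa using h1, h2⟩
  obtain ⟨h1, h2⟩ := key hz hz' h
  obtain ⟨h3, h4⟩ := key hy hy' h1
  exact ⟨h3, h4, h2⟩

variable [DecidableEq R]

/-- The memory that stores a set of facts. -/
def memOf (n : ℕ) (T : Finset (R × ℕ)) : List (R → Bool) :=
  (List.range (n ^ 3)).map fun i r => decide ((r, i) ∈ T)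

theorem length_memOf (n : ℕ) (T : Finset (R × ℕ)) : (memOf n T).length = n ^ 3 := by simp [memOf]

theorem getElem_memOf {n i : ℕ} (T : Finset (R × ℕ)) (h : i < (memOf n T).length) :
    (memOf n T)[i] = fun r => decide ((r, i) ∈ T) := by simp [memOf]

theorem head_drop_memOf {n k : ℕ} (T : Finset (R × ℕ)) (hk : k < n ^ 3) :
    ((memOf n T).drop k).head? = some fun r => decide ((r, k) ∈ T) := by
  simp [memOf, hk]

theorem memOf_insert {n k : ℕ} (T : Finset (R × ℕ)) (r : R) (hk : k < n ^ 3) :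
    memOf n (insert (r, k) T) = (memOf n T).take k ++
      update (fun r => decide ((r, k) ∈ T)) r true :: (memOf n T).drop (k + 1) := by
  have h : memOf n (insert (r, k) T) =
      (memOf n T).set k (update (fun r => decide ((r, k) ∈ T)) r true) := by
    refine List.ext_getElem (by simp [length_memOf]) fun i hi hi' => ?_
    funext r'
    rw [List.getElem_set, getElem_memOf]
    by_cases hik : k = i
    · subst hik
      by_cases hr : r' = r <;> simp [hr]
    · have : i ≠ k := fun h => hik h.symm
      simp [hik, this, getElem_memOf]
  rw [h, List.set_eq_take_append_cons_drop, if_pos (by rwa [length_memOf])]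

/-- The interpretation that is stored in the memory. -/
def stored (n : ℕ) (T : Finset (R × ℕ)) (r : R) (x y z : ℕ) : Prop := (r, addr n x y z) ∈ T

/-- The states between the evaluations of conditions. -/
def base (n : ℕ) (w : List Γ₀) (T : Finset (R × ℕ)) (e : Ctr → ℕ) (f : ℕ) : St Γ₀ R :=
  { N := fun _ => n, inp := w, mem := memOf n T, ctr := e, flag := f }

/-- The counters are in range and the auxiliary counters used for seeking are at rest. -/
structure Env (n : ℕ) (e : Ctr → ℕ) : Prop where
  lt (c) : e c < n
  zero : e (.inr 0) = 0
  zero' : e (.inr 1) = 0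

/-! ### Programs for conditions -/

/-- Go to the memory cell of a triple. -/
def seek (a b c : Fin 8) : StackProg (Alph Γ₀ R) :=
  .seq (times (.inl a) (forCtr (.inr 1) (forCtr (.inr 0) stepMem)))
    (.seq (times (.inl b) (forCtr (.inr 0) stepMem)) (times (.inl c) stepMem))

/-- Time bound for `seek`. -/
def seekCost (n : ℕ) : ℕ :=
  (n * ((n * ((n * (3 + 6) + 2) + 6) + 2) + 8) + 2) +
    ((n * ((n * (3 + 6) + 2) + 8) + 2) + (n * (3 + 8) + 2))

-- The address is walked as x·n² + y·n + z single steps; the factors n are loops over the two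
-- auxiliary counters that `Env` keeps at zero.
omit [DecidableEq R] in
theorem imp_seek {s : St Γ₀ R} {n : ℕ} (hN : ∀ c, s.N c = n) (hs : Env n s.ctr) (h0 : s.tmp = 0)
    (a b c : Fin 8) :
    Imp (seek a b c) s (s.advMem (addr n (s.ctr (.inl a)) (s.ctr (.inl b)) (s.ctr (.inl c))))
      (seekCost n) := by
  have hf := isAct_advMem (Γ₀ := Γ₀) (R := R)
  have h1 : Acts St.advMem n ∅ (stepMem (Γ₀ := Γ₀) (R := R)) 1 3 := fun s _ _ => imp_stepMem s
  have h2 := h1.forCtr hf (c := .inr 0) (by simp)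
  have h3 := h2.forCtr hf (c := .inr 1) (by simp)
  have e1 := h3.times hf (c := .inl a) (by simp) hN (by simp [hs.zero, hs.zero']) (hs.lt _).le h0
  have e2 := h2.times hf (c := .inl b) (s := St.advMem (s.ctr (.inl a) * (n * (n * 1))) s)
    (by simp) hN (by simp [hf.ctr, hs.zero]) (hs.lt _).le h0
  have e3 := h1.times hf (c := .inl c)
    (s := St.advMem (s.ctr (.inl b) * (n * 1)) (St.advMem (s.ctr (.inl a) * (n * (n * 1))) s))
    (by simp) hN (by simp) (hs.lt _).le h0
  have h := e1.seq (e2.seq e3)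
  have : addr n (s.ctr (.inl a)) (s.ctr (.inl b)) (s.ctr (.inl c)) =
      s.ctr (.inl a) * (n * (n * 1)) + (s.ctr (.inl b) * (n * 1) + s.ctr (.inl c) * 1) := by
    simp only [addr]; ring
  rw [this, hf.add, hf.add]
  exact h

/-- The program for a condition: it lowers the flag if the condition fails. -/
def test : Cond Γ₀ R → StackProg (Alph Γ₀ R)
  | .letter v p => .seq (times (.inl v) stepInp) <| .seq
      (.cases .inp fun
        | none => .pop .flag
        | some l => if p l then .skip else .pop .flag)
      rewindInp
  | .fact r a b c => .seq (seek a b c) <| .seq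
      (.cases .mem fun
        | none => .pop .flag
        | some m => if m r then .skip else .pop .flag)
      rewindMem
  | .succ v v' => .seq (times (.inl v') (.push .tmp' ())) <| .seq (times (.inl v) (.pop .tmp')) <|
      .seq
        (.cases .tmp' fun
          | none => .pop .flag
          | some _ => .seq (.pop .tmp') <|
            .cases .tmp' fun
              | none => .skip
              | some _ => .pop .flag)
        (.loop .tmp' (.pop .tmp'))
  | .zero v => .cases (.ctr (.inl v)) fun
      | none => .skip
      | some _ => .pop .flag

/-- Time bound for `test`. -/
def testCost (n : ℕ) : ℕ := seekCost n + (20 + 4 * n ^ 3) + (n * 40 + 40)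

omit [DecidableEq R] in
theorem imp_clearTmp' (s : St Γ₀ R) :
    Imp (.loop .tmp' (.pop .tmp')) s { s with tmp' := 0 } (s.tmp' * 2 + 1) := by
  obtain ⟨m, hm⟩ : ∃ m, s.tmp' = m := ⟨_, rfl⟩
  induction m generalizing s with
  | zero =>
    have : { s with tmp' := 0 } = s := by ext1 <;> simp [hm]
    rw [this, hm]
    exact Imp.loop_nil (by simp [St.store, hm])
  | succ m ih =>
    have h := ih { s with tmp' := s.tmp' - 1 } (by simp [hm])
    refine (Imp.loop_cons (by simp [St.store, hm]) (imp_popTmp' s) h).mono ?_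
    simp [hm]; omega

omit [DecidableEq R] in
theorem isAct_pushTmp' : IsAct (fun k (s : St Γ₀ R) => { s with tmp' := s.tmp' + k }) where
  zero _ := rfl
  add a b s := by simp [add_assoc]
  N _ _ := rfl
  tmp _ _ := rfl
  ctr _ _ := rfl
  set _ _ _ _ := rfl
  setTmp _ _ _ := rfl

omit [DecidableEq R] in
theorem isAct_popTmp' : IsAct (fun k (s : St Γ₀ R) => { s with tmp' := s.tmp' - k }) where
  zero _ := rfl
  add a b s := by simp [Nat.sub_sub]
  N _ _ := rfl
  tmp _ _ := rfl
  ctr _ _ := rfl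
  set _ _ _ _ := rfl
  setTmp _ _ _ := rfl

-- Each test moves along a tape or builds a difference, adjusts the flag, and restores everything
-- else, so that tests can be composed.
open Classical in
theorem imp_test {n : ℕ} {w : List Γ₀} {T : Finset (R × ℕ)} {e : Ctr → ℕ} (he : Env n e)
    (hn : n = w.length + 1) (f : ℕ) (c : Cond Γ₀ R) :
    Imp (test c) (base n w T e f)
      (base n w T e (if c.Holds w (stored n T) (fun v => e (.inl v)) then f else f - 1))
      (testCost n) := by
  have n3 : n ≤ n ^ 3 := Nat.le_self_pow (by norm_num) n
  cases c with
  | letter v p =>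
    have h1 : Acts St.advInp n ∅ (stepInp (Γ₀ := Γ₀) (R := R)) 1 3 := fun s _ _ => imp_stepInp s
    have h2 := h1.times isAct_advInp (c := .inl v) (s := base n w T e f) (by simp) (fun _ => rfl)
      (by simp) (he.lt _).le rfl
    set f' := if (Cond.letter v p : Cond Γ₀ R).Holds w (stored n T) (fun v => e (.inl v))
      then f else f - 1 with hf'
    have h3 : Imp (.cases .inp fun
        | none => .pop .flag
        | some l => if p l then .skip else .pop .flag)
        ((base n w T e f).advInp (e (.inl v) * 1)) ((base n w T e f').advInp (e (.inl v) * 1))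
        (1 + 1) := by
      refine Imp.cases (t := 1) ?_
      have : (((base n w T e f).advInp (e (.inl v) * 1)).store .inp).head? = w[e (.inl v)]? := by
        simp [St.store, base, St.advInp]
      rw [this]
      rcases hl : w[e (.inl v)]? with _ | l
      · have : f' = f - 1 := by simp [hf', Cond.Holds, hl]
        rw [this]
        exact imp_popFlag _
      · by_cases hp : p l = true
        · have : f' = f := by simp [hf', Cond.Holds, hl, hp]
          rw [this]
          simpa [hp] using Imp.skip _
        · have : f' = f - 1 := by simp [hf', Cond.Holds, hl, hp]
          rw [this]
          simp only [hp]
          exact imp_popFlag _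
    have h4 := imp_rewindInp ((base n w T e f').advInp (e (.inl v) * 1))
    have e4 : ({ (base n w T e f').advInp (e (.inl v) * 1) with
        inp := ((base n w T e f').advInp (e (.inl v) * 1)).inpA.reverse ++
          ((base n w T e f').advInp (e (.inl v) * 1)).inp, inpA := [] } : St Γ₀ R) =
        base n w T e f' := by
      ext1 <;> simp [base, St.advInp]
    rw [e4] at h4
    refine (h2.seq (h3.seq h4)).mono ?_
    have : ((base n w T e f').advInp (e (.inl v) * 1)).inpA.length ≤ n := by
      simp [base, St.advInp]; omega
    simp only [testCost]; omega
  | fact r a b c =>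
    set k := addr n (e (.inl a)) (e (.inl b)) (e (.inl c)) with hk
    have hk3 : k < n ^ 3 := addr_lt (he.lt _) (he.lt _) (he.lt _)
    have h2 := imp_seek (s := base n w T e f) (fun _ => rfl) he rfl a b c
    set f' := if (Cond.fact r a b c : Cond Γ₀ R).Holds w (stored n T) (fun v => e (.inl v))
      then f else f - 1 with hf'
    have h3 : Imp (.cases .mem fun
        | none => .pop .flag
        | some m => if m r then .skip else .pop .flag)
        ((base n w T e f).advMem k) ((base n w T e f').advMem k) (1 + 1) := by
      refine Imp.cases (t := 1) ?_
      have : (((base n w T e f).advMem k).store .mem).head? = some fun r => decide ((r, k) ∈ T) :=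
        head_drop_memOf T hk3
      rw [this]
      by_cases hp : (r, k) ∈ T
      · have : f' = f := if_pos hp
        rw [this]
        simpa [hp] using Imp.skip _
      · have : f' = f - 1 := if_neg hp
        rw [this]
        simp only [hp]
        exact imp_popFlag _
    have h4 := imp_rewindMem ((base n w T e f').advMem k)
    have e4 : ({ (base n w T e f').advMem k with
        mem := ((base n w T e f').advMem k).memA.reverse ++ ((base n w T e f').advMem k).mem,
        memA := [] } : St Γ₀ R) = base n w T e f' := by
      ext1 <;> simp [base, St.advMem]
    rw [e4] at h4
    refine (h2.seq (h3.seq h4)).mono ?_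
    have : ((base n w T e f').advMem k).memA.length ≤ n ^ 3 := by
      simp [base, St.advMem, length_memOf]
    simp only [testCost]; omega
  | succ v v' =>
    have hv := he.lt (.inl v)
    have hv' := he.lt (.inl v')
    have h1 : Acts (fun k (s : St Γ₀ R) => { s with tmp' := s.tmp' + k }) n ∅ (.push .tmp' ()) 1 1 :=
      fun s _ _ => imp_pushTmp' s
    have h2 := h1.times isAct_pushTmp' (c := .inl v') (s := base n w T e f) (by simp) (fun _ => rfl)
      (by simp) (he.lt _).le rfl
    have h3 : Acts (fun k (s : St Γ₀ R) => { s with tmp' := s.tmp' - k }) n ∅ (.pop .tmp') 1 1 :=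
      fun s _ _ => imp_popTmp' s
    have h4 := h3.times isAct_popTmp' (c := .inl v)
      (s := { base n w T e f with tmp' := 0 + e (.inl v') * 1 }) (by simp) (fun _ => rfl)
      (by simp) (he.lt _).le rfl
    set f' := if (Cond.succ v v' : Cond Γ₀ R).Holds w (stored n T) (fun v => e (.inl v))
      then f else f - 1 with hf'
    have h5 : Imp (.cases .tmp' fun
          | none => .pop .flag
          | some _ => .seq (.pop .tmp') <|
            .cases .tmp' fun
              | none => .skip
              | some _ => .pop .flag)
        { base n w T e f with tmp' := 0 + e (.inl v') * 1 - e (.inl v) * 1 }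
        { base n w T e f' with tmp' := 0 + e (.inl v') * 1 - e (.inl v) * 1 - 1 }
        (1 + 3) := by
      refine Imp.cases (t := 3) ?_
      -- `tmp'` holds the truncated difference of the two values. It is 1 exactly for successors; 0
      -- and values above 1 both lower the flag.
      rcases hm : 0 + e (.inl v') * 1 - e (.inl v) * 1 with _ | m
      · have : f' = f - 1 := if_neg (by simp only [Cond.Holds]; omega)
        rw [this]
        exact (imp_popFlag _).mono (by norm_num)
      · refine Imp.seq (t := 1) (t' := 1 + 1) (imp_popTmp' _) (Imp.cases ?_)
        rcases m with _ | m
        · have : f' = f := if_pos (by simp only [Cond.Holds]; omega)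
          rw [this]
          exact Imp.skip _
        · have : f' = f - 1 := if_neg (by simp only [Cond.Holds]; omega)
          rw [this]
          exact imp_popFlag _
    have h6 := imp_clearTmp'
      { base n w T e f' with tmp' := 0 + e (.inl v') * 1 - e (.inl v) * 1 - 1 }
    refine (h2.seq (h4.seq (h5.seq h6))).mono ?_
    simp only [testCost]; omega
  | zero v =>
    refine (Imp.cases (t := 1) ?_).mono (by simp only [testCost]; omega)
    by_cases h0 : e (.inl v) = 0
    · simpa [St.store, base, Cond.Holds, h0] using Imp.skip _
    · have : (List.replicate (e (.inl v)) ()).head? = some () := by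
        rw [List.head?_replicate, if_neg h0]
      simpa [St.store, base, Cond.Holds, h0, this] using imp_popFlag (base n w T e f)

end Datalog

/-! ### Applying the rules and reaching the fixed point. -/

namespace Datalog
open Function StackProg

variable {Γ₀ R : Type} [DecidableEq R]

/-! ### Programs for rules -/

/-- Test a list of conditions. -/
def tests (l : List (Cond Γ₀ R)) : StackProg (Alph Γ₀ R) :=
  l.foldr (fun c P => .seq (test c) P) .skip

-- The flag is at most 1, so the first failing condition brings it to 0, where it stays, as popping
-- an empty stack changes nothing.
open Classical in
theorem imp_tests {n : ℕ} {w : List Γ₀} {T : Finset (R × ℕ)} {e : Ctr → ℕ} (he : Env n e)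
    (hn : n = w.length + 1) {f : ℕ} (hf : f ≤ 1) (l : List (Cond Γ₀ R)) :
    Imp (tests l) (base n w T e f)
      (base n w T e
        (if ∀ c ∈ l, c.Holds w (stored n T) (fun v => e (.inl v)) then f else 0))
      (l.length * testCost n + 1) := by
  induction l generalizing f with
  | nil => simpa [tests] using Imp.skip _
  | cons c l ih =>
    by_cases hc : c.Holds w (stored n T) (fun v => e (.inl v))
    · have h := imp_test he hn f c (T := T)
      rw [if_pos hc] at h
      have h' := h.seq (ih hf)
      simp only [List.forall_mem_cons, hc, true_and]
      exact h'.mono (by rw [List.length_cons, Nat.succ_mul]; omega)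
    · have h := imp_test he hn f c (T := T)
      rw [if_neg hc, Nat.sub_eq_zero_of_le hf] at h
      have h' := h.seq (ih zero_le_one)
      simp only [List.forall_mem_cons, hc, false_and, if_false]
      simp only [ite_self] at h'
      exact h'.mono (by rw [List.length_cons, Nat.succ_mul]; omega)

/-- If the flag is set, add a relation symbol to the current memory cell. -/
def mark (r : R) : StackProg (Alph Γ₀ R) :=
  .cases .flag fun
    | none => .skip
    | some _ => .cases .mem fun
      | none => .skip
      | some m => .seq (.pop .mem) (.push .mem (update m r true))

/-- Apply a rule, for the current values of the variables. -/
def runRule (ρ : Rule Γ₀ R) : StackProg (Alph Γ₀ R) :=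
  .seq (.push .flag ()) <| .seq (tests ρ.body) <| .seq (seek ρ.a ρ.b ρ.c) <| .seq (mark ρ.rel) <|
    .seq rewindMem (.pop .flag)

open Classical in
/-- The effect of a rule on a set of facts. -/
noncomputable def applyRule (w : List Γ₀) (n : ℕ) (e : Fin 8 → ℕ) (T : Finset (R × ℕ))
    (ρ : Rule Γ₀ R) : Finset (R × ℕ) :=
  if ∀ c ∈ ρ.body, c.Holds w (stored n T) e then
    insert (ρ.rel, addr n (e ρ.a) (e ρ.b) (e ρ.c)) T else T

/-- Time bound for `runRule`. -/
def ruleCost (l n : ℕ) : ℕ := l * testCost n + seekCost n + 4 * n ^ 3 + 20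

theorem imp_runRule {n : ℕ} {w : List Γ₀} {T : Finset (R × ℕ)} {e : Ctr → ℕ} (he : Env n e)
    (hn : n = w.length + 1) (ρ : Rule Γ₀ R) :
    Imp (runRule ρ) (base n w T e 0) (base n w (applyRule w n (fun v => e (.inl v)) T ρ) e 0)
      (ruleCost ρ.body.length n) := by
  classical
  set k := addr n (e (.inl ρ.a)) (e (.inl ρ.b)) (e (.inl ρ.c)) with hk
  have hk3 : k < n ^ 3 := addr_lt (he.lt _) (he.lt _) (he.lt _)
  have h1 : Imp (.push .flag ()) (base n w T e 0) (base n w T e 1) 1 := imp_pushFlag _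
  have h2 := imp_tests he hn le_rfl ρ.body (T := T)
  set T' := applyRule w n (fun v => e (.inl v)) T ρ with hT'
  set f := if ∀ c ∈ ρ.body, c.Holds w (stored n T) (fun v => e (.inl v)) then 1 else 0 with hf
  have h3 := imp_seek (s := base n w T e f) (fun _ => rfl) he rfl ρ.a ρ.b ρ.c
  have hl : ((memOf n T).take k).length = k := by simp [length_memOf, hk3.le]
  -- The same final flag must serve for the remaining moves; whether it is 0 or 1, one pop clears
  -- it.
  have key : ∃ f' ≤ 1, Imp (mark ρ.rel) ((base n w T e f).advMem k)
      ((base n w T' e f').advMem k) 4 := by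
    by_cases hb : ∀ c ∈ ρ.body, c.Holds w (stored n T) (fun v => e (.inl v))
    · have e1 : f = 1 := if_pos hb
      have e2 : T' = insert (ρ.rel, k) T := if_pos hb
      refine ⟨1, le_rfl, ?_⟩
      rw [e1, e2]
      refine Imp.cases (t := 3) (Imp.cases (t := 2) ?_)
      have : (((base n w T e 1).advMem k).store .mem).head? = some fun r => decide ((r, k) ∈ T) :=
        head_drop_memOf T hk3
      rw [this]
      have hd : (memOf n T).drop k = (fun r => decide ((r, k) ∈ T)) :: (memOf n T).drop (k + 1) := by
        rw [List.drop_eq_getElem_cons (by rwa [length_memOf]), getElem_memOf]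
      have e3 : (base n w (insert (ρ.rel, k) T) e 1).advMem k =
          { (base n w T e 1).advMem k with
            mem := update (fun r => decide ((r, k) ∈ T)) ρ.rel true ::
              ((base n w T e 1).advMem k).mem.tail } := by
        ext1 <;> simp only [base, St.advMem, memOf_insert T ρ.rel hk3]
        · rw [List.drop_left' hl, hd, List.tail_cons]
        · rw [List.take_left' hl]
      rw [e3]
      exact (imp_popMem _).seq (imp_pushMem _ _)
    · have e1 : f = 0 := if_neg hb
      have e2 : T' = T := if_neg hb
      refine ⟨0, zero_le_one, ?_⟩
      rw [e1, e2]
      exact (Imp.cases (Imp.skip _)).mono (by norm_num)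
  obtain ⟨f', hf', h4⟩ := key
  have h5 := imp_rewindMem ((base n w T' e f').advMem k)
  have e5 : ({ (base n w T' e f').advMem k with
      mem := ((base n w T' e f').advMem k).memA.reverse ++ ((base n w T' e f').advMem k).mem,
      memA := [] } : St Γ₀ R) = base n w T' e f' := by
    ext1 <;> simp [base, St.advMem]
  rw [e5] at h5
  have h6 := imp_popFlag (base n w T' e f')
  have e6 : ({ base n w T' e f' with flag := (base n w T' e f').flag - 1 } : St Γ₀ R) =
      base n w T' e 0 := by
    ext1 <;> simp [base]; omega
  rw [e6] at h6
  refine (h1.seq (h2.seq (h3.seq (h4.seq (h5.seq h6))))).mono ?_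
  have : ((base n w T' e f').advMem k).memA.length ≤ n ^ 3 := by
    simp [base, St.advMem, length_memOf]
  simp only [ruleCost]; omega

/-- Apply a list of rules, for the current values of the variables. -/
def runRules (rules : List (Rule Γ₀ R)) : StackProg (Alph Γ₀ R) :=
  rules.foldr (fun ρ P => .seq (runRule ρ) P) .skip

/-- Time bound for `runRules`. -/
def rulesCost : List (Rule Γ₀ R) → ℕ → ℕ
  | [], _ => 1
  | ρ :: l, n => ruleCost ρ.body.length n + rulesCost l n

theorem imp_runRules {n : ℕ} {w : List Γ₀} {T : Finset (R × ℕ)} {e : Ctr → ℕ} (he : Env n e)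
    (hn : n = w.length + 1) (rules : List (Rule Γ₀ R)) :
    Imp (runRules rules) (base n w T e 0)
      (base n w (rules.foldl (applyRule w n fun v => e (.inl v)) T) e 0) (rulesCost rules n) := by
  induction rules generalizing T with
  | nil => exact Imp.skip _
  | cons ρ l ih => exact (imp_runRule he hn ρ).seq ih

/-! ### Nested loops -/

/-- Nested loops over counters. -/
def forCtrs (cs : List Ctr) (P : StackProg (Alph Γ₀ R)) : StackProg (Alph Γ₀ R) :=
  cs.foldr forCtr P

/-- The effect of nested loops on a set of facts. -/
def nest {α : Type} (n : ℕ) : List Ctr → ((Ctr → ℕ) → α → α) → (Ctr → ℕ) → α → α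
  | [], G, e, T => G e T
  | c :: cs, G, e, T => (List.range n).foldl (fun T i => nest n cs G (update e c i) T) T

/-- Time bound for nested loops. -/
def nestCost (n t : ℕ) : ℕ → ℕ
  | 0 => t
  | k + 1 => n * (nestCost n t k + 6) + 2

theorem imp_forCtrs {n : ℕ} {w : List Γ₀} {P : StackProg (Alph Γ₀ R)}
    {G : (Ctr → ℕ) → Finset (R × ℕ) → Finset (R × ℕ)} {t : ℕ}
    (h : ∀ e T, Env n e → Imp P (base n w T e 0) (base n w (G e T) e 0) t) :
    ∀ (cs : List Ctr) (_ : cs.Nodup) (_ : .inr 0 ∉ cs) (_ : .inr 1 ∉ cs) (e : Ctr → ℕ)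
      (_ : Env n e) (_ : ∀ c ∈ cs, e c = 0) (T : Finset (R × ℕ)),
      Imp (forCtrs cs P) (base n w T e 0) (base n w (nest n cs G e T) e 0) (nestCost n t cs.length)
  | [], _, _, _, e, he, _, T => h e T he
  | c :: cs, hcs, h0, h1, e, he, hz, T => by
    have hs : ∀ T, (base n w T e 0 : St Γ₀ R).set c 0 = base n w T e 0 := fun T =>
      St.set_self (hz c (by simp))
    have := imp_forCtr (c := c) (P := forCtrs cs P) (t := nestCost n t cs.length) (n := n)
      (fun i => base n w ((List.range i).foldl (fun T i => nest n cs G (update e c i) T) T) e 0)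
      (fun _ => rfl) fun i hi => by
        rw [List.range_succ, List.foldl_append]
        refine imp_forCtrs h cs (List.nodup_cons.1 hcs).2 (fun h => h0 (by simp [h]))
          (fun h => h1 (by simp [h])) _ ⟨fun d => ?_, ?_, ?_⟩ (fun d hd => ?_) _
        · by_cases hd : d = c
          · subst hd; simpa [base] using hi
          · simpa [base, hd] using he.lt d
        · have : .inr 0 ≠ c := fun h => h0 (by simp [h])
          simpa [base, this] using he.zero
        · have : .inr 1 ≠ c := fun h => h1 (by simp [h])
          simpa [base, this] using he.zero'
        · have : d ≠ c := fun h => (List.nodup_cons.1 hcs).1 (h ▸ hd)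
          simpa [base, this] using hz d (by simp [hd])
    simp only [hs] at this
    exact this

section nest
variable {α : Type} {n : ℕ} {G : (Ctr → ℕ) → α → α}

theorem nest_append (cs cs' : List Ctr) (G : (Ctr → ℕ) → α → α) (e : Ctr → ℕ) (T : α) :
    nest n (cs ++ cs') G e T = nest n cs (nest n cs' G) e T := by
  induction cs generalizing e T with
  | nil => rfl
  | cons c cs ih => simp only [List.cons_append, nest, ih]

/-- Loops whose counters the body ignores are plain repetition; this turns the round counters into a
number of passes. -/
theorem nest_const (F : α → α) (cs : List Ctr) (e : Ctr → ℕ) :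
    nest n cs (fun _ => F) e = F^[n ^ cs.length] := by
  induction cs generalizing e with
  | nil => rfl
  | cons c cs ih =>
    funext T
    simp only [nest, ih]
    rw [List.foldl_const, List.length_range, ← iterate_mul, List.length_cons, pow_succ]

theorem nest_congr (hG : ∀ e e' : Ctr → ℕ, (∀ v, e (.inl v) = e' (.inl v)) → G e = G e')
    (cs : List Ctr) {e e' : Ctr → ℕ} (h : ∀ v, .inl v ∉ cs → e (.inl v) = e' (.inl v)) :
    nest n cs G e = nest n cs G e' := by
  induction cs generalizing e e' with
  | nil => exact hG e e' fun v => h v (by simp)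
  | cons c cs ih =>
    funext T
    simp only [nest]
    congr 1
    funext T i
    rw [ih (e := update e c i) (e' := update e' c i)]
    intro v hv
    by_cases hc : .inl v = c
    · simp [hc]
    · simpa [hc] using h v (by simp [hc, hv])

theorem nest_induction {p : α → Prop} (h : ∀ e T, (∀ c, e c < n) → p T → p (G e T))
    (cs : List Ctr) {e : Ctr → ℕ} (he : ∀ c, e c < n) {T : α} (hT : p T) : p (nest n cs G e T) := by
  induction cs generalizing e T with
  | nil => exact h e T he hT
  | cons c cs ih =>
    refine List.foldlRecOn _ _ hT fun T hT i hi => ih (fun d => ?_) hT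
    by_cases hd : d = c
    · subst hd; simpa using hi
    · simpa [hd] using he d

theorem le_foldl [PartialOrder α] {ι : Type} {F : α → ι → α} (h : ∀ T i, T ≤ F T i) (l : List ι)
    (T : α) : T ≤ l.foldl F T := by
  induction l generalizing T with
  | nil => exact le_rfl
  | cons i l ih => exact (h T i).trans (ih _)

/-- Each step can only enlarge the value, so if the total effect is trivial then every single step
is. -/
theorem eq_of_foldl_eq [PartialOrder α] {ι : Type} {F : α → ι → α} (h : ∀ T i, T ≤ F T i)
    {l : List ι} {T : α} (hl : l.foldl F T = T) {i : ι} (hi : i ∈ l) : F T i = T := by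
  induction l with
  | nil => cases hi
  | cons j l ih =>
    have hj : F T j = T := le_antisymm ((le_foldl h l _).trans hl.le) (h T j)
    rw [List.foldl_cons, hj] at hl
    rcases List.mem_cons.1 hi with rfl | hi
    · exact hj
    · exact ih hl hi

theorem le_nest [PartialOrder α] (h : ∀ e T, T ≤ G e T) (cs : List Ctr) (e : Ctr → ℕ) (T : α) :
    T ≤ nest n cs G e T := by
  induction cs generalizing e T with
  | nil => exact h e T
  | cons c cs ih => exact le_foldl (fun T i => ih _ T) _ T

/-- A pass without effect is one in which the body had no effect for any valuation in range. -/
theorem eq_of_nest_eq [PartialOrder α] (h : ∀ e T, T ≤ G e T) {cs : List Ctr} {e e' : Ctr → ℕ} {T : α}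
    (hT : nest n cs G e T = T) (hc : ∀ c ∈ cs, e' c < n) (hc' : ∀ c ∉ cs, e' c = e c) :
    G e' T = T := by
  induction cs generalizing e with
  | nil =>
    have : e' = e := funext fun c => hc' c (by simp)
    rw [this]; exact hT
  | cons c cs ih =>
    have h1 := eq_of_foldl_eq (fun T i => le_nest h cs (update e c i) T) hT
      (List.mem_range.2 (hc c (by simp)))
    refine ih h1 (fun d hd => hc d (by simp [hd])) fun d hd => ?_
    by_cases hd' : d = c
    · subst hd'; simp
    · simpa [hd'] using hc' d (by simp [hd, hd'])

end nest

/-- An inflationary map on the subsets of a finite set reaches a fixed point. -/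
theorem iterate_fixed {α : Type} {F : Finset α → Finset α} (h : ∀ T, T ⊆ F T) {U : Finset α}
    (hU : ∀ T ⊆ U, F T ⊆ U) {m : ℕ} (hm : U.card < m) : F (F^[m] ∅) = F^[m] ∅ := by
  have hsub : ∀ k, F^[k] ∅ ⊆ U := fun k => by
    induction k with
    | zero => simp
    | succ k ih => rw [iterate_succ_apply']; exact hU _ ih
  -- Until the chain is stationary every iteration adds an element.
  have key : ∀ k, F (F^[k] ∅) = F^[k] ∅ ∨ k ≤ (F^[k] ∅).card := fun k => by
    induction k with
    | zero => simp
    | succ k ih =>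
      rw [iterate_succ_apply']
      rcases ih with ih | ih
      · left; rw [ih, ih]
      · by_cases hk : F (F^[k] ∅) = F^[k] ∅
        · left; rw [hk, hk]
        · right
          have := Finset.card_lt_card ((h (F^[k] ∅)).ssubset_of_ne (Ne.symm hk))
          omega
  rcases key m with hm' | hm'
  · exact hm'
  · have := Finset.card_le_card (hsub m)
    omega

/-! ### The fixed point -/

/-- The counters for the variables. -/
def varCtrs : List Ctr := (List.finRange 8).map .inl

/-- The counters for the number of rounds. -/
def roundCtrs : List Ctr := [.inr 2, .inr 3, .inr 4, .inr 5, .inr 6, .inr 7, .inr 8, .inr 9]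

/-- The effect of all rules for given values of the variables. -/
noncomputable def applyRules (rules : List (Rule Γ₀ R)) (w : List Γ₀) (e : Ctr → ℕ)
    (T : Finset (R × ℕ)) : Finset (R × ℕ) :=
  rules.foldl (applyRule w (w.length + 1) fun v => e (.inl v)) T

/-- The facts that are in the memory in the end. -/
noncomputable def facts (rules : List (Rule Γ₀ R)) (w : List Γ₀) : Finset (R × ℕ) :=
  nest (w.length + 1) (roundCtrs ++ varCtrs) (applyRules rules w) 0 ∅

theorem subset_applyRule (w : List Γ₀) (n : ℕ) (e : Fin 8 → ℕ) (T : Finset (R × ℕ))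
    (ρ : Rule Γ₀ R) : T ⊆ applyRule w n e T ρ := by
  unfold applyRule
  split_ifs
  · exact Finset.subset_insert _ _
  · exact subset_rfl

theorem subset_applyRules (rules : List (Rule Γ₀ R)) (w : List Γ₀) (e : Ctr → ℕ)
    (T : Finset (R × ℕ)) : T ⊆ applyRules rules w e T :=
  le_foldl (fun T ρ => subset_applyRule w _ _ T ρ) _ _

/-- With n = |w| + 1 ≥ 2 there are fewer than 32·n³ ≤ n⁵·n³ = n⁸ possible facts, and eight round
counters give n⁸ passes. This is the origin of the bound 32 and of the nonempty word. -/
theorem facts_fixed [Fintype R] (rules : List (Rule Γ₀ R)) {w : List Γ₀} (hw : w ≠ [])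
    (hR : Fintype.card R < 32) :
    nest (w.length + 1) varCtrs (applyRules rules w) 0 (facts rules w) = facts rules w := by
  have hG : ∀ e e' : Ctr → ℕ, (∀ v, e (.inl v) = e' (.inl v)) →
      applyRules rules w e = applyRules rules w e' := fun e e' h => by
    funext T; simp only [applyRules, h]
  have h1 : nest (w.length + 1) varCtrs (applyRules rules w) =
      fun _ => nest (w.length + 1) varCtrs (applyRules rules w) 0 := by
    funext e
    exact nest_congr hG _ fun v hv => absurd (by simp [varCtrs]) hv
  have h2 : facts rules w =
      (nest (w.length + 1) varCtrs (applyRules rules w) 0)^[(w.length + 1) ^ 8] ∅ := by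
    rw [facts, nest_append, h1, nest_const]; rfl
  rw [h2]
  refine iterate_fixed (U := Finset.univ ×ˢ Finset.range ((w.length + 1) ^ 3))
    (le_nest (subset_applyRules rules w) _ _) (fun T hT => ?_) ?_
  · refine nest_induction (p := fun T => T ⊆ Finset.univ ×ˢ Finset.range ((w.length + 1) ^ 3))
      (fun e T he hT => ?_) _ (by simp) hT
    refine List.foldlRecOn (motive := fun T => T ⊆ Finset.univ ×ˢ Finset.range ((w.length + 1) ^ 3))
      _ _ hT fun T hT ρ _ => ?_
    unfold applyRule
    split_ifs
    · refine Finset.insert_subset ?_ hT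
      simpa using addr_lt (he _) (he _) (he _)
    · exact hT
  · rw [Finset.card_product, Finset.card_univ, Finset.card_range]
    have h2 : 2 ≤ w.length + 1 := by have := List.length_pos_iff.2 hw; omega
    calc Fintype.card R * (w.length + 1) ^ 3 < 2 ^ 5 * (w.length + 1) ^ 3 :=
          Nat.mul_lt_mul_of_pos_right hR (by positivity)
      _ ≤ (w.length + 1) ^ 5 * (w.length + 1) ^ 3 :=
          Nat.mul_le_mul_right _ (Nat.pow_le_pow_left h2 5)
      _ = (w.length + 1) ^ 8 := by ring

/-- That all stored facts hold in a given model is an invariant of the loops; conversely the fixed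
point is itself a model. The rules update the memory in place, and only the growth of the memory is
used, so their order is immaterial. The goal fact has address 0. -/
theorem mem_facts [Fintype R] (rules : List (Rule Γ₀ R)) {w : List Γ₀} (hw : w ≠ [])
    (hR : Fintype.card R < 32) (r : R) :
    (r, 0) ∈ facts rules w ↔ Derivable rules w r 0 0 0 := by
  constructor
  · intro h I hI
    let p : Finset (R × ℕ) → Prop := fun T => ∀ r x y z, x < w.length + 1 → y < w.length + 1 →
      z < w.length + 1 → stored (w.length + 1) T r x y z → I r x y z
    have := nest_induction (n := w.length + 1) (G := applyRules rules w) (p := p)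
      (fun e T he hT => List.foldlRecOn (motive := p) _ _ hT fun T hT ρ hρ => by
        unfold applyRule
        split_ifs with hb
        · intro r x y z hx hy hz hr
          rcases Finset.mem_insert.1 hr with hr | hr
          · obtain ⟨rfl, hr⟩ := Prod.mk.inj hr
            have hr := (Prod.mk.inj hr).2
            obtain ⟨rfl, rfl, rfl⟩ := addr_inj hy hz (he _) (he _) hr
            exact hI ρ hρ _ (fun i => Nat.lt_succ_iff.1 (he _)) fun c hc =>
              (hb c hc).mono fun r a b c h => hT r _ _ _ (he _) (he _) (he _) h
          · exact hT r x y z hx hy hz hr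
        · exact hT)
      (roundCtrs ++ varCtrs) (e := 0) (by simp) (T := ∅) (by simp [p, stored])
    exact this r 0 0 0 (by simp) (by simp) (by simp) (by simpa [stored, addr, facts] using h)
  · intro h
    have := h (stored (w.length + 1) (facts rules w)) fun ρ hρ e he hb => by
      have h1 := eq_of_nest_eq (subset_applyRules rules w) (facts_fixed rules hw hR)
        (e' := Sum.elim e 0)
        (fun c _ => by
          cases c with
          | inl v => exact Nat.lt_succ_of_le (he v)
          | inr v => simp)
        (fun c hc => by
          cases c with
          | inl v => exact absurd (by simp [varCtrs]) hc
          | inr v => rfl)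
      have h2 : applyRule w (w.length + 1) e (facts rules w) ρ = facts rules w :=
        eq_of_foldl_eq (fun T ρ => subset_applyRule w _ e T ρ) h1 hρ
      rw [applyRule, if_pos hb] at h2
      exact Finset.insert_eq_self.1 h2
    simpa [stored, addr] using this

end Datalog

/-! ### Initialization, output, and a polynomial bound for the whole machine. -/

namespace Datalog
open Function StackProg

variable {Γ₀ R : Type}

/-! ### Setup and output -/

/-- Raise the bounds of some counters. -/
def bump (l : List Ctr) : StackProg (Alph Γ₀ R) := l.foldr (fun c P => .seq (.push (.co c) ()) P) .skip

theorem imp_bumps (l : List Ctr) {s : St Γ₀ R} (hs : s.ctr = 0) :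
    Imp (bump l) s { s with N := fun c => s.N c + l.countP (· = c) } (l.length + 1) := by
  induction l generalizing s with
  | nil => exact (Imp.skip s).mono (by simp)
  | cons c l ih =>
    have h := (imp_bump s (c := c) (by simp [hs])).seq
      (ih (s := { s with N := update s.N c (s.N c + 1) }) hs)
    have e : (fun d => update s.N c (s.N c + 1) d + l.countP (· = d)) =
        fun d => s.N d + (c :: l).countP (· = d) := by
      funext d
      by_cases hd : d = c
      · subst hd; simp; omega
      · have : c ≠ d := fun h => hd h.symm
        simp [hd, this]
    rw [e] at h
    exact h.mono (by simp; omega)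

/-- All counters. -/
def allCtrs : List Ctr := (List.finRange 8).map .inl ++ (List.finRange 10).map .inr

theorem count_allCtrs : ∀ c : Ctr, allCtrs.countP (· = c) = 1 := by decide

theorem imp_bump_all {s : St Γ₀ R} (hs : s.ctr = 0) :
    Imp (bump allCtrs) s { s with N := fun c => s.N c + 1 } 19 := by
  have := imp_bumps allCtrs hs
  simp only [count_allCtrs] at this
  exact this

theorem isAct_pushMem : IsAct (fun k (s : St Γ₀ R) =>
    { s with mem := List.replicate k (fun _ => false) ++ s.mem }) where
  zero _ := by simp
  add a b s := by simp [Nat.add_comm a b, ← List.replicate_append_replicate]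
  N _ _ := rfl
  tmp _ _ := rfl
  ctr _ _ := rfl
  set _ _ _ _ := rfl
  setTmp _ _ _ := rfl

/-- Set the bounds of the counters and initialize the memory. -/
def setup : StackProg (Alph Γ₀ R) :=
  .seq (.loop .inp (.seq stepInp (bump allCtrs))) <| .seq (bump allCtrs) <| .seq rewindInp <|
    forCtr (.inr 2) (forCtr (.inr 1) (forCtr (.inr 0) (.push .mem fun _ => false)))

/-- Time bound for `setup`. -/
def setupCost (n : ℕ) : ℕ :=
  (n * (1 + (3 + 19)) + 1) + (19 + ((n * 4 + 1) +
    (n * ((n * ((n * (1 + 6) + 2) + 6) + 2) + 6) + 2)))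

theorem memOf_empty [DecidableEq R] (n : ℕ) :
    memOf n (∅ : Finset (R × ℕ)) = List.replicate (n ^ 3) fun _ => false := by
  simp [memOf, List.map_const']

/-- Every letter raises all bounds by one, and a further increment accounts for the end of the word,
which is also a value of the variables. Three nested loops then write n³ empty cells. -/
theorem imp_setup [DecidableEq R] (w : List Γ₀) :
    Imp setup { inp := w } (base (R := R) (w.length + 1) w ∅ 0 0) (setupCost (w.length + 1)) := by
  have h1 := Imp.loop (k := .inp) (P := .seq stepInp (bump allCtrs)) (t := 3 + 19) w.length
    (fun i => (St.advInp i { inp := w, N := fun _ => i } : St Γ₀ R)) (fun i hi => ⟨?_, ?_⟩) ?_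
  rotate_left
  · simpa [St.store, St.advInp] using hi
  · have := (imp_stepInp (St.advInp i { inp := w, N := fun _ => i } : St Γ₀ R)).seq
      (imp_bump_all rfl)
    rw [← isAct_advInp.add] at this
    exact this
  · simp [St.store, St.advInp]
  have h2 : Imp (bump allCtrs) (St.advInp w.length { inp := w, N := fun _ => w.length } : St Γ₀ R)
      (St.advInp w.length { inp := w, N := fun _ => w.length + 1 }) 19 := imp_bump_all rfl
  have h3 := imp_rewindInp (St.advInp w.length { inp := w, N := fun _ => w.length + 1 } : St Γ₀ R)
  have e3 : ({ (St.advInp w.length { inp := w, N := fun _ => w.length + 1 } : St Γ₀ R) with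
      inp := (St.advInp w.length { inp := w, N := fun _ => w.length + 1 } : St Γ₀ R).inpA.reverse ++
        (St.advInp w.length { inp := w, N := fun _ => w.length + 1 } : St Γ₀ R).inp,
      inpA := [] } : St Γ₀ R) = { inp := w, N := fun _ => w.length + 1 } := by
    ext1 <;> simp [St.advInp]
  rw [e3] at h3
  have hf := isAct_pushMem (Γ₀ := Γ₀) (R := R)
  have h4 : Acts (fun k (s : St Γ₀ R) =>
      { s with mem := List.replicate k (fun _ => false) ++ s.mem }) (w.length + 1) ∅ (.push .mem fun _ => false) 1 1 :=
    fun (s : St Γ₀ R) _ _ => imp_pushMem s fun _ => false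
  have h5 := ((h4.forCtr hf (c := .inr 0) (by simp)).forCtr hf (c := .inr 1) (by simp)).forCtr hf
    (c := .inr 2) (by simp) { inp := w, N := fun _ => w.length + 1 } (fun _ => rfl) (fun _ _ => rfl)
  have e5 : ({ ({ inp := w, N := fun _ => w.length + 1 } : St Γ₀ R) with
      mem := List.replicate ((w.length + 1) * ((w.length + 1) * ((w.length + 1) * 1)))
        (fun _ => false) ++ [] } : St Γ₀ R) = base (w.length + 1) w ∅ 0 0 := by
    have : (w.length + 1) * ((w.length + 1) * ((w.length + 1) * 1)) = (w.length + 1) ^ 3 := by ring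
    rw [this, List.append_nil, ← memOf_empty]
    rfl
  have h5' : Imp (forCtr (.inr 2) (forCtr (.inr 1) (forCtr (.inr 0) (.push .mem fun _ => false))))
      { inp := w, N := fun _ => w.length + 1 } (base (R := R) (w.length + 1) w ∅ 0 0)
      ((w.length + 1) * (((w.length + 1) * (((w.length + 1) * (1 + 6) + 2) + 6) + 2) + 6) + 2) := by
    rw [← e5]; exact h5
  refine (h1.seq (h2.seq (h3.seq h5'))).mono ?_
  have : (St.advInp w.length { inp := w, N := fun _ => w.length + 1 } : St Γ₀ R).inpA.length =
    w.length := by simp [St.advInp]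
  rw [this]
  unfold setupCost
  generalize (w.length + 1) * (((w.length + 1) * (((w.length + 1) * (1 + 6) + 2) + 6) + 2) + 6) = x
  omega

/-- Empty some stacks. -/
def clear (l : List Stk) : StackProg (Alph Γ₀ R) := l.foldr (fun k P => .seq (.loop k (.pop k)) P) .skip

theorem run_clear_stack (k : Stk) (S : ∀ k, List (Alph Γ₀ R k)) :
    Run (.loop k (.pop k)) S (update S k []) ((S k).length * 2 + 1) := by
  obtain ⟨l, hl⟩ : ∃ l, S k = l := ⟨_, rfl⟩
  induction l generalizing S with
  | nil =>
    have : update S k [] = S := by rw [← hl, update_eq_self]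
    rw [this, hl]
    exact .loop_nil hl
  | cons a l ih =>
    have h := ih (update S k (S k).tail) (by simp [hl])
    rw [update_idem, update_self] at h
    have := Run.loop_cons (by simp [hl]) (.pop k S) h
    have e : (S k).length * 2 + 1 = 1 + 1 + ((S k).tail.length * 2 + 1) := by
      simp [hl]; omega
    rw [e]
    exact this

theorem run_clear {B : ℕ} (l : List Stk) {S : ∀ k, List (Alph Γ₀ R k)} (hB : ∀ k, (S k).length ≤ B) :
    ∃ t ≤ l.length * (B * 2 + 1) + 1, Run (clear l) S (fun k => if k ∈ l then [] else S k) t := by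
  induction l generalizing S with
  | nil => exact ⟨1, by simp, by simpa [clear] using Run.skip S⟩
  | cons k l ih =>
    obtain ⟨t, ht, h⟩ := ih (S := update S k []) fun k' => by
      by_cases hk : k' = k
      · subst hk; simp
      · simpa [hk] using hB k'
    refine ⟨_, ?_, .seq (run_clear_stack k S) ((?_ : (fun k' => if k' ∈ l then [] else
      update S k [] k') = _) ▸ h)⟩
    · have := hB k
      rw [List.length_cons, Nat.succ_mul]; omega
    · funext k'
      by_cases hk : k' = k
      · subst hk; simp
      · simp [hk]

/-- Read off the result. -/
noncomputable def finish (goal : R) : StackProg (Alph Γ₀ R) :=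
  .cases .mem fun o => .seq (clear Finset.univ.toList) (.push .out (o.elim false fun m => m goal))

/-- Time bound for `finish`. -/
noncomputable def finishCost (n : ℕ) : ℕ :=
  1 + ((Fintype.card Stk * ((n ^ 3 + n) * 2 + 1) + 1) + 1)

/-- The result is read from the first cell before the stacks are emptied; the branch taken remembers
it. -/
theorem run_finish [DecidableEq R] (goal : R) (w : List Γ₀) (T : Finset (R × ℕ)) :
    ∃ t ≤ finishCost (w.length + 1),
      Run (finish goal) (base (w.length + 1) w T 0 0).store
        (single .out [decide ((goal, 0) ∈ T)]) t := by
  have hB : ∀ k, ((base (w.length + 1) w T 0 0).store k).length ≤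
      (w.length + 1) ^ 3 + (w.length + 1) := by
    intro k
    (cases k <;> simp [base, St.store, length_memOf]); omega
  obtain ⟨t, ht, h⟩ := run_clear Finset.univ.toList hB
  have h0 : ((base (Γ₀ := Γ₀) (w.length + 1) w T 0 0).store .mem).head? =
      some fun r => decide ((r, 0) ∈ T) := by
    have := head_drop_memOf T (n := w.length + 1) (k := 0) (by positivity)
    simpa [base, St.store] using this
  simp only [Finset.mem_toList, Finset.mem_univ, if_true] at h
  rw [Finset.length_toList, Finset.card_univ] at ht
  refine ⟨1 + (t + 1), by unfold finishCost; omega, .cases ?_⟩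
  rw [h0]
  exact .seq h (.push _ _ _)

/-! ### The machine -/

/-- The program that decides derivability of the fact `goal 0 0 0`. -/
noncomputable def program [DecidableEq R] (rules : List (Rule Γ₀ R)) (goal : R) :
    StackProg (Alph Γ₀ R) :=
  .seq setup (.seq (forCtrs (roundCtrs ++ varCtrs) (runRules rules)) (finish goal))

/-- Time bound for `program`. -/
noncomputable def programCost (rules : List (Rule Γ₀ R)) (n : ℕ) : ℕ :=
  setupCost n + (nestCost n (rulesCost rules n) 16 + finishCost n) + 1

theorem run_program [DecidableEq R] (rules : List (Rule Γ₀ R)) (goal : R) {w : List Γ₀} (hw : w ≠ []) :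
    ∃ t, t + 1 ≤ programCost rules (w.length + 1) ∧
      Run (program rules goal) (single .inp w) (single .out [decide ((goal, 0) ∈ facts rules w)])
        t := by
  have hw' : 0 < w.length := List.length_pos_iff.2 hw
  have h0 : (single .inp w : ∀ k, List (Alph Γ₀ R k)) = St.store { inp := w } := by
    funext k
    cases k <;> simp [single, update, St.store]
  obtain ⟨t₁, ht₁, h1⟩ := imp_setup (R := R) w
  obtain ⟨t₂, ht₂, h2⟩ := imp_forCtrs (w := w) (fun e T he => imp_runRules he rfl rules)
    (roundCtrs ++ varCtrs) (by decide) (by simp [roundCtrs, varCtrs])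
    (by simp [roundCtrs, varCtrs]) 0 ⟨by simp, rfl, rfl⟩ (fun _ _ => rfl) ∅
  obtain ⟨t₃, ht₃, h3⟩ := run_finish goal w (facts rules w)
  refine ⟨t₁ + (t₂ + t₃), ?_, h0 ▸ .seq h1 (.seq h2 h3)⟩
  have : (roundCtrs ++ varCtrs).length = 16 := by decide
  rw [this] at ht₂
  unfold programCost
  omega

/-- The function is given by a polynomial. -/
def IsPoly (f : ℕ → ℕ) : Prop := ∃ p : Polynomial ℕ, ∀ n, p.eval n = f n

namespace IsPoly

theorem const (c : ℕ) : IsPoly fun _ => c := ⟨.C c, fun _ => by simp⟩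

theorem id : IsPoly fun n => n := ⟨.X, fun _ => by simp⟩

theorem add {f g : ℕ → ℕ} : IsPoly f → IsPoly g → IsPoly fun n => f n + g n :=
  fun ⟨p, hp⟩ ⟨q, hq⟩ => ⟨p + q, fun n => by simp [hp, hq]⟩

theorem mul {f g : ℕ → ℕ} : IsPoly f → IsPoly g → IsPoly fun n => f n * g n :=
  fun ⟨p, hp⟩ ⟨q, hq⟩ => ⟨p * q, fun n => by simp [hp, hq]⟩

theorem pow {f : ℕ → ℕ} (k : ℕ) : IsPoly f → IsPoly fun n => f n ^ k :=
  fun ⟨p, hp⟩ => ⟨p ^ k, fun n => by simp [hp]⟩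

end IsPoly

theorem isPoly_seekCost : IsPoly seekCost := by
  unfold seekCost
  repeat' first | exact .id | exact .const _ | apply IsPoly.add | apply IsPoly.mul

theorem isPoly_rulesCost (rules : List (Rule Γ₀ R)) : IsPoly (rulesCost rules) := by
  induction rules with
  | nil => exact .const 1
  | cons ρ l ih =>
    show IsPoly fun n => ruleCost ρ.body.length n + rulesCost l n
    unfold ruleCost
    repeat' first | exact isPoly_seekCost | exact ih | exact .id |
      exact .const _ | apply IsPoly.add | apply IsPoly.pow | apply IsPoly.mul

theorem isPoly_nestCost {t : ℕ → ℕ} (ht : IsPoly t) (k : ℕ) : IsPoly fun n => nestCost n (t n) k := by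
  induction k with
  | zero => exact ht
  | succ k ih => exact (IsPoly.id.mul (ih.add (.const 6))).add (.const 2)

theorem isPoly_setupCost : IsPoly setupCost := by
  unfold setupCost
  repeat' first | exact .id | exact .const _ | apply IsPoly.add | apply IsPoly.mul

theorem isPoly_finishCost : IsPoly finishCost := by
  unfold finishCost
  repeat' first | exact .id | exact .const _ | apply IsPoly.add | apply IsPoly.pow |
    apply IsPoly.mul

theorem isPoly_programCost (rules : List (Rule Γ₀ R)) : IsPoly (programCost rules) :=
  (isPoly_setupCost.add ((isPoly_nestCost (isPoly_rulesCost rules) 16).add isPoly_finishCost)).add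
    (.const 1)

/-- The machine that decides derivability. -/
noncomputable def machine [Finite Γ₀] [Finite R] [DecidableEq R] (rules : List (Rule Γ₀ R))
    (goal : R) : Turing.TM2ComputableAux Γ₀ Bool where
  tm := (program rules goal).machine .inp .out
  inputAlphabet := Equiv.refl Γ₀
  outputAlphabet := Equiv.refl Bool

theorem outputs_machine [Finite Γ₀] [Finite R] [DecidableEq R] (rules : List (Rule Γ₀ R)) (goal : R)
    {w : List Γ₀} (hw : w ≠ []) {n : ℕ} (hn : programCost rules (w.length + 1) ≤ n) :
    Nonempty (Turing.TM2OutputsInTime (machine rules goal).tm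
      (w.map (machine rules goal).inputAlphabet.symm)
      (some ([decide ((goal, 0) ∈ facts rules w)].map (machine rules goal).outputAlphabet.symm))
      n) := by
  obtain ⟨t, ht, h⟩ := run_program rules goal hw
  have e : w.map (machine rules goal).inputAlphabet.symm = w := List.map_id w
  rw [e]
  exact h.outputs (ht.trans hn)

/-- Derivability from finitely many rules is decidable in polynomial time. -/
theorem exists_machine [Finite Γ₀] [Fintype R] [DecidableEq R] (rules : List (Rule Γ₀ R)) (goal : R)
    (hR : Fintype.card R < 32) :
    ∃ (M : Turing.TM2ComputableAux Γ₀ Bool) (p : Polynomial ℕ), (∀ k, Finite (M.tm.Γ k)) ∧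
      ∀ w : List Γ₀, w ≠ [] → ∃ b : Bool, (b = true ↔ Derivable rules w goal 0 0 0) ∧
        Nonempty (Turing.TM2OutputsInTime M.tm (w.map M.inputAlphabet.symm)
          (some ([b].map M.outputAlphabet.symm)) (p.eval w.length)) := by
  obtain ⟨p, hp⟩ := isPoly_programCost rules
  -- The costs are expressed in n, the length plus one.
  refine ⟨machine rules goal, p.comp (.X + 1), finite_alph, fun w hw =>
    ⟨decide ((goal, 0) ∈ facts rules w), by simpa using mem_facts rules hw hR goal, ?_⟩⟩
  exact outputs_machine rules goal hw (by simp [hp])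

end Datalog

/-! ### Unique readability of prefix notation; positions of nodes and subterms. -/

namespace SumProd

/-! ### Prefix notation -/

/-- The number of subexpressions of an expression that starts with the letter. -/
def Letter.arity : Letter → ℕ
  | .zero | .one | .cotuple₀ | .tuple₀ => 0
  | .inj₀ | .inj₁ | .proj₀ | .proj₁ => 1
  | .add | .mul | .cotuple | .tuple => 2

/-- The word is an expression in prefix notation. -/
inductive IsExpr : List Letter → Prop
  | nullary {l : Letter} : l.arity = 0 → IsExpr [l]
  | unary {l : Letter} {L : List Letter} : l.arity = 1 → IsExpr L → IsExpr (l :: L)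
  | binary {l : Letter} {L L' : List Letter} : l.arity = 2 → IsExpr L → IsExpr L' →
      IsExpr (l :: (L ++ L'))

/-- Unique readability: the first letter fixes the number of subexpressions, so no expression is a
proper prefix of another. -/
theorem IsExpr.eq_of_append {L L' R R' : List Letter} (h : IsExpr L) (h' : IsExpr L')
    (e : L ++ R = L' ++ R') : L = L' := by
  induction h generalizing L' R R' with
  | nullary hl =>
    cases h' with
    | nullary => simp_all
    | unary hl' => simp_all
    | binary hl' => simp_all
  | unary hl _ ih =>
    cases h' with
    | nullary => simp_all
    | unary hl' h1 =>
      obtain ⟨rfl, e⟩ := List.cons.inj e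
      rw [ih h1 (by simpa using e)]
    | binary hl' => simp_all
  | binary hl _ _ ih1 ih2 =>
    cases h' with
    | nullary => simp_all
    | unary hl' => simp_all
    | binary hl' h1 h2 =>
      obtain ⟨rfl, e⟩ := List.cons.inj e
      simp only [List.cons_append, List.cons.injEq, true_and, List.append_assoc] at e
      obtain rfl := ih1 h1 e
      rw [ih2 h2 (List.append_cancel_left e)]

theorem Ty.isExpr_encode (X : Ty) : IsExpr X.encode := by
  induction X with
  | zero | one => exact .nullary rfl
  | add X Y ihX ihY | mul X Y ihX ihY => exact .binary rfl ihX ihY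

theorem Term.isExpr_encode {X A : Ty} (t : Term X A) : IsExpr t.encode := by
  induction t with
  | cotuple₀ | tuple₀ => exact .nullary rfl
  | inj₀ t ih | inj₁ t ih | proj₀ t ih | proj₁ t ih => exact .unary rfl ih
  | cotuple s t ihs iht | tuple s t ihs iht => exact .binary rfl ihs iht

theorem Ty.length_encode (X : Ty) : X.encode.length = X.size := by
  induction X with
  | zero | one => rfl
  | add X Y ihX ihY | mul X Y ihX ihY => simp [encode, size, ihX, ihY]; omega

theorem Ty.size_pos (X : Ty) : 1 ≤ X.size := by cases X <;> simp [size, add_assoc]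

/-- Each pairing rule splits the rectangle |X| × |A| into two disjoint smaller ones and leaves room
for its own letter; the unary rules pass to a part of it. -/
theorem Term.length_encode_le {X A : Ty} (t : Term X A) : t.encode.length ≤ X.size * A.size := by
  induction t with
  | @cotuple₀ A => simpa [encode, Ty.size] using A.size_pos
  | @tuple₀ X => simpa [encode, Ty.size] using X.size_pos
  | @inj₀ X A B t ih | @inj₁ X A B t ih =>
    have := X.size_pos
    simp only [encode, List.length_cons, Ty.size]; nlinarith
  | @proj₀ X Y A t ih | @proj₁ X Y A t ih =>
    have := A.size_pos
    simp only [encode, List.length_cons, Ty.size]; nlinarith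
  | @cotuple X Y A s t ihs iht =>
    have := A.size_pos
    simp only [encode, List.length_cons, List.length_append, Ty.size]; nlinarith
  | @tuple X A B s t ihs iht =>
    have := X.size_pos
    simp only [encode, List.length_cons, List.length_append, Ty.size]; nlinarith

/-- The word `L` occurs in `w` at position `i`. -/
def Occ (w : List Letter) (i : ℕ) (L : List Letter) : Prop := ∃ R, w.drop i = L ++ R

namespace Occ

variable {w : List Letter} {i : ℕ} {l : Letter} {L L' : List Letter}

theorem getElem? (h : Occ w i (l :: L)) : w[i]? = some l := by
  obtain ⟨R, h⟩ := h
  have := congrArg List.head? h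
  simpa using this

theorem tail (h : Occ w i (l :: L)) : Occ w (i + 1) L := by
  obtain ⟨R, h⟩ := h
  exact ⟨R, by rw [← List.drop_drop, h]; simp⟩

theorem left (h : Occ w i (L ++ L')) : Occ w i L := by
  obtain ⟨R, h⟩ := h
  exact ⟨L' ++ R, by rw [h, List.append_assoc]⟩

theorem right (h : Occ w i (L ++ L')) : Occ w (i + L.length) L' := by
  obtain ⟨R, h⟩ := h
  exact ⟨R, by rw [← List.drop_drop, h, List.append_assoc, List.drop_left]⟩

theorem lt (h : Occ w i (l :: L)) : i < w.length :=
  (List.getElem?_eq_some_iff.1 h.getElem?).1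

theorem le_length (h : Occ w i L) (hi : i ≤ w.length) : i + L.length ≤ w.length := by
  obtain ⟨R, h⟩ := h
  have := congrArg List.length h
  simp at this
  omega

theorem cons (h : w[i]? = some l) (h' : Occ w (i + 1) L) : Occ w i (l :: L) := by
  obtain ⟨R, h'⟩ := h'
  obtain ⟨hi, h⟩ := List.getElem?_eq_some_iff.1 h
  exact ⟨R, by rw [List.drop_eq_getElem_cons hi, h, h']; rfl⟩

theorem append (h : Occ w i L) (h' : Occ w (i + L.length) L') : Occ w i (L ++ L') := by
  obtain ⟨R, h⟩ := h
  obtain ⟨R', h'⟩ := h'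
  refine ⟨R', ?_⟩
  rw [← List.drop_drop, h, List.drop_left] at h'
  rw [h, h', List.append_assoc]

theorem eq (h : Occ w i L) (h' : Occ w i L') (hL : IsExpr L) (hL' : IsExpr L') : L = L' := by
  obtain ⟨R, h⟩ := h
  obtain ⟨R', h'⟩ := h'
  exact hL.eq_of_append hL' (h.symm.trans h')

end Occ

theorem IsExpr.exists_cons {L : List Letter} (h : IsExpr L) : ∃ l L', L = l :: L' := by
  cases h <;> exact ⟨_, _, rfl⟩

theorem IsExpr.lt {L w : List Letter} {i : ℕ} (h : IsExpr L) (ho : Occ w i L) : i < w.length := by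
  obtain ⟨l, L', rfl⟩ := h.exists_cons
  exact ho.lt

theorem IsExpr.le {L w : List Letter} {i : ℕ} (h : IsExpr L) (ho : Occ w i L) :
    i + L.length ≤ w.length := ho.le_length (h.lt ho).le

/-! ### Nodes of types -/

namespace Ty

/-- The subexpression at the end of a path. -/
def sub : Ty → List Bool → Option Ty
  | X, [] => some X
  | .add X _, false :: p => X.sub p
  | .add _ Y, true :: p => Y.sub p
  | .mul X _, false :: p => X.sub p
  | .mul _ Y, true :: p => Y.sub p
  | .zero, _ :: _ => none
  | .one, _ :: _ => none

/-- The position in the prefix notation of the end of a path. -/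
def pos : Ty → List Bool → ℕ
  | _, [] => 0
  | .add X _, false :: p => 1 + X.pos p
  | .add X Y, true :: p => 1 + X.size + Y.pos p
  | .mul X _, false :: p => 1 + X.pos p
  | .mul X Y, true :: p => 1 + X.size + Y.pos p
  | .zero, _ :: _ => 0
  | .one, _ :: _ => 0

@[simp] theorem sub_nil (X : Ty) : X.sub [] = some X := by cases X <;> rfl

@[simp] theorem pos_nil (X : Ty) : X.pos [] = 0 := by cases X <;> rfl

theorem sub_append {X Y : Ty} {p : List Bool} (h : X.sub p = some Y) (q : List Bool) :
    X.sub (p ++ q) = Y.sub q := by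
  induction X generalizing p with
  | zero | one => cases p <;> simp_all [sub]
  | add X₀ X₁ ih₀ ih₁ | mul X₀ X₁ ih₀ ih₁ =>
    rcases p with _ | ⟨_ | _, p⟩
    · simp_all
    · exact ih₀ h
    · exact ih₁ h

theorem pos_append {X Y : Ty} {p : List Bool} (h : X.sub p = some Y) (q : List Bool) :
    X.pos (p ++ q) = X.pos p + Y.pos q := by
  induction X generalizing p with
  | zero | one => cases p <;> simp_all [sub]
  | add X₀ X₁ ih₀ ih₁ | mul X₀ X₁ ih₀ ih₁ =>
    rcases p with _ | ⟨_ | _, p⟩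
    · simp_all
    · simp only [List.cons_append, pos]; rw [ih₀ h]; ring
    · simp only [List.cons_append, pos]; rw [ih₁ h]; ring

theorem occ_sub {w : List Letter} {i : ℕ} {X Y : Ty} {p : List Bool} (h : X.sub p = some Y)
    (hX : Occ w i X.encode) : Occ w (i + X.pos p) Y.encode := by
  induction X generalizing i p with
  | zero | one => cases p <;> simp_all [sub]
  | add X₀ X₁ ih₀ ih₁ | mul X₀ X₁ ih₀ ih₁ =>
    rcases p with _ | ⟨_ | _, p⟩
    · simp_all
    · simpa [pos, add_assoc] using ih₀ h hX.tail.left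
    · simpa [pos, add_assoc, length_encode] using ih₁ h hX.tail.right

theorem pos_lt {X Y : Ty} {p : List Bool} (h : X.sub p = some Y) : X.pos p < X.size := by
  induction X generalizing p with
  | zero | one => cases p <;> simp_all [sub, size]
  | add X₀ X₁ ih₀ ih₁ | mul X₀ X₁ ih₀ ih₁ =>
    rcases p with _ | ⟨_ | _, p⟩
    · simp [size, add_assoc]
    · have := ih₀ h; simp only [pos, size]; omega
    · have := ih₁ h; simp only [pos, size]; omega

/-- The positions in the left subtree come strictly after the root and strictly before those in the
right subtree. -/
theorem pos_inj {X Y Y' : Ty} {p p' : List Bool} (h : X.sub p = some Y) (h' : X.sub p' = some Y')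
    (e : X.pos p = X.pos p') : p = p' := by
  induction X generalizing p p' with
  | zero | one => cases p <;> cases p' <;> simp [sub] at h h' ⊢
  | add X₀ X₁ ih₀ ih₁ | mul X₀ X₁ ih₀ ih₁ =>
    rcases p with _ | ⟨_ | _, p⟩ <;> rcases p' with _ | ⟨_ | _, p'⟩ <;> simp only [pos] at e
    · rfl
    · omega
    · omega
    · omega
    · rw [ih₀ h h' (by omega)]
    · have := pos_lt (X := X₀) h; omega
    · omega
    · have := pos_lt (X := X₀) h'; omega
    · rw [ih₁ h h' (by omega)]

theorem sub_dual (X : Ty) (p : List Bool) : X.dual.sub p = (X.sub p).map dual := by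
  induction X generalizing p with
  | zero | one => cases p <;> simp [sub, dual]
  | add X₀ X₁ ih₀ ih₁ | mul X₀ X₁ ih₀ ih₁ =>
    rcases p with _ | ⟨_ | _, p⟩
    · simp
    · exact ih₀ p
    · exact ih₁ p

theorem isZeroLeaf_iff_sub {X : Ty} {p : List Bool} : X.IsZeroLeaf p ↔ X.sub p = some .zero := by
  induction X generalizing p with
  | zero | one => cases p <;> simp [sub, IsZeroLeaf]
  | add X₀ X₁ ih₀ ih₁ | mul X₀ X₁ ih₀ ih₁ =>
    rcases p with _ | ⟨_ | _, p⟩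
    · simp [IsZeroLeaf]
    · exact ih₀
    · exact ih₁

theorem isOneLeaf_iff_sub {X : Ty} {p : List Bool} : X.IsOneLeaf p ↔ X.sub p = some .one := by
  rw [IsOneLeaf, isZeroLeaf_iff_sub, sub_dual]
  rcases X.sub p with _ | (_ | _ | _ | _) <;> simp [dual]

theorem Stable.sub {A B : Ty} {P : List Bool → Prop} {p : List Bool} (h : A.Stable P)
    (hp : A.sub p = some B) : B.Stable fun q => P (p ++ q) := by
  induction A generalizing p P with
  | zero | one => cases p <;> simp_all [Ty.sub]
  | add X₀ X₁ ih₀ ih₁ | mul X₀ X₁ ih₀ ih₁ =>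
    rcases p with _ | ⟨_ | _, p⟩
    · simp_all
    · exact ih₀ (P := fun p => P (false :: p)) h.2.1 hp
    · exact ih₁ (P := fun p => P (true :: p)) h.2.2 hp

theorem Stable.add {A B C : Ty} {P : List Bool → Prop} {p : List Bool} (h : A.Stable P)
    (hp : A.sub p = some (.add B C)) : (P p ↔ P (p ++ [false])) ∧ (P p ↔ P (p ++ [true])) := by
  simpa using (h.sub hp).1

theorem Stable.mul {A B C : Ty} {P : List Bool → Prop} {p : List Bool} (h : A.Stable P)
    (hp : A.sub p = some (.mul B C)) : P p ↔ P (p ++ [false]) ∧ P (p ++ [true]) := by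
  simpa using (h.sub hp).1

/-- The recursive condition restated as one condition per node, which is the form that the rules
express. -/
theorem stable_of_sub {A : Ty} {P : List Bool → Prop}
    (ha : ∀ p B C, A.sub p = some (.add B C) →
      (P p ↔ P (p ++ [false])) ∧ (P p ↔ P (p ++ [true])))
    (hm : ∀ p B C, A.sub p = some (.mul B C) → (P p ↔ P (p ++ [false]) ∧ P (p ++ [true]))) :
    A.Stable P := by
  induction A generalizing P with
  | zero | one => trivial
  | add X₀ X₁ ih₀ ih₁ =>
    exact ⟨ha [] X₀ X₁ rfl, ih₀ (fun p => ha (false :: p)) fun p => hm (false :: p),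
      ih₁ (fun p => ha (true :: p)) fun p => hm (true :: p)⟩
  | mul X₀ X₁ ih₀ ih₁ =>
    exact ⟨hm [] X₀ X₁ rfl, ih₀ (fun p => ha (false :: p)) fun p => hm (false :: p),
      ih₁ (fun p => ha (true :: p)) fun p => hm (true :: p)⟩

theorem Stable.dual_add {A B C : Ty} {P : List Bool → Prop} {p : List Bool} (h : A.dual.Stable P)
    (hp : A.sub p = some (.add B C)) : P p ↔ P (p ++ [false]) ∧ P (p ++ [true]) :=
  h.mul (B := B.dual) (C := C.dual) (by rw [sub_dual, hp]; rfl)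

theorem Stable.dual_mul {A B C : Ty} {P : List Bool → Prop} {p : List Bool} (h : A.dual.Stable P)
    (hp : A.sub p = some (.mul B C)) : (P p ↔ P (p ++ [false])) ∧ (P p ↔ P (p ++ [true])) :=
  h.add (B := B.dual) (C := C.dual) (by rw [sub_dual, hp]; rfl)

theorem stable_dual_of_sub {A : Ty} {P : List Bool → Prop}
    (hm : ∀ p B C, A.sub p = some (.mul B C) →
      (P p ↔ P (p ++ [false])) ∧ (P p ↔ P (p ++ [true])))
    (ha : ∀ p B C, A.sub p = some (.add B C) → (P p ↔ P (p ++ [false]) ∧ P (p ++ [true]))) :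
    A.dual.Stable P := by
  refine stable_of_sub (fun p B C h => hm p B.dual C.dual ?_) fun p B C h => ha p B.dual C.dual ?_
  all_goals
    have := sub_dual A.dual p
    rw [dual_dual, h] at this
    exact this

end Ty

/-! ### Subterms -/

/-- The term `t` is the subterm of `f` that starts at position `u`; its domain and its codomain are
the ends of the paths `x` and `a`. -/
inductive Term.Place {X A : Ty} (f : Term X A) :
    {X' A' : Ty} → ℕ → List Bool → List Bool → Term X' A' → Prop
  | root : Place f 0 [] [] f
  | inj₀ {X' A' B' : Ty} {u : ℕ} {x a : List Bool} {t : Term X' A'} :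
      Place f u x a (.inj₀ t : Term X' (.add A' B')) → Place f (u + 1) x (a ++ [false]) t
  | inj₁ {X' A' B' : Ty} {u : ℕ} {x a : List Bool} {t : Term X' B'} :
      Place f u x a (.inj₁ t : Term X' (.add A' B')) → Place f (u + 1) x (a ++ [true]) t
  | proj₀ {X' Y' A' : Ty} {u : ℕ} {x a : List Bool} {t : Term X' A'} :
      Place f u x a (.proj₀ t : Term (.mul X' Y') A') → Place f (u + 1) (x ++ [false]) a t
  | proj₁ {X' Y' A' : Ty} {u : ℕ} {x a : List Bool} {t : Term Y' A'} :
      Place f u x a (.proj₁ t : Term (.mul X' Y') A') → Place f (u + 1) (x ++ [true]) a t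
  | cotuple_left {X' Y' A' : Ty} {u : ℕ} {x a : List Bool} {s : Term X' A'} {t : Term Y' A'} :
      Place f u x a (.cotuple s t) → Place f (u + 1) (x ++ [false]) a s
  | cotuple_right {X' Y' A' : Ty} {u : ℕ} {x a : List Bool} {s : Term X' A'} {t : Term Y' A'} :
      Place f u x a (.cotuple s t) → Place f (u + 1 + s.encode.length) (x ++ [true]) a t
  | tuple_left {X' A' B' : Ty} {u : ℕ} {x a : List Bool} {s : Term X' A'} {t : Term X' B'} :
      Place f u x a (.tuple s t) → Place f (u + 1) x (a ++ [false]) s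
  | tuple_right {X' A' B' : Ty} {u : ℕ} {x a : List Bool} {s : Term X' A'} {t : Term X' B'} :
      Place f u x a (.tuple s t) → Place f (u + 1 + s.encode.length) x (a ++ [true]) t

namespace Term.Place

variable {X A X' A' : Ty} {f : Term X A} {u : ℕ} {x a : List Bool} {t : Term X' A'}

theorem sub_dom (h : f.Place u x a t) : X.sub x = some X' := by
  induction h with
  | root => simp
  | inj₀ _ ih | inj₁ _ ih | tuple_left _ ih | tuple_right _ ih => exact ih
  | proj₀ _ ih | proj₁ _ ih | cotuple_left _ ih | cotuple_right _ ih =>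
    rw [Ty.sub_append ih]; simp [Ty.sub]

theorem sub_cod (h : f.Place u x a t) : A.sub a = some A' := by
  induction h with
  | root => simp
  | proj₀ _ ih | proj₁ _ ih | cotuple_left _ ih | cotuple_right _ ih => exact ih
  | inj₀ _ ih | inj₁ _ ih | tuple_left _ ih | tuple_right _ ih =>
    rw [Ty.sub_append ih]; simp [Ty.sub]

theorem occ {w : List Letter} {i : ℕ} (h : f.Place u x a t) (hf : Occ w i f.encode) :
    Occ w (i + u) t.encode := by
  induction h with
  | root => exact hf
  | inj₀ _ ih | inj₁ _ ih | proj₀ _ ih | proj₁ _ ih => exact ih.tail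
  | cotuple_left _ ih | tuple_left _ ih => exact ih.tail.left
  | cotuple_right _ ih | tuple_right _ ih =>
    have := ih.tail.right
    simpa only [← add_assoc] using this

theorem sat {T : List Bool → List Bool → Prop} (h : f.Place u x a t) (hf : f.Sat T) :
    t.Sat fun x' a' => T (x ++ x') (a ++ a') := by
  induction h with
  | root => exact hf
  | inj₀ _ ih | inj₁ _ ih | proj₀ _ ih | proj₁ _ ih => simpa [Sat] using ih
  | cotuple_left _ ih | tuple_left _ ih => simpa [Sat] using ih.1
  | cotuple_right _ ih | tuple_right _ ih => simpa [Sat] using ih.2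

/-- Stated for all places so that the induction keeps track of the paths from the roots; it is used
for the term itself. -/
theorem sat_of_units {T : List Bool → List Bool → Prop} (h : f.Place u x a t)
    (hz : ∀ (A' : Ty) u x a, f.Place u x a (.cotuple₀ : Term .zero A') → T x a)
    (ho : ∀ (X' : Ty) u x a, f.Place u x a (.tuple₀ : Term X' .one) → T x a) :
    t.Sat fun x' a' => T (x ++ x') (a ++ a') := by
  induction t generalizing u x a with
  | cotuple₀ => simpa [Sat] using hz _ _ _ _ h
  | tuple₀ => simpa [Sat] using ho _ _ _ _ h
  | inj₀ t ih => simpa [Sat] using ih h.inj₀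
  | inj₁ t ih => simpa [Sat] using ih h.inj₁
  | proj₀ t ih => simpa [Sat] using ih h.proj₀
  | proj₁ t ih => simpa [Sat] using ih h.proj₁
  | cotuple s t ihs iht =>
    exact ⟨by simpa using ihs h.cotuple_left, by simpa using iht h.cotuple_right⟩
  | tuple s t ihs iht =>
    exact ⟨by simpa using ihs h.tuple_left, by simpa using iht h.tuple_right⟩

end Term.Place

end SumProd

/-! ### The rules for the word problem and their intended interpretation. -/

namespace SumProd
open Datalog

/-! ### The rules for the word problem -/

instance : Finite Letter :=
  Finite.of_surjective (fun i : Fin 12 => (![.zero, .one, .add, .mul, .cotuple₀, .tuple₀, .inj₀,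
    .inj₁, .proj₀, .proj₁, .cotuple, .tuple] : Fin 12 → Letter) i) fun l => by
      cases l
      exacts [⟨0, rfl⟩, ⟨1, rfl⟩, ⟨2, rfl⟩, ⟨3, rfl⟩, ⟨4, rfl⟩, ⟨5, rfl⟩, ⟨6, rfl⟩, ⟨7, rfl⟩,
        ⟨8, rfl⟩, ⟨9, rfl⟩, ⟨10, rfl⟩, ⟨11, rfl⟩]

/-- The relations between positions of the input word; `b : Bool` selects one of the two terms. -/
inductive Rel : Type
  /-- the expression that starts at `i` ends at `j` -/
  | ends
  /-- the codomain starts at `j` -/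
  | cod
  /-- the term starts at `j` -/
  | start (b : Bool)
  /-- the position lies in the domain -/
  | inDom
  /-- the position lies in the codomain -/
  | inCod
  /-- the two subexpressions of an expression -/
  | child
  /-- a subterm with its domain and codomain -/
  | place (b : Bool)
  /-- a token derivable from the term -/
  | token (b : Bool)
  /-- the units of a subterm are tokens derivable from the other term -/
  | ok (b : Bool)
  /-- the two terms denote the same arrow -/
  | equal
  deriving DecidableEq, Fintype

/-- Names of the rules. -/
inductive RuleName : Type
  | endsNullary | endsUnary | endsBinary
  | cod | startLeft | startRight | child
  | inDom | inDomChild (c : Bool) | inCod | inCodChild (c : Bool)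
  | place (b : Bool) | placeInj (b c : Bool) | placeProj (b c : Bool)
  | placeCotuple (b c : Bool) | placeTuple (b c : Bool)
  | unit (b c : Bool)
  | zeroAdd (b c : Bool) | zeroAdd' (b c : Bool) | zeroMul (b c : Bool) | zeroMul' (b : Bool)
  | oneMul (b c : Bool) | oneMul' (b c : Bool) | oneAdd (b c : Bool) | oneAdd' (b : Bool)
  | okUnit (b c : Bool) | okInj (b c : Bool) | okProj (b c : Bool) | okCotuple (b : Bool)
  | okTuple (b : Bool)
  | equal
  deriving Fintype

open Classical in
/-- The letter at a position. -/
noncomputable def isLetter (v : Fin 8) (l : Letter) : Cond Letter Rel :=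
  .letter v fun l' => decide (l' = l)

/-- The arity of the letter at a position. -/
def hasArity (v : Fin 8) (n : ℕ) : Cond Letter Rel := .letter v fun l => decide (l.arity = n)

theorem holds_isLetter {w : List Letter} {I : Rel → ℕ → ℕ → ℕ → Prop} {e : Fin 8 → ℕ} {v : Fin 8}
    {l : Letter} : (isLetter v l).Holds w I e ↔ w[e v]? = some l := by
  simp [isLetter, Cond.Holds]

theorem holds_hasArity {w : List Letter} {I : Rel → ℕ → ℕ → ℕ → Prop} {e : Fin 8 → ℕ} {v : Fin 8}
    {n : ℕ} : (hasArity v n).Holds w I e ↔ ∃ l, w[e v]? = some l ∧ l.arity = n := by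
  simp [hasArity, Cond.Holds]

/-- The rules. -/
noncomputable def rule : RuleName → Rule Letter Rel
  -- Relations with fewer than three arguments repeat the last one.
  | .endsNullary => ⟨[hasArity 0 0, .succ 0 1], .ends, 0, 1, 1⟩
  | .endsUnary => ⟨[hasArity 0 1, .succ 0 1, .fact .ends 1 2 2], .ends, 0, 2, 2⟩
  | .endsBinary =>
    ⟨[hasArity 0 2, .succ 0 1, .fact .ends 1 2 2, .fact .ends 2 3 3], .ends, 0, 3, 3⟩
  | .cod => ⟨[.zero 0, .fact .ends 0 1 1], .cod, 1, 1, 1⟩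
  | .startLeft => ⟨[.fact .cod 0 0 0, .fact .ends 0 1 1], .start false, 1, 1, 1⟩
  | .startRight => ⟨[.fact (.start false) 0 0 0, .fact .ends 0 1 1], .start true, 1, 1, 1⟩
  | .child => ⟨[hasArity 0 2, .succ 0 1, .fact .ends 1 2 2], .child, 0, 1, 2⟩
  | .inDom => ⟨[.zero 0], .inDom, 0, 0, 0⟩
  | .inDomChild c =>
    ⟨[.fact .inDom 0 0 0, .fact .child 0 1 2], .inDom, cond c 2 1, cond c 2 1, cond c 2 1⟩
  | .inCod => ⟨[.fact .cod 0 0 0], .inCod, 0, 0, 0⟩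
  | .inCodChild c =>
    ⟨[.fact .inCod 0 0 0, .fact .child 0 1 2], .inCod, cond c 2 1, cond c 2 1, cond c 2 1⟩
  | .place b => ⟨[.zero 0, .fact .cod 1 1 1, .fact (.start b) 2 2 2], .place b, 2, 0, 1⟩
  | .placeInj b c =>
    ⟨[.fact (.place b) 0 1 2, isLetter 0 (cond c .inj₁ .inj₀), .succ 0 3, .fact .child 2 4 5],
      .place b, 3, 1, cond c 5 4⟩
  | .placeProj b c =>
    ⟨[.fact (.place b) 0 1 2, isLetter 0 (cond c .proj₁ .proj₀), .succ 0 3, .fact .child 1 4 5],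
      .place b, 3, cond c 5 4, 2⟩
  | .placeCotuple b c =>
    ⟨[.fact (.place b) 0 1 2, isLetter 0 .cotuple, .fact .child 0 3 6, .fact .child 1 4 5],
      .place b, cond c 6 3, cond c 5 4, 2⟩
  | .placeTuple b c =>
    ⟨[.fact (.place b) 0 1 2, isLetter 0 .tuple, .fact .child 0 3 6, .fact .child 2 4 5],
      .place b, cond c 6 3, 1, cond c 5 4⟩
  | .unit b c =>
    ⟨[.fact (.place b) 0 1 2, isLetter 0 (cond c .tuple₀ .cotuple₀)], .token b, 1, 2, 2⟩
  -- The rules from here to `oneAdd'` are the implications contained in `Closed`: those over leaves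
  -- 0 of the domain, then their duals over leaves 1 of the codomain.
  | .zeroAdd b c =>
    ⟨[.fact .inDom 0 0 0, isLetter 0 .zero, .fact .inCod 1 1 1, isLetter 1 .add,
      .fact .child 1 2 3, .fact (.token b) 0 1 1], .token b, 0, cond c 3 2, cond c 3 2⟩
  | .zeroAdd' b c =>
    ⟨[.fact .inDom 0 0 0, isLetter 0 .zero, .fact .inCod 1 1 1, isLetter 1 .add,
      .fact .child 1 2 3, .fact (.token b) 0 (cond c 3 2) (cond c 3 2)], .token b, 0, 1, 1⟩
  | .zeroMul b c =>
    ⟨[.fact .inDom 0 0 0, isLetter 0 .zero, .fact .inCod 1 1 1, isLetter 1 .mul,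
      .fact .child 1 2 3, .fact (.token b) 0 1 1], .token b, 0, cond c 3 2, cond c 3 2⟩
  | .zeroMul' b =>
    ⟨[.fact .inDom 0 0 0, isLetter 0 .zero, .fact .inCod 1 1 1, isLetter 1 .mul,
      .fact .child 1 2 3, .fact (.token b) 0 2 2, .fact (.token b) 0 3 3], .token b, 0, 1, 1⟩
  | .oneMul b c =>
    ⟨[.fact .inCod 0 0 0, isLetter 0 .one, .fact .inDom 1 1 1, isLetter 1 .mul,
      .fact .child 1 2 3, .fact (.token b) 1 0 0], .token b, cond c 3 2, 0, 0⟩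
  | .oneMul' b c =>
    ⟨[.fact .inCod 0 0 0, isLetter 0 .one, .fact .inDom 1 1 1, isLetter 1 .mul,
      .fact .child 1 2 3, .fact (.token b) (cond c 3 2) 0 0], .token b, 1, 0, 0⟩
  | .oneAdd b c =>
    ⟨[.fact .inCod 0 0 0, isLetter 0 .one, .fact .inDom 1 1 1, isLetter 1 .add,
      .fact .child 1 2 3, .fact (.token b) 1 0 0], .token b, cond c 3 2, 0, 0⟩
  | .oneAdd' b =>
    ⟨[.fact .inCod 0 0 0, isLetter 0 .one, .fact .inDom 1 1 1, isLetter 1 .add,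
      .fact .child 1 2 3, .fact (.token b) 2 0 0, .fact (.token b) 3 0 0], .token b, 1, 0, 0⟩
  -- The second term of each comparison is consulted through `!b`. No `place` premise is needed, as
  -- the intended meaning of `ok` covers every typed reading of the word at a position.
  | .okUnit b c =>
    ⟨[isLetter 0 (cond c .tuple₀ .cotuple₀), .fact (.token !b) 1 2 2], .ok b, 0, 1, 2⟩
  | .okInj b c =>
    ⟨[isLetter 0 (cond c .inj₁ .inj₀), .succ 0 3, .fact .child 2 4 5,
      .fact (.ok b) 3 1 (cond c 5 4)], .ok b, 0, 1, 2⟩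
  | .okProj b c =>
    ⟨[isLetter 0 (cond c .proj₁ .proj₀), .succ 0 3, .fact .child 1 4 5,
      .fact (.ok b) 3 (cond c 5 4) 2], .ok b, 0, 1, 2⟩
  | .okCotuple b =>
    ⟨[isLetter 0 .cotuple, .fact .child 0 3 6, .fact .child 1 4 5, .fact (.ok b) 3 4 2,
      .fact (.ok b) 6 5 2], .ok b, 0, 1, 2⟩
  | .okTuple b =>
    ⟨[isLetter 0 .tuple, .fact .child 0 3 6, .fact .child 2 4 5, .fact (.ok b) 3 1 4,
      .fact (.ok b) 6 1 5], .ok b, 0, 1, 2⟩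
  | .equal =>
    ⟨[.zero 0, .fact .cod 1 1 1, .fact (.start false) 2 2 2, .fact (.start true) 3 3 3,
      .fact (.ok false) 2 0 1, .fact (.ok true) 3 0 1], .equal, 0, 0, 0⟩

/-- The list of the rules. -/
noncomputable def rules : List (Rule Letter Rel) := Finset.univ.toList.map rule

theorem isModel_rules {w : List Letter} {I : Rel → ℕ → ℕ → ℕ → Prop} :
    IsModel rules w I ↔ ∀ (k : RuleName) (e : Fin 8 → ℕ), (∀ i, e i ≤ w.length) →
      (∀ c ∈ (rule k).body, c.Holds w I e) →
      I (rule k).rel (e (rule k).a) (e (rule k).b) (e (rule k).c) := by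
  simp [IsModel, rules]

/-! ### The intended model -/

/-- The two subexpressions of the expression at position `i` start at `j` and `k`. -/
structure Child (w : List Letter) (i j k : ℕ) : Prop where
  arity : ∃ l, w[i]? = some l ∧ l.arity = 2
  left : j = i + 1
  right : ∃ L, IsExpr L ∧ Occ w j L ∧ k = j + L.length

theorem Child.eq {w : List Letter} {i j k : ℕ} {l : Letter} {L L' : List Letter}
    (h : Child w i j k) (ho : Occ w i (l :: (L ++ L'))) (hL : IsExpr L) :
    j = i + 1 ∧ k = i + 1 + L.length := by
  obtain ⟨-, rfl, L₁, h1, h2, rfl⟩ := h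
  rw [h2.eq ho.tail.left h1 hL]
  exact ⟨rfl, rfl⟩

/-- A leaf has no letter of arity 2, so the node is a sum or a product, and unique readability fixes
where its right part starts. -/
theorem Child.sub {w : List Letter} {i j k : ℕ} {T Y : Ty} {p : List Bool} (hT : Occ w i T.encode)
    (hp : T.sub p = some Y) (h : Child w (i + T.pos p) j k) :
    (∃ Y₀, T.sub (p ++ [false]) = some Y₀) ∧ (∃ Y₁, T.sub (p ++ [true]) = some Y₁) ∧
      j = i + T.pos (p ++ [false]) ∧ k = i + T.pos (p ++ [true]) := by
  have ho := Ty.occ_sub hp hT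
  rw [Ty.sub_append hp, Ty.sub_append hp, Ty.pos_append hp, Ty.pos_append hp]
  cases Y with
  | zero | one =>
    obtain ⟨l, hl, hl'⟩ := h.arity
    have := Option.some.inj (hl.symm.trans ho.getElem?)
    subst this
    cases hl'
  | add Y₀ Y₁ | mul Y₀ Y₁ =>
    obtain ⟨h1, h2⟩ := h.eq ho Y₀.isExpr_encode
    rw [Ty.length_encode] at h2
    simp [Ty.sub, Ty.pos, h1, h2, add_assoc]

theorem Ty.eq_zero_of_occ {w : List Letter} {i : ℕ} {Y : Ty} (h : Occ w i Y.encode)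
    (hl : w[i]? = some .zero) : Y = .zero := by
  cases Y <;> first | rfl | exact absurd (h.getElem?.symm.trans hl) nofun

theorem Ty.eq_one_of_occ {w : List Letter} {i : ℕ} {Y : Ty} (h : Occ w i Y.encode)
    (hl : w[i]? = some .one) : Y = .one := by
  cases Y <;> first | rfl | exact absurd (h.getElem?.symm.trans hl) nofun

theorem Ty.eq_add_of_occ {w : List Letter} {i : ℕ} {Y : Ty} (h : Occ w i Y.encode)
    (hl : w[i]? = some .add) : ∃ Y₀ Y₁, Y = .add Y₀ Y₁ := by
  cases Y <;> first | exact ⟨_, _, rfl⟩ | exact absurd (h.getElem?.symm.trans hl) nofun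

theorem Ty.eq_mul_of_occ {w : List Letter} {i : ℕ} {Y : Ty} (h : Occ w i Y.encode)
    (hl : w[i]? = some .mul) : ∃ Y₀ Y₁, Y = .mul Y₀ Y₁ := by
  cases Y <;> first | exact ⟨_, _, rfl⟩ | exact absurd (h.getElem?.symm.trans hl) nofun

namespace WordProblem

variable (P : WordProblem)

/-- One of the two terms. -/
def term (b : Bool) : Term P.dom P.cod := cond b P.right P.left

/-- The position where one of the terms starts. -/
def start (b : Bool) : ℕ := P.dom.size + P.cod.size + cond b P.left.encode.length 0

theorem occ_dom : Occ P.encode 0 P.dom.encode :=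
  ⟨P.cod.encode ++ (P.left.encode ++ P.right.encode), by simp [encode]⟩

theorem occ_cod : Occ P.encode P.dom.size P.cod.encode := by
  have : Occ P.encode 0 (P.dom.encode ++ P.cod.encode) :=
    ⟨P.left.encode ++ P.right.encode, by simp [encode]⟩
  simpa [Ty.length_encode] using this.right

theorem occ_term (b : Bool) : Occ P.encode (P.start b) (P.term b).encode := by
  have h : Occ P.encode 0 ((P.dom.encode ++ P.cod.encode) ++ (P.left.encode ++ P.right.encode)) :=
    ⟨[], by simp [encode]⟩
  have h' := h.right
  cases b
  · simpa [Ty.length_encode, start, term] using h'.left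
  · simpa [Ty.length_encode, start, term] using h'.right

/-- The intended meaning of the relations. -/
def intended : Rel → ℕ → ℕ → ℕ → Prop
  | .ends, i, j, _ => ∃ L, IsExpr L ∧ Occ P.encode i L ∧ j = i + L.length
  | .cod, j, _, _ => j = P.dom.size
  | .start b, j, _, _ => j = P.start b
  | .inDom, x, _, _ => ∃ p Y, P.dom.sub p = some Y ∧ x = P.dom.pos p
  | .inCod, a, _, _ => ∃ p B, P.cod.sub p = some B ∧ a = P.dom.size + P.cod.pos p
  | .child, i, j, k => Child P.encode i j k
  | .place b, u, x, a => ∃ (u' : ℕ) (p q : List Bool) (X' A' : Ty) (t : Term X' A'),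
      (P.term b).Place u' p q t ∧ u = P.start b + u' ∧ x = P.dom.pos p ∧
        a = P.dom.size + P.cod.pos q
  -- Quantifying over all paths makes the relation vacuous at positions that are not nodes; at nodes
  -- the paths are unique.
  | .token b, x, a, _ => ∀ p q Y B, P.dom.sub p = some Y → P.cod.sub q = some B →
      x = P.dom.pos p → a = P.dom.size + P.cod.pos q → (P.term b).closure p q
  | .ok b, u, x, a => ∀ (p q : List Bool) (X' A' : Ty) (t : Term X' A'), P.dom.sub p = some X' →
      P.cod.sub q = some A' → x = P.dom.pos p → a = P.dom.size + P.cod.pos q →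
      Occ P.encode u t.encode → t.Sat fun p' q' => (P.term !b).closure (p ++ p') (q ++ q')
  | .equal, _, _, _ => P.left.denote = P.right.denote

variable {P}

theorem intended_token {b : Bool} {p q : List Bool} {Y B : Ty} {k : ℕ} (hp : P.dom.sub p = some Y)
    (hq : P.cod.sub q = some B) :
    P.intended (.token b) (P.dom.pos p) (P.dom.size + P.cod.pos q) k ↔
      (P.term b).closure p q := by
  refine ⟨fun h => h p q Y B hp hq rfl rfl, fun h p' q' Y' B' hp' hq' ep eq => ?_⟩
  rw [← Ty.pos_inj hp hp' ep, ← Ty.pos_inj hq hq' (by omega)]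
  exact h

theorem intended_ends {i j k : ℕ} {L : List Letter} (h : P.intended .ends i j k)
    (ho : Occ P.encode i L) (hL : IsExpr L) : j = i + L.length := by
  obtain ⟨L', h1, h2, rfl⟩ := h
  rw [h2.eq ho h1 hL]

theorem intended_inDom_child {i j k : ℕ} (h : P.intended .inDom i i i) (hc : Child P.encode i j k) :
    P.intended .inDom j j j ∧ P.intended .inDom k k k := by
  obtain ⟨p, Y, hp, rfl⟩ := h
  obtain ⟨⟨Y₀, h₀⟩, ⟨Y₁, h₁⟩, rfl, rfl⟩ := Child.sub P.occ_dom hp (by simpa using hc)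
  exact ⟨⟨_, _, h₀, by simp⟩, ⟨_, _, h₁, by simp⟩⟩

theorem intended_inCod_child {i j k : ℕ} (h : P.intended .inCod i i i) (hc : Child P.encode i j k) :
    P.intended .inCod j j j ∧ P.intended .inCod k k k := by
  obtain ⟨p, Y, hp, rfl⟩ := h
  obtain ⟨⟨Y₀, h₀⟩, ⟨Y₁, h₁⟩, rfl, rfl⟩ := Child.sub P.occ_cod hp hc
  exact ⟨⟨_, _, h₀, rfl⟩, ⟨_, _, h₁, rfl⟩⟩

theorem intended_placeInj {b c : Bool} {u x a j k : ℕ} (h : P.intended (.place b) u x a)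
    (hl : P.encode[u]? = some (cond c .inj₁ .inj₀)) (hc : Child P.encode a j k) :
    P.intended (.place b) (u + 1) x (cond c k j) := by
  obtain ⟨u, p, q, X', A', t, h, rfl, rfl, rfl⟩ := h
  have ho := h.occ (P.occ_term b)
  obtain ⟨-, -, rfl, rfl⟩ := Child.sub P.occ_cod h.sub_cod hc
  cases c
  · cases t with
    | inj₀ t => exact ⟨_, _, _, _, _, t, h.inj₀, rfl, rfl, rfl⟩
    | _ => exact absurd (ho.getElem?.symm.trans hl) nofun
  · cases t with
    | inj₁ t => exact ⟨_, _, _, _, _, t, h.inj₁, rfl, rfl, rfl⟩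
    | _ => exact absurd (ho.getElem?.symm.trans hl) nofun

theorem intended_placeProj {b c : Bool} {u x a j k : ℕ} (h : P.intended (.place b) u x a)
    (hl : P.encode[u]? = some (cond c .proj₁ .proj₀)) (hc : Child P.encode x j k) :
    P.intended (.place b) (u + 1) (cond c k j) a := by
  obtain ⟨u, p, q, X', A', t, h, rfl, rfl, rfl⟩ := h
  have ho := h.occ (P.occ_term b)
  obtain ⟨-, -, rfl, rfl⟩ := Child.sub P.occ_dom h.sub_dom (by simpa using hc)
  cases c
  · cases t with
    | proj₀ t => exact ⟨_, _, _, _, _, t, h.proj₀, rfl, by simp, rfl⟩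
    | _ => exact absurd (ho.getElem?.symm.trans hl) nofun
  · cases t with
    | proj₁ t => exact ⟨_, _, _, _, _, t, h.proj₁, rfl, by simp, rfl⟩
    | _ => exact absurd (ho.getElem?.symm.trans hl) nofun

theorem intended_placeCotuple {b c : Bool} {u x a v v' j k : ℕ}
    (h : P.intended (.place b) u x a) (hl : P.encode[u]? = some .cotuple)
    (hu : Child P.encode u v v') (hc : Child P.encode x j k) :
    P.intended (.place b) (cond c v' v) (cond c k j) a := by
  obtain ⟨u, p, q, X', A', t, h, rfl, rfl, rfl⟩ := h
  have ho := h.occ (P.occ_term b)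
  obtain ⟨-, -, rfl, rfl⟩ := Child.sub P.occ_dom h.sub_dom (by simpa using hc)
  cases t with
  | cotuple s t =>
    obtain ⟨rfl, rfl⟩ := hu.eq ho s.isExpr_encode
    cases c
    · exact ⟨_, _, _, _, _, s, h.cotuple_left, rfl, by simp, rfl⟩
    · exact ⟨_, _, _, _, _, t, h.cotuple_right, by simp [add_assoc], by simp, rfl⟩
  | _ => exact absurd (ho.getElem?.symm.trans hl) nofun

theorem intended_placeTuple {b c : Bool} {u x a v v' j k : ℕ}
    (h : P.intended (.place b) u x a) (hl : P.encode[u]? = some .tuple)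
    (hu : Child P.encode u v v') (hc : Child P.encode a j k) :
    P.intended (.place b) (cond c v' v) x (cond c k j) := by
  obtain ⟨u, p, q, X', A', t, h, rfl, rfl, rfl⟩ := h
  have ho := h.occ (P.occ_term b)
  obtain ⟨-, -, rfl, rfl⟩ := Child.sub P.occ_cod h.sub_cod hc
  cases t with
  | tuple s t =>
    obtain ⟨rfl, rfl⟩ := hu.eq ho s.isExpr_encode
    cases c
    · exact ⟨_, _, _, _, _, s, h.tuple_left, rfl, rfl, rfl⟩
    · exact ⟨_, _, _, _, _, t, h.tuple_right, by simp [add_assoc], rfl, rfl⟩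
  | _ => exact absurd (ho.getElem?.symm.trans hl) nofun

/-- The closure contains the tokens of the term, and a place locates the token of its unit by the
paths from the roots. -/
theorem intended_unit {b c : Bool} {u x a k : ℕ} (h : P.intended (.place b) u x a)
    (hl : P.encode[u]? = some (cond c .tuple₀ .cotuple₀)) : P.intended (.token b) x a k := by
  obtain ⟨u, p, q, X', A', t, h, rfl, rfl, rfl⟩ := h
  have ho := h.occ (P.occ_term b)
  rw [intended_token h.sub_dom h.sub_cod]
  have := h.sat (P.term b).sat_closure
  cases c
  · cases t with
    | cotuple₀ => simpa [Term.Sat] using this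
    | _ => exact absurd (ho.getElem?.symm.trans hl) nofun
  · cases t with
    | tuple₀ => simpa [Term.Sat] using this
    | _ => exact absurd (ho.getElem?.symm.trans hl) nofun

section token

variable {x a j k : ℕ}

theorem intended_zeroAdd (b : Bool) (hx : P.intended .inDom x x x) (hx' : P.encode[x]? = some .zero)
    (ha : P.intended .inCod a a a) (ha' : P.encode[a]? = some .add) (hc : Child P.encode a j k) :
    (P.intended (.token b) x a a ↔ P.intended (.token b) x j j) ∧
      (P.intended (.token b) x a a ↔ P.intended (.token b) x k k) := by
  obtain ⟨p, Y, hp, rfl⟩ := hx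
  obtain ⟨q, B, hq, rfl⟩ := ha
  obtain rfl := Ty.eq_zero_of_occ (Ty.occ_sub hp P.occ_dom) (by simpa using hx')
  obtain ⟨B₀, B₁, rfl⟩ := Ty.eq_add_of_occ (Ty.occ_sub hq P.occ_cod) ha'
  obtain ⟨⟨_, h₀⟩, ⟨_, h₁⟩, rfl, rfl⟩ := Child.sub P.occ_cod hq hc
  rw [intended_token hp hq, intended_token hp h₀, intended_token hp h₁]
  exact ((P.term b).closed_closure.1 p (Ty.isZeroLeaf_iff_sub.2 hp)).add hq

theorem intended_zeroMul (b : Bool) (hx : P.intended .inDom x x x) (hx' : P.encode[x]? = some .zero)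
    (ha : P.intended .inCod a a a) (ha' : P.encode[a]? = some .mul) (hc : Child P.encode a j k) :
    P.intended (.token b) x a a ↔ P.intended (.token b) x j j ∧ P.intended (.token b) x k k := by
  obtain ⟨p, Y, hp, rfl⟩ := hx
  obtain ⟨q, B, hq, rfl⟩ := ha
  obtain rfl := Ty.eq_zero_of_occ (Ty.occ_sub hp P.occ_dom) (by simpa using hx')
  obtain ⟨B₀, B₁, rfl⟩ := Ty.eq_mul_of_occ (Ty.occ_sub hq P.occ_cod) ha'
  obtain ⟨⟨_, h₀⟩, ⟨_, h₁⟩, rfl, rfl⟩ := Child.sub P.occ_cod hq hc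
  rw [intended_token hp hq, intended_token hp h₀, intended_token hp h₁]
  exact ((P.term b).closed_closure.1 p (Ty.isZeroLeaf_iff_sub.2 hp)).mul hq

theorem intended_oneMul (b : Bool) (ha : P.intended .inCod a a a) (ha' : P.encode[a]? = some .one)
    (hx : P.intended .inDom x x x) (hx' : P.encode[x]? = some .mul) (hc : Child P.encode x j k) :
    (P.intended (.token b) x a a ↔ P.intended (.token b) j a a) ∧
      (P.intended (.token b) x a a ↔ P.intended (.token b) k a a) := by
  obtain ⟨p, Y, hp, rfl⟩ := hx
  obtain ⟨q, B, hq, rfl⟩ := ha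
  obtain rfl := Ty.eq_one_of_occ (Ty.occ_sub hq P.occ_cod) ha'
  obtain ⟨B₀, B₁, rfl⟩ := Ty.eq_mul_of_occ (Ty.occ_sub hp P.occ_dom) (by simpa using hx')
  obtain ⟨⟨_, h₀⟩, ⟨_, h₁⟩, rfl, rfl⟩ := Child.sub P.occ_dom hp (by simpa using hc)
  rw [zero_add, zero_add, intended_token hp hq, intended_token h₀ hq, intended_token h₁ hq]
  exact ((P.term b).closed_closure.2 q (Ty.isOneLeaf_iff_sub.2 hq)).dual_mul hp

theorem intended_oneAdd (b : Bool) (ha : P.intended .inCod a a a) (ha' : P.encode[a]? = some .one)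
    (hx : P.intended .inDom x x x) (hx' : P.encode[x]? = some .add) (hc : Child P.encode x j k) :
    P.intended (.token b) x a a ↔ P.intended (.token b) j a a ∧ P.intended (.token b) k a a := by
  obtain ⟨p, Y, hp, rfl⟩ := hx
  obtain ⟨q, B, hq, rfl⟩ := ha
  obtain rfl := Ty.eq_one_of_occ (Ty.occ_sub hq P.occ_cod) ha'
  obtain ⟨B₀, B₁, rfl⟩ := Ty.eq_add_of_occ (Ty.occ_sub hp P.occ_dom) (by simpa using hx')
  obtain ⟨⟨_, h₀⟩, ⟨_, h₁⟩, rfl, rfl⟩ := Child.sub P.occ_dom hp (by simpa using hc)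
  rw [zero_add, zero_add, intended_token hp hq, intended_token h₀ hq, intended_token h₁ hq]
  exact ((P.term b).closed_closure.2 q (Ty.isOneLeaf_iff_sub.2 hq)).dual_add hp

end token

section ok

variable {b c : Bool} {u x a v v' j k : ℕ}

theorem intended_okUnit (hl : P.encode[u]? = some (cond c .tuple₀ .cotuple₀))
    (h : P.intended (.token !b) x a a) : P.intended (.ok b) u x a := by
  rintro p q X' A' t hp hq rfl rfl ho
  have h' := (intended_token hp hq).1 h
  cases c
  · cases t with
    | cotuple₀ => simpa [Term.Sat] using h'
    | _ => exact absurd (ho.getElem?.symm.trans hl) nofun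
  · cases t with
    | tuple₀ => simpa [Term.Sat] using h'
    | _ => exact absurd (ho.getElem?.symm.trans hl) nofun

theorem intended_okInj (hl : P.encode[u]? = some (cond c .inj₁ .inj₀)) (hc : Child P.encode a j k)
    (h : P.intended (.ok b) (u + 1) x (cond c k j)) : P.intended (.ok b) u x a := by
  rintro p q X' A' t hp hq rfl rfl ho
  obtain ⟨-, -, rfl, rfl⟩ := Child.sub P.occ_cod hq hc
  cases c
  · cases t with
    | inj₀ t =>
      simpa [Term.Sat] using h _ _ _ _ t hp ((Ty.sub_append hq _).trans (Ty.sub_nil _)) rfl rfl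
        ho.tail
    | _ => exact absurd (ho.getElem?.symm.trans hl) nofun
  · cases t with
    | inj₁ t =>
      simpa [Term.Sat] using h _ _ _ _ t hp ((Ty.sub_append hq _).trans (Ty.sub_nil _)) rfl rfl
        ho.tail
    | _ => exact absurd (ho.getElem?.symm.trans hl) nofun

theorem intended_okProj (hl : P.encode[u]? = some (cond c .proj₁ .proj₀))
    (hc : Child P.encode x j k) (h : P.intended (.ok b) (u + 1) (cond c k j) a) :
    P.intended (.ok b) u x a := by
  rintro p q X' A' t hp hq rfl rfl ho
  obtain ⟨-, -, rfl, rfl⟩ := Child.sub P.occ_dom hp (by simpa using hc)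
  rw [zero_add, zero_add] at h
  cases c
  · cases t with
    | proj₀ t =>
      simpa [Term.Sat] using h _ _ _ _ t ((Ty.sub_append hp _).trans (Ty.sub_nil _)) hq rfl rfl
        ho.tail
    | _ => exact absurd (ho.getElem?.symm.trans hl) nofun
  · cases t with
    | proj₁ t =>
      simpa [Term.Sat] using h _ _ _ _ t ((Ty.sub_append hp _).trans (Ty.sub_nil _)) hq rfl rfl
        ho.tail
    | _ => exact absurd (ho.getElem?.symm.trans hl) nofun

theorem intended_okCotuple (hl : P.encode[u]? = some .cotuple) (hu : Child P.encode u v v')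
    (hc : Child P.encode x j k) (h : P.intended (.ok b) v j a) (h' : P.intended (.ok b) v' k a) :
    P.intended (.ok b) u x a := by
  rintro p q X' A' t hp hq rfl rfl ho
  obtain ⟨-, -, rfl, rfl⟩ := Child.sub P.occ_dom hp (by simpa using hc)
  rw [zero_add] at h h'
  cases t with
  | cotuple s t =>
    obtain ⟨rfl, rfl⟩ := hu.eq ho s.isExpr_encode
    have h1 := h _ _ _ _ s ((Ty.sub_append hp _).trans (Ty.sub_nil _)) hq rfl rfl ho.tail.left
    have h2 := h' _ _ _ _ t ((Ty.sub_append hp _).trans (Ty.sub_nil _)) hq rfl rfl ho.tail.right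
    simpa [Term.Sat] using And.intro h1 h2
  | _ => exact absurd (ho.getElem?.symm.trans hl) nofun

theorem intended_okTuple (hl : P.encode[u]? = some .tuple) (hu : Child P.encode u v v')
    (hc : Child P.encode a j k) (h : P.intended (.ok b) v x j) (h' : P.intended (.ok b) v' x k) :
    P.intended (.ok b) u x a := by
  rintro p q X' A' t hp hq rfl rfl ho
  obtain ⟨-, -, rfl, rfl⟩ := Child.sub P.occ_cod hq hc
  cases t with
  | tuple s t =>
    obtain ⟨rfl, rfl⟩ := hu.eq ho s.isExpr_encode
    have h1 := h _ _ _ _ s hp ((Ty.sub_append hq _).trans (Ty.sub_nil _)) rfl rfl ho.tail.left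
    have h2 := h' _ _ _ _ t hp ((Ty.sub_append hq _).trans (Ty.sub_nil _)) rfl rfl ho.tail.right
    simpa [Term.Sat] using And.intro h1 h2
  | _ => exact absurd (ho.getElem?.symm.trans hl) nofun

theorem intended_equal (h : P.intended (.ok false) (P.start false) 0 P.dom.size)
    (h' : P.intended (.ok true) (P.start true) 0 P.dom.size) : P.left.denote = P.right.denote := by
  rw [Term.denote_eq_iff_sat]
  exact ⟨h [] [] _ _ P.left (by simp) (by simp) (by simp) (by simp) (P.occ_term false),
    h' [] [] _ _ P.right (by simp) (by simp) (by simp) (by simp) (P.occ_term true)⟩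

end ok

end WordProblem

end SumProd

/-! ### Soundness: the intended interpretation is a model. -/

namespace SumProd
open Datalog

theorem holds_fact {w : List Letter} {I : Rel → ℕ → ℕ → ℕ → Prop} {e : Fin 8 → ℕ} {r : Rel}
    {a b c : Fin 8} : (Cond.fact r a b c).Holds w I e ↔ I r (e a) (e b) (e c) := .rfl

theorem holds_succ {w : List Letter} {I : Rel → ℕ → ℕ → ℕ → Prop} {e : Fin 8 → ℕ} {v v' : Fin 8} :
    (Cond.succ v v').Holds w I e ↔ e v' = e v + 1 := .rfl

theorem holds_zero {w : List Letter} {I : Rel → ℕ → ℕ → ℕ → Prop} {e : Fin 8 → ℕ} {v : Fin 8} :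
    (Cond.zero v).Holds w I e ↔ e v = 0 := .rfl

namespace WordProblem

theorem isModel_intended (P : WordProblem) : IsModel rules P.encode P.intended := by
  rw [isModel_rules]
  intro k e he hb
  cases k <;>
    simp only [rule, List.forall_mem_cons, List.not_mem_nil, false_imp_iff, implies_true, and_true,
      holds_isLetter, holds_hasArity, holds_fact, holds_succ, holds_zero] at hb ⊢
  case endsNullary =>
    obtain ⟨⟨l, hl, hl'⟩, h1⟩ := hb
    exact ⟨[l], .nullary hl', .cons hl ⟨P.encode.drop (e 0 + 1), rfl⟩, h1⟩
  case endsUnary =>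
    obtain ⟨⟨l, hl, hl'⟩, h1, L, hL, ho, h2⟩ := hb
    rw [h1] at ho h2
    exact ⟨l :: L, .unary hl' hL, .cons hl ho, by simp [h2]; omega⟩
  case endsBinary =>
    obtain ⟨⟨l, hl, hl'⟩, h1, ⟨L, hL, ho, h2⟩, L', hL', ho', h3⟩ := hb
    rw [h2, h1] at ho' h3
    rw [h1] at ho
    exact ⟨l :: (L ++ L'), .binary hl' hL hL', .cons hl (ho.append ho'), by simp [h3]; omega⟩
  case cod =>
    obtain ⟨h0, h1⟩ := hb
    have := intended_ends h1 (h0 ▸ P.occ_dom) P.dom.isExpr_encode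
    rw [h0, zero_add, Ty.length_encode] at this
    exact this
  case startLeft =>
    obtain ⟨h0, h1⟩ := hb
    replace h0 : e 0 = P.dom.size := h0
    have := intended_ends h1 (h0 ▸ P.occ_cod) P.cod.isExpr_encode
    rw [h0, Ty.length_encode] at this
    exact this
  case startRight =>
    obtain ⟨h0, h1⟩ := hb
    replace h0 : e 0 = P.start false := h0
    have := intended_ends h1 (h0 ▸ P.occ_term false) (P.term false).isExpr_encode
    rw [h0] at this
    exact this
  case child =>
    obtain ⟨h0, h1, L, hL, ho, h2⟩ := hb
    exact ⟨h0, h1, L, hL, ho, h2⟩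
  case inDom => exact ⟨[], _, Ty.sub_nil _, by simp [hb]⟩
  case inDomChild c =>
    have := intended_inDom_child hb.1 hb.2
    cases c
    · exact this.1
    · exact this.2
  case inCod =>
    replace hb : e 0 = P.dom.size := hb
    exact ⟨[], _, Ty.sub_nil _, by simp [hb]⟩
  case inCodChild c =>
    have := intended_inCod_child hb.1 hb.2
    cases c
    · exact this.1
    · exact this.2
  case place b =>
    obtain ⟨h0, h1, h2⟩ := hb
    replace h1 : e 1 = P.dom.size := h1
    replace h2 : e 2 = P.start b := h2
    exact ⟨0, [], [], _, _, P.term b, .root, by simp [h2], by simp [h0], by simp [h1]⟩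
  case placeInj b c =>
    obtain ⟨h0, h1, h2, h3⟩ := hb
    have := intended_placeInj h0 h1 h3
    rw [h2]
    cases c <;> exact this
  case placeProj b c =>
    obtain ⟨h0, h1, h2, h3⟩ := hb
    have := intended_placeProj h0 h1 h3
    rw [h2]
    cases c <;> exact this
  case placeCotuple b c =>
    obtain ⟨h0, h1, h2, h3⟩ := hb
    have := intended_placeCotuple (c := c) h0 h1 h2 h3
    cases c <;> exact this
  case placeTuple b c =>
    obtain ⟨h0, h1, h2, h3⟩ := hb
    have := intended_placeTuple (c := c) h0 h1 h2 h3
    cases c <;> exact this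
  case unit b c => exact intended_unit hb.1 hb.2
  case zeroAdd b c =>
    obtain ⟨h0, h1, h2, h3, h4, h5⟩ := hb
    have := intended_zeroAdd b h0 h1 h2 h3 h4
    cases c
    · exact this.1.1 h5
    · exact this.2.1 h5
  case zeroAdd' b c =>
    obtain ⟨h0, h1, h2, h3, h4, h5⟩ := hb
    have := intended_zeroAdd b h0 h1 h2 h3 h4
    cases c
    · exact this.1.2 h5
    · exact this.2.2 h5
  case zeroMul b c =>
    obtain ⟨h0, h1, h2, h3, h4, h5⟩ := hb
    have := (intended_zeroMul b h0 h1 h2 h3 h4).1 h5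
    cases c
    · exact this.1
    · exact this.2
  case zeroMul' b =>
    obtain ⟨h0, h1, h2, h3, h4, h5⟩ := hb
    exact (intended_zeroMul b h0 h1 h2 h3 h4).2 h5
  case oneMul b c =>
    obtain ⟨h0, h1, h2, h3, h4, h5⟩ := hb
    have := intended_oneMul b h0 h1 h2 h3 h4
    cases c
    · exact this.1.1 h5
    · exact this.2.1 h5
  case oneMul' b c =>
    obtain ⟨h0, h1, h2, h3, h4, h5⟩ := hb
    have := intended_oneMul b h0 h1 h2 h3 h4
    cases c
    · exact this.1.2 h5
    · exact this.2.2 h5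
  case oneAdd b c =>
    obtain ⟨h0, h1, h2, h3, h4, h5⟩ := hb
    have := (intended_oneAdd b h0 h1 h2 h3 h4).1 h5
    cases c
    · exact this.1
    · exact this.2
  case oneAdd' b =>
    obtain ⟨h0, h1, h2, h3, h4, h5⟩ := hb
    exact (intended_oneAdd b h0 h1 h2 h3 h4).2 h5
  case okUnit b c => exact intended_okUnit hb.1 hb.2
  case okInj b c =>
    obtain ⟨h0, h1, h2, h3⟩ := hb
    rw [h1] at h3
    refine intended_okInj h0 h2 ?_
    cases c <;> exact h3
  case okProj b c =>
    obtain ⟨h0, h1, h2, h3⟩ := hb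
    rw [h1] at h3
    refine intended_okProj h0 h2 ?_
    cases c <;> exact h3
  case okCotuple b =>
    obtain ⟨h0, h1, h2, h3, h4⟩ := hb
    exact intended_okCotuple h0 h1 h2 h3 h4
  case okTuple b =>
    obtain ⟨h0, h1, h2, h3, h4⟩ := hb
    exact intended_okTuple h0 h1 h2 h3 h4
  case equal =>
    obtain ⟨h0, h1, h2, h3, h4, h5⟩ := hb
    replace h1 : e 1 = P.dom.size := h1
    replace h2 : e 2 = P.start false := h2
    replace h3 : e 3 = P.start true := h3
    rw [h0, h1, h2] at h4
    rw [h0, h1, h3] at h5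
    exact intended_equal h4 h5

end WordProblem

end SumProd

/-! ### Completeness of the rules in every model, and the main theorem. -/

namespace SumProd
open Datalog

/-! ### Completeness of the rules -/

theorem forall_mem_two {α : Type} {p : α → Prop} {a b : α} (ha : p a) (hb : p b) :
    ∀ x ∈ [a, b], p x := by simp [*]

theorem forall_mem_three {α : Type} {p : α → Prop} {a b c : α} (ha : p a) (hb : p b) (hc : p c) :
    ∀ x ∈ [a, b, c], p x := by simp [*]

theorem forall_mem_four {α : Type} {p : α → Prop} {a b c d : α} (ha : p a) (hb : p b) (hc : p c)
    (hd : p d) : ∀ x ∈ [a, b, c, d], p x := by simp [*]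

theorem forall_mem_five {α : Type} {p : α → Prop} {a b c d e : α} (ha : p a) (hb : p b) (hc : p c)
    (hd : p d) (he : p e) : ∀ x ∈ [a, b, c, d, e], p x := by simp [*]

theorem forall_mem_six {α : Type} {p : α → Prop} {a b c d e f : α} (ha : p a) (hb : p b) (hc : p c)
    (hd : p d) (he : p e) (hf : p f) : ∀ x ∈ [a, b, c, d, e, f], p x := by simp [*]

theorem forall_mem_seven {α : Type} {p : α → Prop} {a b c d e f g : α} (ha : p a) (hb : p b)
    (hc : p c) (hd : p d) (he : p e) (hf : p f) (hg : p g) :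
    ∀ x ∈ [a, b, c, d, e, f, g], p x := by simp [*]

/-- Checks that an explicit valuation is in range. No rule uses the eighth variable, which is always
set to 0. -/
theorem forall_le {n a b c d e f g : ℕ} (h0 : a ≤ n) (h1 : b ≤ n) (h2 : c ≤ n) (h3 : d ≤ n)
    (h4 : e ≤ n) (h5 : f ≤ n) (h6 : g ≤ n) : ∀ i, ![a, b, c, d, e, f, g, 0] i ≤ n := by
  simp [Fin.forall_fin_succ, *]

section complete

variable {w : List Letter} {I : Rel → ℕ → ℕ → ℕ → Prop}

theorem ends_complete (hI : IsModel rules w I) {L : List Letter} (hL : IsExpr L) {i : ℕ}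
    (ho : Occ w i L) : I .ends i (i + L.length) (i + L.length) := by
  have hle := hL.le ho
  induction hL generalizing i with
  | nullary hl =>
    simp only [List.length_singleton] at hle ⊢
    refine isModel_rules.1 hI .endsNullary ![i, i + 1, 0, 0, 0, 0, 0, 0] ?_
      (forall_mem_two (holds_hasArity.2 ⟨_, ho.getElem?, hl⟩) rfl)
    apply forall_le <;> omega
  | @unary l L hl hL ih =>
    have h := ih ho.tail (hL.le ho.tail)
    have hle' := hL.le ho.tail
    have e : i + (l :: L).length = i + 1 + L.length := by simp; omega
    rw [e]
    refine isModel_rules.1 hI .endsUnary ![i, i + 1, i + 1 + L.length, 0, 0, 0, 0, 0] ?_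
      (forall_mem_three (holds_hasArity.2 ⟨_, ho.getElem?, hl⟩) rfl h)
    apply forall_le <;> omega
  | @binary l L L' hl hL hL' ih ih' =>
    have h := ih ho.tail.left (hL.le ho.tail.left)
    have h' := ih' ho.tail.right (hL'.le ho.tail.right)
    have hle' := hL'.le ho.tail.right
    have e : i + (l :: (L ++ L')).length = i + 1 + L.length + L'.length := by simp; omega
    rw [e]
    refine isModel_rules.1 hI .endsBinary
      ![i, i + 1, i + 1 + L.length, i + 1 + L.length + L'.length, 0, 0, 0, 0] ?_
      (forall_mem_four (holds_hasArity.2 ⟨_, ho.getElem?, hl⟩) rfl h h')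
    apply forall_le <;> omega

/-- The expression at position `i` has subexpressions at positions `j` and `k`, and this is part of
the interpretation. -/
structure Split (w : List Letter) (I : Rel → ℕ → ℕ → ℕ → Prop) (i j k : ℕ) : Prop where
  child : I .child i j k
  le : i ≤ w.length
  left_le : j ≤ w.length
  right_le : k ≤ w.length

theorem split_complete (hI : IsModel rules w I) {l : Letter} {L L' : List Letter}
    (hl : l.arity = 2) (hL : IsExpr L) {i : ℕ} (ho : Occ w i (l :: (L ++ L'))) :
    Split w I i (i + 1) (i + 1 + L.length) := by
  have h := ends_complete hI hL ho.tail.left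
  have hle := hL.le ho.tail.left
  refine ⟨?_, by omega, by omega, hle⟩
  refine isModel_rules.1 hI .child ![i, i + 1, i + 1 + L.length, 0, 0, 0, 0, 0] ?_
    (forall_mem_three (holds_hasArity.2 ⟨_, ho.getElem?, hl⟩) rfl h)
  apply forall_le <;> omega

theorem Ty.split_complete (hI : IsModel rules w I) {T Y Z : Ty} {i : ℕ} (hT : Occ w i T.encode)
    {p : List Bool} (hp : T.sub p = some (.add Y Z) ∨ T.sub p = some (.mul Y Z)) :
    Split w I (i + T.pos p) (i + T.pos (p ++ [false])) (i + T.pos (p ++ [true])) := by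
  rcases hp with hp | hp
  all_goals
    have h := SumProd.split_complete hI rfl Y.isExpr_encode (Ty.occ_sub hp hT)
    rw [Ty.length_encode] at h
    rw [Ty.pos_append hp, Ty.pos_append hp]
    simp only [Ty.pos, Ty.pos_nil, add_zero]
    have e : i + (T.pos p + (1 + Y.size)) = i + T.pos p + 1 + Y.size := by ring
    rw [← add_assoc i _ 1, e]
    exact h

/-- A property passed from expressions to their two parts reaches every node. It is used for both
`inDom` and `inCod`. -/
theorem Ty.node_complete (hI : IsModel rules w I) {J : ℕ → Prop}
    (hJ : ∀ i j k, Split w I i j k → J i → J j ∧ J k) {T Y : Ty} {i : ℕ} (hT : Occ w i T.encode)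
    (hi : J i) {p : List Bool} (hp : T.sub p = some Y) : J (i + T.pos p) := by
  induction T generalizing i p with
  | zero | one => cases p <;> simp_all [sub]
  | add T₀ T₁ ih₀ ih₁ | mul T₀ T₁ ih₀ ih₁ =>
    have h := hJ _ _ _ (SumProd.split_complete hI rfl T₀.isExpr_encode hT) hi
    rw [Ty.length_encode] at h
    rcases p with _ | ⟨_ | _, p⟩
    · simpa using hi
    · simpa only [pos, add_assoc] using ih₀ hT.tail.left h.1 hp
    · have := ih₁ hT.tail.right (by rw [Ty.length_encode]; exact h.2) hp
      simpa only [pos, add_assoc, Ty.length_encode] using this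

end complete

namespace WordProblem

variable {P : WordProblem} {I : Rel → ℕ → ℕ → ℕ → Prop}

theorem dom_lt {p : List Bool} {Y : Ty} (hp : P.dom.sub p = some Y) :
    P.dom.pos p < P.encode.length := by
  simpa using Y.isExpr_encode.lt (Ty.occ_sub hp P.occ_dom)

theorem cod_lt {p : List Bool} {Y : Ty} (hp : P.cod.sub p = some Y) :
    P.dom.size + P.cod.pos p < P.encode.length :=
  Y.isExpr_encode.lt (Ty.occ_sub hp P.occ_cod)

theorem cod_complete (hI : IsModel rules P.encode I) : I .cod P.dom.size P.dom.size P.dom.size := by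
  have h := ends_complete hI P.dom.isExpr_encode P.occ_dom
  rw [zero_add, Ty.length_encode] at h
  have := cod_lt (P := P) (Ty.sub_nil _)
  simp only [Ty.pos_nil, add_zero] at this
  refine isModel_rules.1 hI .cod ![0, P.dom.size, 0, 0, 0, 0, 0, 0] ?_ (forall_mem_two rfl h)
  apply forall_le <;> omega

theorem start_lt (P : WordProblem) (b : Bool) : P.start b < P.encode.length :=
  (P.term b).isExpr_encode.lt (P.occ_term b)

theorem start_complete (hI : IsModel rules P.encode I) (b : Bool) :
    I (.start b) (P.start b) (P.start b) (P.start b) := by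
  have h1 := cod_lt (P := P) (Ty.sub_nil _)
  simp only [Ty.pos_nil, add_zero] at h1
  have h2 := P.start_lt false
  have h3 := P.start_lt true
  have hl : I (.start false) (P.start false) (P.start false) (P.start false) := by
    have h := ends_complete hI P.cod.isExpr_encode P.occ_cod
    rw [Ty.length_encode] at h
    refine isModel_rules.1 hI .startLeft ![P.dom.size, P.start false, 0, 0, 0, 0, 0, 0] ?_
      (forall_mem_two (cod_complete hI) h)
    apply forall_le <;> omega
  cases b
  · exact hl
  · have h := ends_complete hI (P.term false).isExpr_encode (P.occ_term false)
    refine isModel_rules.1 hI .startRight ![P.start false, P.start true, 0, 0, 0, 0, 0, 0] ?_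
      (forall_mem_two hl h)
    apply forall_le <;> omega

theorem inDom_complete (hI : IsModel rules P.encode I) {p : List Bool} {Y : Ty}
    (hp : P.dom.sub p = some Y) : I .inDom (P.dom.pos p) (P.dom.pos p) (P.dom.pos p) := by
  have := Ty.node_complete hI (J := fun i => I .inDom i i i) (fun i j k h hi => ⟨?_, ?_⟩) P.occ_dom
    ?_ hp
  · simpa using this
  · refine isModel_rules.1 hI (.inDomChild false) ![i, j, k, 0, 0, 0, 0, 0] ?_
      (forall_mem_two hi h.child)
    have := h.le; have := h.left_le; have := h.right_le
    apply forall_le <;> omega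
  · refine isModel_rules.1 hI (.inDomChild true) ![i, j, k, 0, 0, 0, 0, 0] ?_
      (forall_mem_two hi h.child)
    have := h.le; have := h.left_le; have := h.right_le
    apply forall_le <;> omega
  · refine isModel_rules.1 hI .inDom ![0, 0, 0, 0, 0, 0, 0, 0] ?_ (List.forall_mem_singleton.2 rfl)
    apply forall_le <;> omega

theorem inCod_complete (hI : IsModel rules P.encode I) {p : List Bool} {Y : Ty}
    (hp : P.cod.sub p = some Y) :
    I .inCod (P.dom.size + P.cod.pos p) (P.dom.size + P.cod.pos p) (P.dom.size + P.cod.pos p) := by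
  refine Ty.node_complete hI (J := fun i => I .inCod i i i) (fun i j k h hi => ⟨?_, ?_⟩) P.occ_cod
    ?_ hp
  · refine isModel_rules.1 hI (.inCodChild false) ![i, j, k, 0, 0, 0, 0, 0] ?_
      (forall_mem_two hi h.child)
    have := h.le; have := h.left_le; have := h.right_le
    apply forall_le <;> omega
  · refine isModel_rules.1 hI (.inCodChild true) ![i, j, k, 0, 0, 0, 0, 0] ?_
      (forall_mem_two hi h.child)
    have := h.le; have := h.left_le; have := h.right_le
    apply forall_le <;> omega
  · have h1 := cod_lt (P := P) (Ty.sub_nil _)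
    simp only [Ty.pos_nil, add_zero] at h1
    refine isModel_rules.1 hI .inCod ![P.dom.size, 0, 0, 0, 0, 0, 0, 0] ?_
      (List.forall_mem_singleton.2 (cod_complete hI))
    apply forall_le <;> omega

theorem split_dom (hI : IsModel rules P.encode I) {Y Z : Ty} {p : List Bool}
    (hp : P.dom.sub p = some (.add Y Z) ∨ P.dom.sub p = some (.mul Y Z)) :
    Split P.encode I (P.dom.pos p) (P.dom.pos (p ++ [false])) (P.dom.pos (p ++ [true])) := by
  simpa using Ty.split_complete hI P.occ_dom hp

theorem split_cod (hI : IsModel rules P.encode I) {Y Z : Ty} {p : List Bool}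
    (hp : P.cod.sub p = some (.add Y Z) ∨ P.cod.sub p = some (.mul Y Z)) :
    Split P.encode I (P.dom.size + P.cod.pos p) (P.dom.size + P.cod.pos (p ++ [false]))
      (P.dom.size + P.cod.pos (p ++ [true])) := Ty.split_complete hI P.occ_cod hp

theorem place_complete (hI : IsModel rules P.encode I) {b : Bool} {u : ℕ} {p q : List Bool}
    {X' A' : Ty} {t : Term X' A'} (h : (P.term b).Place u p q t) :
    I (.place b) (P.start b + u) (P.dom.pos p) (P.dom.size + P.cod.pos q) := by
  induction h with
  | root =>
    simp only [Ty.pos_nil, add_zero]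
    have h1 := cod_lt (P := P) (Ty.sub_nil _)
    simp only [Ty.pos_nil, add_zero] at h1
    have h2 := P.start_lt b
    refine isModel_rules.1 hI (.place b) ![0, P.dom.size, P.start b, 0, 0, 0, 0, 0] ?_
      (forall_mem_three rfl (cod_complete hI) (start_complete hI b))
    apply forall_le <;> omega
  | @inj₀ X' A' B' u p q t h ih =>
    have ho := h.occ (P.occ_term b)
    have hs := split_cod hI (.inl h.sub_cod)
    have := ho.lt; have := dom_lt h.sub_dom; have := hs.le; have := hs.left_le; have := hs.right_le
    refine isModel_rules.1 hI (.placeInj b false) ![P.start b + u, P.dom.pos p,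
      P.dom.size + P.cod.pos q, P.start b + u + 1, P.dom.size + P.cod.pos (q ++ [false]),
      P.dom.size + P.cod.pos (q ++ [true]), 0, 0] ?_
      (forall_mem_four ih (holds_isLetter.2 ho.getElem?) rfl hs.child)
    apply forall_le <;> omega
  | @inj₁ X' A' B' u p q t h ih =>
    have ho := h.occ (P.occ_term b)
    have hs := split_cod hI (.inl h.sub_cod)
    have := ho.lt; have := dom_lt h.sub_dom; have := hs.le; have := hs.left_le; have := hs.right_le
    refine isModel_rules.1 hI (.placeInj b true) ![P.start b + u, P.dom.pos p,
      P.dom.size + P.cod.pos q, P.start b + u + 1, P.dom.size + P.cod.pos (q ++ [false]),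
      P.dom.size + P.cod.pos (q ++ [true]), 0, 0] ?_
      (forall_mem_four ih (holds_isLetter.2 ho.getElem?) rfl hs.child)
    apply forall_le <;> omega
  | @proj₀ X' Y' A' u p q t h ih =>
    have ho := h.occ (P.occ_term b)
    have hs := split_dom hI (.inr h.sub_dom)
    have := ho.lt; have := cod_lt h.sub_cod; have := hs.le; have := hs.left_le; have := hs.right_le
    refine isModel_rules.1 hI (.placeProj b false) ![P.start b + u, P.dom.pos p,
      P.dom.size + P.cod.pos q, P.start b + u + 1, P.dom.pos (p ++ [false]),
      P.dom.pos (p ++ [true]), 0, 0] ?_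
      (forall_mem_four ih (holds_isLetter.2 ho.getElem?) rfl hs.child)
    apply forall_le <;> omega
  | @proj₁ X' Y' A' u p q t h ih =>
    have ho := h.occ (P.occ_term b)
    have hs := split_dom hI (.inr h.sub_dom)
    have := ho.lt; have := cod_lt h.sub_cod; have := hs.le; have := hs.left_le; have := hs.right_le
    refine isModel_rules.1 hI (.placeProj b true) ![P.start b + u, P.dom.pos p,
      P.dom.size + P.cod.pos q, P.start b + u + 1, P.dom.pos (p ++ [false]),
      P.dom.pos (p ++ [true]), 0, 0] ?_
      (forall_mem_four ih (holds_isLetter.2 ho.getElem?) rfl hs.child)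
    apply forall_le <;> omega
  | @cotuple_left X' Y' A' u p q s t h ih =>
    have ho := h.occ (P.occ_term b)
    have hs := split_dom hI (.inl h.sub_dom)
    have hu := split_complete hI rfl s.isExpr_encode ho
    have := hu.le; have := hu.left_le; have := hu.right_le
    have := cod_lt h.sub_cod; have := hs.le; have := hs.left_le; have := hs.right_le
    refine isModel_rules.1 hI (.placeCotuple b false) ![P.start b + u, P.dom.pos p,
      P.dom.size + P.cod.pos q, P.start b + u + 1, P.dom.pos (p ++ [false]),
      P.dom.pos (p ++ [true]), P.start b + u + 1 + s.encode.length, 0] ?_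
      (forall_mem_four ih (holds_isLetter.2 ho.getElem?) hu.child hs.child)
    apply forall_le <;> omega
  | @cotuple_right X' Y' A' u p q s t h ih =>
    have ho := h.occ (P.occ_term b)
    have hs := split_dom hI (.inl h.sub_dom)
    have hu := split_complete hI rfl s.isExpr_encode ho
    have := hu.le; have := hu.left_le; have := hu.right_le
    have := cod_lt h.sub_cod; have := hs.le; have := hs.left_le; have := hs.right_le
    rw [← add_assoc, ← add_assoc]
    refine isModel_rules.1 hI (.placeCotuple b true) ![P.start b + u, P.dom.pos p,
      P.dom.size + P.cod.pos q, P.start b + u + 1, P.dom.pos (p ++ [false]),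
      P.dom.pos (p ++ [true]), P.start b + u + 1 + s.encode.length, 0] ?_
      (forall_mem_four ih (holds_isLetter.2 ho.getElem?) hu.child hs.child)
    apply forall_le <;> omega
  | @tuple_left X' A' B' u p q s t h ih =>
    have ho := h.occ (P.occ_term b)
    have hs := split_cod hI (.inr h.sub_cod)
    have hu := split_complete hI rfl s.isExpr_encode ho
    have := hu.le; have := hu.left_le; have := hu.right_le
    have := dom_lt h.sub_dom; have := hs.le; have := hs.left_le; have := hs.right_le
    refine isModel_rules.1 hI (.placeTuple b false) ![P.start b + u, P.dom.pos p,
      P.dom.size + P.cod.pos q, P.start b + u + 1, P.dom.size + P.cod.pos (q ++ [false]),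
      P.dom.size + P.cod.pos (q ++ [true]), P.start b + u + 1 + s.encode.length, 0] ?_
      (forall_mem_four ih (holds_isLetter.2 ho.getElem?) hu.child hs.child)
    apply forall_le <;> omega
  | @tuple_right X' A' B' u p q s t h ih =>
    have ho := h.occ (P.occ_term b)
    have hs := split_cod hI (.inr h.sub_cod)
    have hu := split_complete hI rfl s.isExpr_encode ho
    have := hu.le; have := hu.left_le; have := hu.right_le
    have := dom_lt h.sub_dom; have := hs.le; have := hs.left_le; have := hs.right_le
    rw [← add_assoc, ← add_assoc]
    refine isModel_rules.1 hI (.placeTuple b true) ![P.start b + u, P.dom.pos p,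
      P.dom.size + P.cod.pos q, P.start b + u + 1, P.dom.size + P.cod.pos (q ++ [false]),
      P.dom.size + P.cod.pos (q ++ [true]), P.start b + u + 1 + s.encode.length, 0] ?_
      (forall_mem_four ih (holds_isLetter.2 ho.getElem?) hu.child hs.child)
    apply forall_le <;> omega

/-- The tokens in an interpretation. -/
def Token (P : WordProblem) (I : Rel → ℕ → ℕ → ℕ → Prop) (b : Bool) (p q : List Bool) : Prop :=
  I (.token b) (P.dom.pos p) (P.dom.size + P.cod.pos q) (P.dom.size + P.cod.pos q)

theorem sat_token (hI : IsModel rules P.encode I) (b : Bool) : (P.term b).Sat (P.Token I b) := by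
  refine (Term.Place.root (f := P.term b)).sat_of_units (fun A' u p q h => ?_) fun A' u p q h => ?_
  · have ho := h.occ (P.occ_term b)
    have := ho.lt; have := dom_lt h.sub_dom; have := cod_lt h.sub_cod
    refine isModel_rules.1 hI (.unit b false) ![P.start b + u, P.dom.pos p,
      P.dom.size + P.cod.pos q, 0, 0, 0, 0, 0] ?_
      (forall_mem_two (place_complete hI h) (holds_isLetter.2 ho.getElem?))
    apply forall_le <;> omega
  · have ho := h.occ (P.occ_term b)
    have := ho.lt; have := dom_lt h.sub_dom; have := cod_lt h.sub_cod
    refine isModel_rules.1 hI (.unit b true) ![P.start b + u, P.dom.pos p,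
      P.dom.size + P.cod.pos q, 0, 0, 0, 0, 0] ?_
      (forall_mem_two (place_complete hI h) (holds_isLetter.2 ho.getElem?))
    apply forall_le <;> omega

theorem stable_cod_token (hI : IsModel rules P.encode I) (b : Bool) {p : List Bool}
    (hp : P.dom.sub p = some .zero) : P.cod.Stable (P.Token I b p) := by
  have hx := inDom_complete hI hp
  have hx' : P.encode[P.dom.pos p]? = some .zero := by
    simpa using (Ty.occ_sub hp P.occ_dom).getElem?
  have hlt := dom_lt hp
  refine Ty.stable_of_sub (fun q B C hq => ?_) fun q B C hq => ?_
  · have hs := split_cod hI (.inl hq)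
    have ha := inCod_complete hI hq
    have ha' := (Ty.occ_sub hq P.occ_cod).getElem?
    have hle : ∀ i, ![P.dom.pos p, P.dom.size + P.cod.pos q, P.dom.size + P.cod.pos (q ++ [false]),
        P.dom.size + P.cod.pos (q ++ [true]), 0, 0, 0, 0] i ≤ P.encode.length := by
      have := hs.le; have := hs.left_le; have := hs.right_le
      apply forall_le <;> omega
    refine ⟨⟨fun h => isModel_rules.1 hI (.zeroAdd b false) _ hle (forall_mem_six hx
      (holds_isLetter.2 hx') ha (holds_isLetter.2 ha') hs.child h),
      fun h => isModel_rules.1 hI (.zeroAdd' b false) _ hle (forall_mem_six hx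
      (holds_isLetter.2 hx') ha (holds_isLetter.2 ha') hs.child h)⟩,
      fun h => isModel_rules.1 hI (.zeroAdd b true) _ hle (forall_mem_six hx
      (holds_isLetter.2 hx') ha (holds_isLetter.2 ha') hs.child h),
      fun h => isModel_rules.1 hI (.zeroAdd' b true) _ hle (forall_mem_six hx
      (holds_isLetter.2 hx') ha (holds_isLetter.2 ha') hs.child h)⟩
  · have hs := split_cod hI (.inr hq)
    have ha := inCod_complete hI hq
    have ha' := (Ty.occ_sub hq P.occ_cod).getElem?
    have hle : ∀ i, ![P.dom.pos p, P.dom.size + P.cod.pos q, P.dom.size + P.cod.pos (q ++ [false]),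
        P.dom.size + P.cod.pos (q ++ [true]), 0, 0, 0, 0] i ≤ P.encode.length := by
      have := hs.le; have := hs.left_le; have := hs.right_le
      apply forall_le <;> omega
    exact ⟨fun h => ⟨isModel_rules.1 hI (.zeroMul b false) _ hle (forall_mem_six hx
      (holds_isLetter.2 hx') ha (holds_isLetter.2 ha') hs.child h),
      isModel_rules.1 hI (.zeroMul b true) _ hle (forall_mem_six hx
      (holds_isLetter.2 hx') ha (holds_isLetter.2 ha') hs.child h)⟩,
      fun h => isModel_rules.1 hI (.zeroMul' b) _ hle (forall_mem_seven hx
      (holds_isLetter.2 hx') ha (holds_isLetter.2 ha') hs.child h.1 h.2)⟩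

theorem stable_dom_token (hI : IsModel rules P.encode I) (b : Bool) {q : List Bool}
    (hq : P.cod.sub q = some .one) : P.dom.dual.Stable fun p => P.Token I b p q := by
  have ha := inCod_complete hI hq
  have ha' := (Ty.occ_sub hq P.occ_cod).getElem?
  have hlt := cod_lt hq
  refine Ty.stable_dual_of_sub (fun p B C hp => ?_) fun p B C hp => ?_
  · have hs := split_dom hI (.inr hp)
    have hx := inDom_complete hI hp
    have hx' : P.encode[P.dom.pos p]? = some .mul := by
      simpa using (Ty.occ_sub hp P.occ_dom).getElem?
    have hle : ∀ i, ![P.dom.size + P.cod.pos q, P.dom.pos p, P.dom.pos (p ++ [false]),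
        P.dom.pos (p ++ [true]), 0, 0, 0, 0] i ≤ P.encode.length := by
      have := hs.le; have := hs.left_le; have := hs.right_le
      apply forall_le <;> omega
    refine ⟨⟨fun h => isModel_rules.1 hI (.oneMul b false) _ hle (forall_mem_six ha
      (holds_isLetter.2 ha') hx (holds_isLetter.2 hx') hs.child h),
      fun h => isModel_rules.1 hI (.oneMul' b false) _ hle (forall_mem_six ha
      (holds_isLetter.2 ha') hx (holds_isLetter.2 hx') hs.child h)⟩,
      fun h => isModel_rules.1 hI (.oneMul b true) _ hle (forall_mem_six ha
      (holds_isLetter.2 ha') hx (holds_isLetter.2 hx') hs.child h),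
      fun h => isModel_rules.1 hI (.oneMul' b true) _ hle (forall_mem_six ha
      (holds_isLetter.2 ha') hx (holds_isLetter.2 hx') hs.child h)⟩
  · have hs := split_dom hI (.inl hp)
    have hx := inDom_complete hI hp
    have hx' : P.encode[P.dom.pos p]? = some .add := by
      simpa using (Ty.occ_sub hp P.occ_dom).getElem?
    have hle : ∀ i, ![P.dom.size + P.cod.pos q, P.dom.pos p, P.dom.pos (p ++ [false]),
        P.dom.pos (p ++ [true]), 0, 0, 0, 0] i ≤ P.encode.length := by
      have := hs.le; have := hs.left_le; have := hs.right_le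
      apply forall_le <;> omega
    exact ⟨fun h => ⟨isModel_rules.1 hI (.oneAdd b false) _ hle (forall_mem_six ha
      (holds_isLetter.2 ha') hx (holds_isLetter.2 hx') hs.child h),
      isModel_rules.1 hI (.oneAdd b true) _ hle (forall_mem_six ha
      (holds_isLetter.2 ha') hx (holds_isLetter.2 hx') hs.child h)⟩,
      fun h => isModel_rules.1 hI (.oneAdd' b) _ hle (forall_mem_seven ha
      (holds_isLetter.2 ha') hx (holds_isLetter.2 hx') hs.child h.1 h.2)⟩

/-- The closure is the least closed set, so it suffices that the tokens of a model are closed and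
contain the units of the term. -/
theorem token_complete (hI : IsModel rules P.encode I) {b : Bool} {p q : List Bool}
    (h : (P.term b).closure p q) : P.Token I b p q :=
  h _ ⟨fun _ hp => stable_cod_token hI b (Ty.isZeroLeaf_iff_sub.1 hp),
    fun _ hq => stable_dom_token hI b (Ty.isOneLeaf_iff_sub.1 hq)⟩ (sat_token hI b)

/-- The check is assembled from the units upwards along the term, while the paths follow the types
of the subterms. -/
theorem ok_complete (hI : IsModel rules P.encode I) {b : Bool} {u : ℕ} {p q : List Bool}
    {X' A' : Ty} {t : Term X' A'} (hp : P.dom.sub p = some X') (hq : P.cod.sub q = some A')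
    (ho : Occ P.encode u t.encode)
    (h : t.Sat fun p' q' => (P.term !b).closure (p ++ p') (q ++ q')) :
    I (.ok b) u (P.dom.pos p) (P.dom.size + P.cod.pos q) := by
  have hu' := t.isExpr_encode.lt ho
  have hp' := dom_lt hp
  have hq' := cod_lt hq
  induction t generalizing u p q with
  | cotuple₀ =>
    refine isModel_rules.1 hI (.okUnit b false) ![u, P.dom.pos p, P.dom.size + P.cod.pos q, 0, 0, 0,
      0, 0] ?_ (forall_mem_two (holds_isLetter.2 ho.getElem?)
        (token_complete hI (by simpa [Term.Sat] using h)))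
    apply forall_le <;> omega
  | tuple₀ =>
    refine isModel_rules.1 hI (.okUnit b true) ![u, P.dom.pos p, P.dom.size + P.cod.pos q, 0, 0, 0,
      0, 0] ?_ (forall_mem_two (holds_isLetter.2 ho.getElem?)
        (token_complete hI (by simpa [Term.Sat] using h)))
    apply forall_le <;> omega
  | inj₀ t ih =>
    have hs := split_cod hI (.inl hq)
    have := hs.left_le; have := hs.right_le
    have hq₀ := (Ty.sub_append hq [false]).trans (Ty.sub_nil _)
    have h' := ih hp hq₀ ho.tail (by simpa [Term.Sat] using h) (t.isExpr_encode.lt ho.tail) hp'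
      (cod_lt hq₀)
    refine isModel_rules.1 hI (.okInj b false) ![u, P.dom.pos p, P.dom.size + P.cod.pos q, u + 1,
      P.dom.size + P.cod.pos (q ++ [false]), P.dom.size + P.cod.pos (q ++ [true]), 0, 0] ?_
      (forall_mem_four (holds_isLetter.2 ho.getElem?) rfl hs.child h')
    apply forall_le <;> omega
  | inj₁ t ih =>
    have hs := split_cod hI (.inl hq)
    have := hs.left_le; have := hs.right_le
    have hq₁ := (Ty.sub_append hq [true]).trans (Ty.sub_nil _)
    have h' := ih hp hq₁ ho.tail (by simpa [Term.Sat] using h) (t.isExpr_encode.lt ho.tail) hp'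
      (cod_lt hq₁)
    refine isModel_rules.1 hI (.okInj b true) ![u, P.dom.pos p, P.dom.size + P.cod.pos q, u + 1,
      P.dom.size + P.cod.pos (q ++ [false]), P.dom.size + P.cod.pos (q ++ [true]), 0, 0] ?_
      (forall_mem_four (holds_isLetter.2 ho.getElem?) rfl hs.child h')
    apply forall_le <;> omega
  | proj₀ t ih =>
    have hs := split_dom hI (.inr hp)
    have := hs.left_le; have := hs.right_le
    have hp₀ := (Ty.sub_append hp [false]).trans (Ty.sub_nil _)
    have h' := ih hp₀ hq ho.tail (by simpa [Term.Sat] using h) (t.isExpr_encode.lt ho.tail)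
      (dom_lt hp₀) hq'
    refine isModel_rules.1 hI (.okProj b false) ![u, P.dom.pos p, P.dom.size + P.cod.pos q, u + 1,
      P.dom.pos (p ++ [false]), P.dom.pos (p ++ [true]), 0, 0] ?_
      (forall_mem_four (holds_isLetter.2 ho.getElem?) rfl hs.child h')
    apply forall_le <;> omega
  | proj₁ t ih =>
    have hs := split_dom hI (.inr hp)
    have := hs.left_le; have := hs.right_le
    have hp₁ := (Ty.sub_append hp [true]).trans (Ty.sub_nil _)
    have h' := ih hp₁ hq ho.tail (by simpa [Term.Sat] using h) (t.isExpr_encode.lt ho.tail)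
      (dom_lt hp₁) hq'
    refine isModel_rules.1 hI (.okProj b true) ![u, P.dom.pos p, P.dom.size + P.cod.pos q, u + 1,
      P.dom.pos (p ++ [false]), P.dom.pos (p ++ [true]), 0, 0] ?_
      (forall_mem_four (holds_isLetter.2 ho.getElem?) rfl hs.child h')
    apply forall_le <;> omega
  | cotuple s t ihs iht =>
    have hs := split_dom hI (.inl hp)
    have hu := split_complete hI rfl s.isExpr_encode ho
    have := hs.left_le; have := hs.right_le; have := hu.left_le; have := hu.right_le
    have hp₀ := (Ty.sub_append hp [false]).trans (Ty.sub_nil _)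
    have hp₁ := (Ty.sub_append hp [true]).trans (Ty.sub_nil _)
    have h₀ := ihs hp₀ hq ho.tail.left (by simpa [Term.Sat] using h.1)
      (s.isExpr_encode.lt ho.tail.left) (dom_lt hp₀) hq'
    have h₁ := iht hp₁ hq ho.tail.right (by simpa [Term.Sat] using h.2)
      (t.isExpr_encode.lt ho.tail.right) (dom_lt hp₁) hq'
    refine isModel_rules.1 hI (.okCotuple b) ![u, P.dom.pos p, P.dom.size + P.cod.pos q, u + 1,
      P.dom.pos (p ++ [false]), P.dom.pos (p ++ [true]), u + 1 + s.encode.length, 0] ?_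
      (forall_mem_five (holds_isLetter.2 ho.getElem?) hu.child hs.child h₀ h₁)
    apply forall_le <;> omega
  | tuple s t ihs iht =>
    have hs := split_cod hI (.inr hq)
    have hu := split_complete hI rfl s.isExpr_encode ho
    have := hs.left_le; have := hs.right_le; have := hu.left_le; have := hu.right_le
    have hq₀ := (Ty.sub_append hq [false]).trans (Ty.sub_nil _)
    have hq₁ := (Ty.sub_append hq [true]).trans (Ty.sub_nil _)
    have h₀ := ihs hp hq₀ ho.tail.left (by simpa [Term.Sat] using h.1)
      (s.isExpr_encode.lt ho.tail.left) hp' (cod_lt hq₀)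
    have h₁ := iht hp hq₁ ho.tail.right (by simpa [Term.Sat] using h.2)
      (t.isExpr_encode.lt ho.tail.right) hp' (cod_lt hq₁)
    refine isModel_rules.1 hI (.okTuple b) ![u, P.dom.pos p, P.dom.size + P.cod.pos q, u + 1,
      P.dom.size + P.cod.pos (q ++ [false]), P.dom.size + P.cod.pos (q ++ [true]),
      u + 1 + s.encode.length, 0] ?_
      (forall_mem_five (holds_isLetter.2 ho.getElem?) hu.child hs.child h₀ h₁)
    apply forall_le <;> omega

/-- One direction evaluates derivability in the intended model. For the other,
`Term.denote_eq_iff_sat` supplies both inclusions of tokens, which every model verifies. -/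
theorem derivable_equal_iff (P : WordProblem) :
    Derivable rules P.encode .equal 0 0 0 ↔ P.left.denote = P.right.denote := by
  refine ⟨fun h => h P.intended P.isModel_intended, fun h I hI => ?_⟩
  obtain ⟨h₀, h₁⟩ := Term.denote_eq_iff_sat.1 h
  have ok : ∀ b, (P.term b).Sat (P.term !b).closure →
      I (.ok b) (P.start b) 0 P.dom.size := fun b h => by
    simpa using ok_complete hI (b := b) (p := []) (q := []) (Ty.sub_nil _) (Ty.sub_nil _)
      (P.occ_term b) (by simpa using h)
  have h1 := cod_lt (P := P) (Ty.sub_nil _)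
  simp only [Ty.pos_nil, add_zero] at h1
  have h2 := P.start_lt false
  have h3 := P.start_lt true
  refine isModel_rules.1 hI .equal ![0, P.dom.size, P.start false, P.start true, 0, 0, 0, 0] ?_
    (forall_mem_six rfl (cod_complete hI) (start_complete hI false) (start_complete hI true)
      (ok false h₀) (ok true h₁))
  apply forall_le <;> omega

theorem length_encode_le (P : WordProblem) : P.encode.length ≤ 4 * (P.dom.size * P.cod.size) := by
  have h1 := P.left.length_encode_le
  have h2 := P.right.length_encode_le
  have h3 := P.dom.size_pos
  have h4 := P.cod.size_pos
  simp only [encode, List.length_append, Ty.length_encode]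
  nlinarith

theorem encode_ne_nil (P : WordProblem) : P.encode ≠ [] := by
  have := dom_lt (P := P) (Ty.sub_nil _)
  exact List.ne_nil_of_length_pos (by omega)

end WordProblem

theorem monotone_eval (p : Polynomial ℕ) : Monotone fun n => p.eval n := fun m n h => by
  simp only [Polynomial.eval_eq_sum_range]
  gcongr

end SumProd

theorem mainTheorem2 :
    SumProd.DecidableInPolyTime SumProd.WordProblem.encode
      (fun w : SumProd.WordProblem => w.dom.size * w.cod.size)
      (fun w : SumProd.WordProblem => w.left.denote = w.right.denote) := by
  -- There are 14 relation symbols, within the bound 32.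
  obtain ⟨M, p, hM, h⟩ := Datalog.exists_machine SumProd.rules .equal (by decide)
  -- The factor 4 comes from |X| + |A| + 2·|X|·|A| ≤ 4·|X|·|A|, a bound for the length of the input
  -- word.
  refine ⟨M, p.comp (4 * .X), hM, fun P => ?_⟩
  obtain ⟨b, hb, ⟨hout⟩⟩ := h P.encode P.encode_ne_nil
  refine ⟨b, hb.trans P.derivable_equal_iff, ⟨⟨hout.toEvalsTo, hout.steps_le_m.trans ?_⟩⟩⟩
  have := SumProd.monotone_eval p P.length_encode_le
  simpa using this
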